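/- Let $\bar M$ be a connected smooth 4-manifold with non-empty compact boundary $\partial M$ and interior $M$, and let $g$ be a smooth Riemannian metric on $M$ with $\mathrm{Ric}_g=-3g$. Let $\bar g$ be a continuous Riemannian metric on $\bar M$ with $\bar g=t^2g$ on $M$, where $t:\bar M\to[0,\infty)$ satisfies $t>0$ on $M$, $t=0$ and $dt\neq0$ on $\partial M$, $|\bar\nabla t|_{\bar g}=1$ near $\partial M$, and $t(x)=\mathrm{dist}_{\bar g}(x,\partial M)$ for all $x\in\bar M$. The cut locus $\bar C\subset M$ is the set of points of $M$ that do not lie in the interior of any unit speed $C^1$ curve issuing from $\partial M$ that minimizes the $\bar g$-distance to $\partial M$. Assume that $\bar g$ is a $C^2$ geodesic compactification of $g$, that is, $t$ and $\bar g$ are of class $C^2$ near every point of $\bar M\setminus\bar C$ (up to the boundary). Let $\gamma=\bar g|_{\partial M}$, and let $\bar s$ and $s_\gamma$ be the scalar curvatures of $\bar g$ (on $\bar M\setminus\bar C$) and of $\gamma$. Then: 1. For each $x\in M\setminus\bar C$, the integral curves of $\bar\nabla t$ through $x$ exist locally, and the derivative of $\bar s$ along any of them at $x$ exists and equals $$\bar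 s'(x)=6\,t^{-1}|\bar D^2t|^2(x)\ \ge\ 0 ,$$ where $\bar D^2t$ is the Hessian of $t$ and the norm is that of $\bar g$. If $\bar s$ is differentiable at $x$, then also $\langle\bar\nabla\bar s,\bar\nabla t\rangle(x)=6\,t^{-1}|\bar D^2t|^2(x)$. 2. On $\partial M$ one has $\bar s=\tfrac32 s_\gamma$. 3. There is $p\in\partial M$ at which both $\bar s|_{\partial M}$ and $s_\gamma$ attain their minima, and $\bar s(x)\ge\bar s(p)=\tfrac32 s_\gamma(p)$ for all $x\in\bar M\setminus\bar C$. Thus $\bar s$ is bounded below on $\bar M\setminus\bar C$ by the minimum of its boundary values, which is $\tfrac32\min_{\partial M}s_\gamma$. -/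

import Mathlib

open Set Filter Topology Manifold Bundle
open scoped ContDiff ENNReal

noncomputable section

/-! ## Riemannian geometry in coordinates

`G` is the matrix `(g_ij)` of a metric as a function of coordinates in `ℝⁿ`, and `s` is the set on
which the coordinates live: `univ` for an ordinary chart, a closed half-space for a chart of a
manifold with boundary. Derivatives are taken within `s`, so that at boundary points of a
half-space they are the one-sided ones. -/

/-- The partial derivative `∂ᵢ f (y)` within `s`. -/
def partialDerivWithin {n : ℕ} (s : Set (EuclideanSpace ℝ (Fin n)))
    (f : EuclideanSpace ℝ (Fin n) → ℝ) (i : Fin n) (y : EuclideanSpace ℝ (Fin n)) : ℝ :=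
  fderivWithin ℝ f s y (EuclideanSpace.single i (1 : ℝ))

/-- The Christoffel symbol
`Γᵏᵢⱼ = ½ ∑ₗ gᵏˡ (∂ᵢ gⱼₗ + ∂ⱼ gᵢₗ - ∂ₗ gᵢⱼ)`. -/
def christoffel {n : ℕ} (s : Set (EuclideanSpace ℝ (Fin n)))
    (G : EuclideanSpace ℝ (Fin n) → Matrix (Fin n) (Fin n) ℝ) (k i j : Fin n)
    (y : EuclideanSpace ℝ (Fin n)) : ℝ :=
  (1 / 2 : ℝ) * ∑ l, (G y)⁻¹ k l *
    (partialDerivWithin s (fun z => G z j l) i y + partialDerivWithin s (fun z => G z i l) j y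
      - partialDerivWithin s (fun z => G z i j) l y)

/-- The Ricci tensor
`Ricⱼₖ = ∑ᵢ (∂ᵢ Γⁱⱼₖ - ∂ⱼ Γⁱᵢₖ) + ∑ᵢₚ (Γⁱᵢₚ Γᵖⱼₖ - Γⁱⱼₚ Γᵖᵢₖ)`
(positive on round spheres). -/
def ricciCoord {n : ℕ} (s : Set (EuclideanSpace ℝ (Fin n)))
    (G : EuclideanSpace ℝ (Fin n) → Matrix (Fin n) (Fin n) ℝ) (j k : Fin n)
    (y : EuclideanSpace ℝ (Fin n)) : ℝ :=
  ∑ i, (partialDerivWithin s (christoffel s G i j k) i y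
      - partialDerivWithin s (christoffel s G i i k) j y)
    + ∑ i, ∑ p, (christoffel s G i i p y * christoffel s G p j k y
      - christoffel s G i j p y * christoffel s G p i k y)

/-- The scalar curvature `∑ⱼₖ gʲᵏ Ricⱼₖ`. -/
def scalarCurvatureCoord {n : ℕ} (s : Set (EuclideanSpace ℝ (Fin n)))
    (G : EuclideanSpace ℝ (Fin n) → Matrix (Fin n) (Fin n) ℝ)
    (y : EuclideanSpace ℝ (Fin n)) : ℝ :=
  ∑ j, ∑ k, (G y)⁻¹ j k * ricciCoord s G j k y

/-- The Hessian `(D²f)ᵢⱼ = ∂ᵢ ∂ⱼ f - ∑ₖ Γᵏᵢⱼ ∂ₖ f`. -/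
def hessianCoord {n : ℕ} (s : Set (EuclideanSpace ℝ (Fin n)))
    (G : EuclideanSpace ℝ (Fin n) → Matrix (Fin n) (Fin n) ℝ)
    (f : EuclideanSpace ℝ (Fin n) → ℝ) (i j : Fin n) (y : EuclideanSpace ℝ (Fin n)) : ℝ :=
  partialDerivWithin s (partialDerivWithin s f j) i y
    - ∑ k, christoffel s G k i j y * partialDerivWithin s f k y

/-- The squared norm `|D²f|² = ∑ gⁱᵏ gʲˡ (D²f)ᵢⱼ (D²f)ₖₗ`. -/
def hessianNormSqCoord {n : ℕ} (s : Set (EuclideanSpace ℝ (Fin n)))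
    (G : EuclideanSpace ℝ (Fin n) → Matrix (Fin n) (Fin n) ℝ)
    (f : EuclideanSpace ℝ (Fin n) → ℝ) (y : EuclideanSpace ℝ (Fin n)) : ℝ :=
  ∑ i, ∑ j, ∑ k, ∑ l, (G y)⁻¹ i k * (G y)⁻¹ j l
    * hessianCoord s G f i j y * hessianCoord s G f k l y

/-! ## Metrics on a smooth 4-manifold with boundary -/

/-- The coordinate space of the charts. -/
abbrev E4 : Type := EuclideanSpace ℝ (Fin 4)

/-- A field of bilinear forms on the tangent spaces of `M`. -/
abbrev BilinField (M : Type*) [TopologicalSpace M] [ChartedSpace (EuclideanHalfSpace 4) M] :=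
  ∀ x : M, TangentSpace (𝓡∂ 4) x →L[ℝ] TangentSpace (𝓡∂ 4) x →L[ℝ] ℝ

/-- Continuous Riemannian metrics on `M`, up to and including the boundary. -/
abbrev ContMetric (M : Type*) [TopologicalSpace M] [ChartedSpace (EuclideanHalfSpace 4) M]
    [IsManifold (𝓡∂ 4) ∞ M] :=
  Bundle.ContinuousRiemannianMetric E4 (fun x : M => TangentSpace (𝓡∂ 4) x)

section Manifold

variable {M : Type*} [TopologicalSpace M] [ChartedSpace (EuclideanHalfSpace 4) M]

/-- `g` is of class `Cᵏ` at `x` (for finite `k`: in a neighbourhood of `x`, and up to the boundary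
if `x` is a boundary point). -/
def BilinField.ContMDiffAt [IsManifold (𝓡∂ 4) ∞ M] (k : ℕ∞) (g : BilinField M) (x : M) : Prop :=
  _root_.ContMDiffAt (𝓡∂ 4) ((𝓡∂ 4).prod 𝓘(ℝ, E4 →L[ℝ] E4 →L[ℝ] ℝ)) (k : WithTop ℕ∞)
    (fun b => TotalSpace.mk' (E4 →L[ℝ] E4 →L[ℝ] ℝ)
      (E := fun x : M => TangentSpace (𝓡∂ 4) x →L[ℝ] TangentSpace (𝓡∂ 4) x →L[ℝ] ℝ) b (g b)) x

/-- The `i`-th coordinate vector field of the chart at `x₀`, at the point with coordinates `y`. -/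
def coordField (x₀ : M) (i : Fin 4) (y : E4) :
    TangentSpace (𝓡∂ 4) ((extChartAt (𝓡∂ 4) x₀).symm y) :=
  mfderivWithin 𝓘(ℝ, E4) (𝓡∂ 4) (extChartAt (𝓡∂ 4) x₀).symm (range (𝓡∂ 4)) y
    (EuclideanSpace.single i (1 : ℝ) : E4)

/-- The components `g_ij` of `g` in the chart at `x₀`, as functions of the coordinates. -/
def BilinField.matrix (g : BilinField M) (x₀ : M) (y : E4) : Matrix (Fin 4) (Fin 4) ℝ :=
  Matrix.of fun i j => g ((extChartAt (𝓡∂ 4) x₀).symm y) (coordField x₀ i y) (coordField x₀ j y)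

/-- The function `f` in the chart at `x₀`. -/
def inChart (f : M → ℝ) (x₀ : M) (y : E4) : ℝ := f ((extChartAt (𝓡∂ 4) x₀).symm y)

/-- The coordinates of `x` in the chart at `x`. -/
def coords (x : M) : E4 := extChartAt (𝓡∂ 4) x x

/-- The component `Ricⱼₖ` of the Ricci tensor of `g` at `x`, in the chart at `x`. -/
def BilinField.ricci (g : BilinField M) (x : M) (j k : Fin 4) : ℝ :=
  ricciCoord (range (𝓡∂ 4)) (g.matrix x) j k (coords x)

/-- The scalar curvature of `g` at `x`. -/
def BilinField.scalarCurvature (g : BilinField M) (x : M) : ℝ :=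
  scalarCurvatureCoord (range (𝓡∂ 4)) (g.matrix x) (coords x)

/-- The squared norm of the Hessian of `f` with respect to `g` at `x`. -/
def BilinField.hessianNormSq (g : BilinField M) (f : M → ℝ) (x : M) : ℝ :=
  hessianNormSqCoord (range (𝓡∂ 4)) (g.matrix x) (inChart f x) (coords x)

/-- The gradient `∑ₖₗ gᵏˡ (∂ₗ f) ∂ₖ` of `f` with respect to `g`. -/
def BilinField.gradient (g : BilinField M) (f : M → ℝ) (x : M) : TangentSpace (𝓡∂ 4) x :=
  (WithLp.toLp 2 fun k => ∑ l, (g.matrix x (coords x))⁻¹ k l *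
    partialDerivWithin (range (𝓡∂ 4)) (inChart f x) l (coords x) : E4)

/-! ### The boundary metric -/

/-- The inclusion of `ℝ³` in `ℝ⁴` as the boundary of the half-space `{x₀ ≥ 0}`. -/
def boundaryIncl (z : EuclideanSpace ℝ (Fin 3)) : E4 := WithLp.toLp 2 (Fin.cons 0 fun i => z i)

/-- The last three coordinates of a point of `ℝ⁴`. -/
def boundaryProj (y : E4) : EuclideanSpace ℝ (Fin 3) := WithLp.toLp 2 fun i => y i.succ

/-- The components of the metric `γ = g|_{∂M}` induced on the boundary, in the chart of `∂M` obtained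
by restricting the chart of `M` at `p ∈ ∂M`. -/
def BilinField.boundaryMatrix (g : BilinField M) (p : M) (z : EuclideanSpace ℝ (Fin 3)) :
    Matrix (Fin 3) (Fin 3) ℝ :=
  Matrix.of fun a b => g.matrix p (boundaryIncl z) a.succ b.succ

/-- The (intrinsic) scalar curvature `s_γ` at `p ∈ ∂M` of the metric `γ` that `g` induces on the
3-manifold `∂M`. -/
def BilinField.boundaryScalarCurvature (g : BilinField M) (p : M) : ℝ :=
  scalarCurvatureCoord univ (g.boundaryMatrix p) (boundaryProj (coords p))

/-- `g` is a smooth Riemannian metric on the interior of `M` with `Ric_g = -3 g`. The values of `g`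
on the boundary are irrelevant. -/
structure IsEinsteinMetric [IsManifold (𝓡∂ 4) ∞ M] (g : BilinField M) : Prop where
  symm : ∀ x ∈ (𝓡∂ 4).interior M, ∀ v w, g x v w = g x w v
  pos : ∀ x ∈ (𝓡∂ 4).interior M, ∀ v, v ≠ 0 → 0 < g x v v
  smooth : ∀ x ∈ (𝓡∂ 4).interior M, g.ContMDiffAt ⊤ x
  einstein : ∀ x ∈ (𝓡∂ 4).interior M, ∀ j k, g.ricci x j k = -3 * g.matrix x (coords x) j k

/-! ### Distance to the boundary, cut locus, geodesic compactifications -/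

variable [IsManifold (𝓡∂ 4) ∞ M]

/-- The distance from `x` to `∂M`: the infimum of the lengths of `C¹` curves from `∂M` to `x`. -/
def distToBoundary (gbar : ContMetric M) (x : M) : ℝ≥0∞ :=
  letI : RiemannianBundle (fun x : M => TangentSpace (𝓡∂ 4) x) := ⟨gbar.toRiemannianMetric⟩
  ⨅ p ∈ (𝓡∂ 4).boundary M, Manifold.riemannianEDist (𝓡∂ 4) p x

/-- `σ : [0, b] → M` is a unit speed `C¹` curve that starts on `∂M` and minimizes the distance to
`∂M`. -/
structure IsMinimizingFromBoundary (gbar : ContMetric M) (σ : ℝ → M) (b : ℝ) : Prop where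
  contMDiffOn : ContMDiffOn 𝓘(ℝ, ℝ) (𝓡∂ 4) 1 σ (Icc 0 b)
  start : σ 0 ∈ (𝓡∂ 4).boundary M
  unit_speed : ∀ s ∈ Icc 0 b,
    gbar.inner (σ s) (mfderivWithin 𝓘(ℝ, ℝ) (𝓡∂ 4) σ (Icc 0 b) s (1 : ℝ))
      (mfderivWithin 𝓘(ℝ, ℝ) (𝓡∂ 4) σ (Icc 0 b) s (1 : ℝ)) = 1
  minimizing : ∀ s ∈ Icc 0 b, distToBoundary gbar (σ s) = ENNReal.ofReal s

/-- The cut locus of `∂M`: the interior points past which no curve from `∂M` that minimizes the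
distance to `∂M` can be continued as a minimizing curve. -/
def cutLocus (gbar : ContMetric M) : Set M :=
  {x | x ∈ (𝓡∂ 4).interior M ∧
    ¬ ∃ (σ : ℝ → M) (b s : ℝ), IsMinimizingFromBoundary gbar σ b ∧ 0 < s ∧ s < b ∧ σ s = x}

/-- `gbar = t² g` is a geodesic compactification of `g` with geodesic defining function `t`, of class
`C²`. The metric `gbar` is continuous on all of `M`. It is of class `C²` off the cut locus; on the
cut locus of `t` it is singular in general. -/
structure IsC2GeodesicCompactification (g : BilinField M) (t : M → ℝ) (gbar : ContMetric M) :
    Prop where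
  conformal : ∀ x ∈ (𝓡∂ 4).interior M, ∀ v w, gbar.inner x v w = t x ^ 2 * g x v w
  pos : ∀ x ∈ (𝓡∂ 4).interior M, 0 < t x
  zero : ∀ x ∈ (𝓡∂ 4).boundary M, t x = 0
  mfderiv_ne_zero : ∀ x ∈ (𝓡∂ 4).boundary M, mfderiv (𝓡∂ 4) 𝓘(ℝ, ℝ) t x ≠ 0
  /-- `|∇t| = 1` in a neighbourhood of the boundary. -/
  collar : ∃ U : Set M, IsOpen U ∧ (𝓡∂ 4).boundary M ⊆ U ∧
    ∀ x ∈ U, gbar.inner x (BilinField.gradient gbar.inner t x)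
      (BilinField.gradient gbar.inner t x) = 1
  /-- `t` is the distance to the boundary with respect to `gbar`. -/
  dist : ∀ x, ENNReal.ofReal (t x) = distToBoundary gbar x
  contMDiffAt_defining : ∀ x, x ∉ cutLocus gbar → ContMDiffAt (𝓡∂ 4) 𝓘(ℝ, ℝ) 2 t x
  contMDiffAt_metric : ∀ x, x ∉ cutLocus gbar → BilinField.ContMDiffAt 2 gbar.inner x

end Manifold

end

/-! Write `X = ∇t`, let `A` be the endomorphism `v ↦ ∇_v X` (`shapeOp`), and let `s` be the scalar
curvature of the compactified metric.

Off the cut locus `|X| = 1`. The function `t` is 1-Lipschitz, and flowing along `X` gives `|X|² ≤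
|X|` (`normSq_gradVec_le_one`). A nearly shortest curve from the boundary cannot cross a region
where `|X| < 1` without wasting length (`one_le_normSq_gradVec`). At boundary points the collar
condition says it directly. Consequently `A` is self-adjoint, `A X = 0` and `|D²t|² = tr A²`.

For `g = t⁻² gbar` with `|X| = 1`, in dimension four, the conformal change of the Ricci tensor turns
`Ric_g = -3g` into `Ric = -t⁻¹ (2 D²t + (tr A) gbar)` (`curvatureOp_conformal`,
`ricciForm_conformal`, `IsUnitPairWithinAt.ricciForm_eq`). Hence `s = -6 t⁻¹ tr A` and `Ric(X, X) =
-t⁻¹ tr A`. Insert the Riccati equation `(tr A)' = -tr A² - Ric(X, X)` along flow lines of `X`. In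
`s'` the terms `t⁻² tr A` cancel and `6 t⁻¹ |D²t|²` remains. Regularity is delicate here: `X` is
only `C¹`, so `A` is only continuous. It is still differentiable along `X`, because the geodesic
equation `DX(X) = -Γ(X, X)` has a differentiable right side
(`hasDerivAt_fderiv_along_integralCurve`).

At the boundary, multiplying the Ricci formula by `t` and passing to the limit gives `2 D²t + (tr A)
gbar = 0`, so `A = 0` and the boundary is totally geodesic (`shapeOp_eq_zero`). The Gauss equation
yields `s = s_γ + 2 Ric(X, X)` (`trace_ricci_restrict`), and the interior relation `s = 6 Ric(X, X)`
survives in the limit. Together, `s = 3/2 s_γ`.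

For the lower bound, an interior point off the cut locus lies inside a minimizing curve from the
boundary. Such a curve is a flow line of `X`, so `s` does not decrease along it from its boundary
value (`IsMinimizingFromBoundary.scalarCurvature_le`). That value is at least the minimum of `s`
over the compact boundary.

Curvature at each point is defined in the chart preferred at that point. Tensoriality under
coordinate changes therefore has to be proved before anything can be differentiated along a curve.
-/

noncomputable section

section

set_option maxSynthPendingDepth 3

/-! ## Levi-Civita connections and curvature in an open set or half-space of a normed space -/

section LocalConnection

variable {E F W : Type*} [NormedAddCommGroup E] [NormedSpace ℝ E]
  [NormedAddCommGroup F] [NormedSpace ℝ F] [NormedAddCommGroup W] [NormedSpace ℝ W]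

/-- The product rule for a field of bilinear maps applied to two vector fields. -/
lemma fderivWithin_clm_apply₂ {s : Set E} {x : E} {B : E → F →L[ℝ] F →L[ℝ] W} {a b : E → F}
    (hs : UniqueDiffWithinAt ℝ s x) (hB : DifferentiableWithinAt ℝ B s x)
    (ha : DifferentiableWithinAt ℝ a s x) (hb : DifferentiableWithinAt ℝ b s x) (u : E) :
    fderivWithin ℝ (fun y => B y (a y) (b y)) s x u =
      fderivWithin ℝ B s x u (a x) (b x) + B x (fderivWithin ℝ a s x u) (b x)
        + B x (a x) (fderivWithin ℝ b s x u) := by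
  rw [fderivWithin_clm_apply hs (hB.clm_apply ha) hb, fderivWithin_clm_apply hs hB ha]
  simp
  abel

lemma fderivWithin_clm_apply_const₂ {s : Set E} {x : E} {B : E → F →L[ℝ] F →L[ℝ] W}
    (hs : UniqueDiffWithinAt ℝ s x) (hB : DifferentiableWithinAt ℝ B s x) (a b : F) (u : E) :
    fderivWithin ℝ (fun y => B y a b) s x u = fderivWithin ℝ B s x u a b := by
  rw [fderivWithin_clm_apply₂ hs hB (differentiableWithinAt_const a) (differentiableWithinAt_const b)]
  simp

/-- A positive definite symmetric bilinear form. -/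
structure IsPosDefForm (b : E →L[ℝ] E →L[ℝ] ℝ) : Prop where
  symm : ∀ v w, b v w = b w v
  pos : ∀ v, v ≠ 0 → 0 < b v v

/-- Nondegeneracy. Many vector identities below are reduced by it to scalar identities against all
test vectors. -/
lemma IsPosDefForm.eq_of_forall {b : E →L[ℝ] E →L[ℝ] ℝ} (hb : IsPosDefForm b) {v w : E}
    (h : ∀ z, b v z = b w z) : v = w := by
  by_contra hne
  have := hb.pos (v - w) (sub_ne_zero.2 hne)
  rw [map_sub b, sub_apply, h, sub_self] at this
  exact lt_irrefl _ this

lemma IsPosDefForm.nonneg {b : E →L[ℝ] E →L[ℝ] ℝ} (hb : IsPosDefForm b) (v : E) : 0 ≤ b v v := by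
  rcases eq_or_ne v 0 with rfl | h
  · simp
  · exact (hb.pos v h).le

/-- Raising an index: `v ↦ b v` is injective by positivity, hence an isomorphism onto the dual in
finite dimension. Scalar curvature thereby becomes the trace of an endomorphism. -/
lemma IsPosDefForm.exists_endomorphism [FiniteDimensional ℝ E] {b : E →L[ℝ] E →L[ℝ] ℝ}
    (hb : IsPosDefForm b) (h : E →ₗ[ℝ] E →ₗ[ℝ] ℝ) :
    ∃ A : E →ₗ[ℝ] E, ∀ v w, b (A v) w = h v w := by
  let flat : E →ₗ[ℝ] Module.Dual ℝ E :=
    { toFun := fun v => (b v).toLinearMap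
      map_add' := fun v w => by ext; simp
      map_smul' := fun c v => by ext; simp }
  have hinj : Function.Injective flat := fun v w hvw =>
    hb.eq_of_forall fun z => by simpa [flat] using congrArg (fun l => l z) hvw
  have hdim : Module.finrank ℝ E = Module.finrank ℝ (Module.Dual ℝ E) :=
    (Subspace.dual_finrank_eq).symm
  let e := LinearEquiv.ofInjectiveOfFinrankEq flat hinj hdim
  refine ⟨e.symm.toLinearMap ∘ₗ h, fun v w => ?_⟩
  have : flat (e.symm (h v)) = h v := e.apply_symm_apply (h v)
  exact congrArg (fun l => l w) this

/-- `Γ` is at `x` the Levi-Civita connection of the field `B` of bilinear forms: it is torsion free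
and `B` is parallel. Derivatives are taken within `s`. -/
structure IsLeviCivitaWithin (s : Set E) (B : E → E →L[ℝ] E →L[ℝ] ℝ)
    (Γ : E → E →L[ℝ] E →L[ℝ] E) (x : E) : Prop where
  symm : ∀ u v, Γ x u v = Γ x v u
  metric : ∀ u v w, fderivWithin ℝ B s x u v w = B x (Γ x u v) w + B x v (Γ x u w)

/-- In the cyclic combination of metric compatibility, torsion-freeness cancels all connection terms
but one. The connection is thus determined by `B` and its first derivative, which is how two
connections are compared below. -/
lemma IsLeviCivitaWithin.koszul {s : Set E} {B : E → E →L[ℝ] E →L[ℝ] ℝ}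
    {Γ : E → E →L[ℝ] E →L[ℝ] E} {x : E} (h : IsLeviCivitaWithin s B Γ x) (hB : IsPosDefForm (B x))
    (u v w : E) :
    2 * B x (Γ x u v) w = fderivWithin ℝ B s x u v w + fderivWithin ℝ B s x v u w
      - fderivWithin ℝ B s x w u v := by
  rw [h.metric, h.metric, h.metric, h.symm v u, h.symm w u, h.symm w v,
    hB.symm v (Γ x u w)]
  ring

/-- The curvature endomorphism `u ↦ R(u, v) w` of the connection `Γ`. -/
def curvatureOp (s : Set E) (Γ : E → E →L[ℝ] E →L[ℝ] E) (x v w : E) : E →ₗ[ℝ] E where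
  toFun u := fderivWithin ℝ Γ s x u v w - fderivWithin ℝ Γ s x v u w
    + Γ x u (Γ x v w) - Γ x v (Γ x u w)
  map_add' u u' := by simp only [map_add, add_apply]; abel
  map_smul' c u := by
    simp only [map_smul, smul_apply, RingHom.id_apply]; module

lemma curvatureOp_apply (s : Set E) (Γ : E → E →L[ℝ] E →L[ℝ] E) (x u v w : E) :
    curvatureOp s Γ x v w u = fderivWithin ℝ Γ s x u v w - fderivWithin ℝ Γ s x v u w
      + Γ x u (Γ x v w) - Γ x v (Γ x u w) := rfl

lemma curvatureOp_swap (s : Set E) (Γ : E → E →L[ℝ] E →L[ℝ] E) (x u v w : E) :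
    curvatureOp s Γ x v w u = - curvatureOp s Γ x u w v := by
  simp only [curvatureOp_apply]; abel

/-- The Ricci tensor of the connection `Γ` at `x`. -/
def ricciForm (s : Set E) (Γ : E → E →L[ℝ] E →L[ℝ] E) (x v w : E) : ℝ :=
  LinearMap.trace ℝ E (curvatureOp s Γ x v w)

/-- The Ricci tensor as a bilinear map. -/
def ricciBilin (s : Set E) (Γ : E → E →L[ℝ] E →L[ℝ] E) (x : E) : E →ₗ[ℝ] E →ₗ[ℝ] ℝ :=
  LinearMap.mk₂ ℝ (ricciForm s Γ x)
    (fun v v' w => by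
      rw [ricciForm, ricciForm, ricciForm, ← map_add]; congr 1; ext u
      simp only [curvatureOp_apply, LinearMap.add_apply, map_add, add_apply]
      abel)
    (fun c v w => by
      rw [ricciForm, ricciForm, ← map_smul]; congr 1; ext u
      simp only [curvatureOp_apply, LinearMap.smul_apply, map_smul, smul_apply]
      module)
    (fun v w w' => by
      rw [ricciForm, ricciForm, ricciForm, ← map_add]; congr 1; ext u
      simp only [curvatureOp_apply, LinearMap.add_apply, map_add]
      abel)
    (fun c v w => by
      rw [ricciForm, ricciForm, ← map_smul]; congr 1; ext u
      simp only [curvatureOp_apply, LinearMap.smul_apply, map_smul]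
      module)

lemma ricciBilin_apply (s : Set E) (Γ : E → E →L[ℝ] E →L[ℝ] E) (x v w : E) :
    ricciBilin s Γ x v w = ricciForm s Γ x v w := rfl

/-- The curvature of a metric connection is skew-symmetric. -/
lemma IsLeviCivitaWithin.curvatureOp_skew {s : Set E} {B : E → E →L[ℝ] E →L[ℝ] ℝ}
    {Γ : E → E →L[ℝ] E →L[ℝ] E} {x : E} (h : ∀ᶠ y in 𝓝[s] x, IsLeviCivitaWithin s B Γ y)
    (hx : x ∈ s) (hs : UniqueDiffWithinAt ℝ s x) (hB : DifferentiableWithinAt ℝ B s x)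
    (hB2 : DifferentiableWithinAt ℝ (fderivWithin ℝ B s) s x)
    (hsymm : IsSymmSndFDerivWithinAt ℝ B s x)
    (hΓ : DifferentiableWithinAt ℝ Γ s x) (u v w z : E) :
    B x (curvatureOp s Γ x v w u) z + B x w (curvatureOp s Γ x v z u) = 0 := by
  have hLC := h.self_of_nhdsWithin hx
  -- Differentiate `∇B = 0` once more. Antisymmetrizing in `u`, `v` removes the second derivative of
  -- `B` and the mixed products, leaving exactly the curvature terms.
  have key : ∀ u v : E, fderivWithin ℝ (fderivWithin ℝ B s) s x u v w z =
      B x (Γ x u (Γ x v w)) z + B x (Γ x v w) (Γ x u z) + B x (fderivWithin ℝ Γ s x u v w) z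
      + (B x (Γ x u w) (Γ x v z) + B x w (Γ x u (Γ x v z))
        + B x w (fderivWithin ℝ Γ s x u v z)) := by
    intro u v
    have e1 : (fun y => fderivWithin ℝ B s y v w z) =ᶠ[𝓝[s] x]
        fun y => B y (Γ y v w) z + B y w (Γ y v z) :=
      h.mono fun y hy => hy.metric v w z
    have c : ∀ a : E, DifferentiableWithinAt ℝ (fun _ : E => a) s x :=
      fun a => differentiableWithinAt_const a
    have dΓ : ∀ a b : E, DifferentiableWithinAt ℝ (fun y => Γ y a b) s x :=
      fun a b => (hΓ.clm_apply (c a)).clm_apply (c b)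
    have e2 := congrArg (fun l : E →L[ℝ] ℝ => l u) (e1.fderivWithin_eq_of_mem hx)
    rw [fderivWithin_fun_add hs ((hB.clm_apply (dΓ v w)).clm_apply (c z))
      ((hB.clm_apply (c w)).clm_apply (dΓ v z))] at e2
    simp only [add_apply] at e2
    rw [fderivWithin_clm_apply₂ hs hB (dΓ v w) (c z),
      fderivWithin_clm_apply₂ hs hB (c w) (dΓ v z),
      fderivWithin_clm_apply_const₂ hs hΓ, fderivWithin_clm_apply_const₂ hs hΓ,
      hLC.metric, hLC.metric] at e2
    have e3 : fderivWithin ℝ (fun y => fderivWithin ℝ B s y v w z) s x u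
        = fderivWithin ℝ (fderivWithin ℝ B s) s x u v w z := by
      rw [fderivWithin_clm_apply₂ (B := fun y => fderivWithin ℝ B s y v) hs
        (hB2.clm_apply (c v)) (c w) (c z), fderivWithin_clm_apply hs hB2 (c v)]
      simp
    rw [← e3, e2]
    simp
  have h1 := key u v
  have h2 := key v u
  have h3 : fderivWithin ℝ (fderivWithin ℝ B s) s x u v w z
      = fderivWithin ℝ (fderivWithin ℝ B s) s x v u w z := by rw [hsymm v u]
  simp only [curvatureOp_apply, map_add, map_sub, add_apply,
    sub_apply]
  linarith

end LocalConnection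

section LocalConnection

variable {E F W : Type*} [NormedAddCommGroup E] [NormedSpace ℝ E]
  [NormedAddCommGroup F] [NormedSpace ℝ F] [NormedAddCommGroup W] [NormedSpace ℝ W]

/-! ### Changes of coordinates -/

/-- The transformation law of Christoffel symbols. -/
lemma IsLeviCivitaWithin.pullback {s : Set E} {s' : Set F} {φ : E → F} {x : E}
    {B : E → E →L[ℝ] E →L[ℝ] ℝ} {B' : F → F →L[ℝ] F →L[ℝ] ℝ}
    {Γ : E → E →L[ℝ] E →L[ℝ] E} {Γ' : F → F →L[ℝ] F →L[ℝ] F}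
    (h : IsLeviCivitaWithin s B Γ x) (h' : IsLeviCivitaWithin s' B' Γ' (φ x))
    (hs : UniqueDiffWithinAt ℝ s x) (hx : x ∈ s)
    (hpull : ∀ᶠ y in 𝓝[s] x, ∀ u v,
      B y u v = B' (φ y) (fderivWithin ℝ φ s y u) (fderivWithin ℝ φ s y v))
    (hB : DifferentiableWithinAt ℝ B s x)
    (hB' : DifferentiableWithinAt ℝ B' s' (φ x)) (hpos' : IsPosDefForm (B' (φ x)))
    (hpos : IsPosDefForm (B x))
    (hφ : DifferentiableWithinAt ℝ φ s x)
    (hφ2 : DifferentiableWithinAt ℝ (fderivWithin ℝ φ s) s x)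
    (hmaps : Tendsto φ (𝓝[s] x) (𝓝[s'] (φ x))) (hsymm : IsSymmSndFDerivWithinAt ℝ φ s x)
    (hsurj : Function.Surjective (fderivWithin ℝ φ s x)) (u v : E) :
    fderivWithin ℝ φ s x (Γ x u v) =
      Γ' (φ x) (fderivWithin ℝ φ s x u) (fderivWithin ℝ φ s x v)
        + fderivWithin ℝ (fderivWithin ℝ φ s) s x u v := by
  set D := fderivWithin ℝ φ s with hD
  have hcomp : HasFDerivWithinAt (fun y => B' (φ y)) ((fderivWithin ℝ B' s' (φ x)).comp (D x)) s x :=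
    hB'.hasFDerivWithinAt.comp_of_tendsto x hφ.hasFDerivWithinAt hmaps
  have dD : ∀ a : E, DifferentiableWithinAt ℝ (fun y => D y a) s x :=
    fun a => hφ2.clm_apply (differentiableWithinAt_const a)
  have fD : ∀ a b : E, fderivWithin ℝ (fun y => D y a) s x b = fderivWithin ℝ D s x b a := by
    intro a b
    rw [fderivWithin_clm_apply hs hφ2 (differentiableWithinAt_const a)]
    simp
  -- The derivative of `B = φ*B'` contains the second derivative of `φ` twice, once per slot.
  have key : ∀ u v w : E, fderivWithin ℝ B s x u v w =
      fderivWithin ℝ B' s' (φ x) (D x u) (D x v) (D x w)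
      + B' (φ x) (fderivWithin ℝ D s x u v) (D x w)
      + B' (φ x) (D x v) (fderivWithin ℝ D s x u w) := by
    intro u v w
    have e1 : (fun y => B y v w) =ᶠ[𝓝[s] x] fun y => B' (φ y) (D y v) (D y w) :=
      hpull.mono fun y hy => hy v w
    have e2 := congrArg (fun l : E →L[ℝ] ℝ => l u) (e1.fderivWithin_eq_of_mem hx)
    rw [fderivWithin_clm_apply_const₂ hs hB,
      fderivWithin_clm_apply₂ hs hcomp.differentiableWithinAt (dD v) (dD w), fD, fD,
      hcomp.fderivWithin hs] at e2
    simpa using e2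
  refine hpos'.eq_of_forall fun z => ?_
  obtain ⟨w, rfl⟩ := hsurj z
  -- Compare the Koszul formulas upstairs and downstairs. Of the six second-derivative terms four
  -- cancel by symmetry, and the two equal ones left give the inhomogeneous term of the law.
  have k0 := h.koszul hpos u v w
  have k1 := h'.koszul hpos' (D x u) (D x v) (D x w)
  rw [key, key, key, (hpull.self_of_nhdsWithin hx)] at k0
  have s1 : fderivWithin ℝ D s x u v = fderivWithin ℝ D s x v u := hsymm u v
  have s2 : fderivWithin ℝ D s x u w = fderivWithin ℝ D s x w u := hsymm u w
  have s3 : fderivWithin ℝ D s x v w = fderivWithin ℝ D s x w v := hsymm v w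
  rw [map_add, add_apply]
  rw [s2, s3, ← s1, hpos'.symm (D x v) (fderivWithin ℝ D s x w u),
    hpos'.symm (D x u) (fderivWithin ℝ D s x w v)] at k0
  linarith

/-- The curvature is tensorial. -/
lemma curvatureOp_pullback {s : Set E} {s' : Set F} {φ : E → F} {x : E}
    {Γ : E → E →L[ℝ] E →L[ℝ] E} {Γ' : F → F →L[ℝ] F →L[ℝ] F}
    (hs : UniqueDiffWithinAt ℝ s x) (hx : x ∈ s)
    (h : ∀ᶠ y in 𝓝[s] x, ∀ u v, fderivWithin ℝ φ s y (Γ y u v) =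
      Γ' (φ y) (fderivWithin ℝ φ s y u) (fderivWithin ℝ φ s y v)
        + fderivWithin ℝ (fderivWithin ℝ φ s) s y u v)
    (hΓ : DifferentiableWithinAt ℝ Γ s x) (hΓ' : DifferentiableWithinAt ℝ Γ' s' (φ x))
    (hφ : DifferentiableWithinAt ℝ φ s x)
    (hφ2 : DifferentiableWithinAt ℝ (fderivWithin ℝ φ s) s x)
    (hφ3 : DifferentiableWithinAt ℝ (fderivWithin ℝ (fderivWithin ℝ φ s) s) s x)
    (hmaps : Tendsto φ (𝓝[s] x) (𝓝[s'] (φ x))) (hsymm : IsSymmSndFDerivWithinAt ℝ φ s x)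
    (hsymm3 : IsSymmSndFDerivWithinAt ℝ (fderivWithin ℝ φ s) s x) (u v w : E) :
    fderivWithin ℝ φ s x (curvatureOp s Γ x v w u) =
      curvatureOp s' Γ' (φ x) (fderivWithin ℝ φ s x v) (fderivWithin ℝ φ s x w)
        (fderivWithin ℝ φ s x u) := by
  set D := fderivWithin ℝ φ s with hD
  set D2 := fderivWithin ℝ D s with hD2
  have h0 := h.self_of_nhdsWithin hx
  have c : ∀ a : E, DifferentiableWithinAt ℝ (fun _ : E => a) s x :=
    fun a => differentiableWithinAt_const a
  have dΓ : ∀ a b : E, DifferentiableWithinAt ℝ (fun y => Γ y a b) s x :=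
    fun a b => (hΓ.clm_apply (c a)).clm_apply (c b)
  have hcomp : HasFDerivWithinAt (fun y => Γ' (φ y)) ((fderivWithin ℝ Γ' s' (φ x)).comp (D x)) s x :=
    hΓ'.hasFDerivWithinAt.comp_of_tendsto x hφ.hasFDerivWithinAt hmaps
  have dD : ∀ a : E, DifferentiableWithinAt ℝ (fun y => D y a) s x :=
    fun a => hφ2.clm_apply (c a)
  have fD : ∀ a b : E, fderivWithin ℝ (fun y => D y a) s x b = D2 x b a := by
    intro a b
    rw [fderivWithin_clm_apply hs hφ2 (c a)]
    simp [hD2]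
  -- Differentiate the transformation law in direction `a`. The third derivative of `φ` drops out of
  -- the curvature because it is symmetric in its first two arguments.
  have key : ∀ a u v : E, D2 x a (Γ x u v) + D x (fderivWithin ℝ Γ s x a u v) =
      fderivWithin ℝ Γ' s' (φ x) (D x a) (D x u) (D x v)
      + Γ' (φ x) (D2 x a u) (D x v) + Γ' (φ x) (D x u) (D2 x a v)
      + fderivWithin ℝ D2 s x a u v := by
    intro a u v
    have e1 : (fun y => D y (Γ y u v)) =ᶠ[𝓝[s] x]
        fun y => Γ' (φ y) (D y u) (D y v) + D2 y u v := h.mono fun y hy => hy u v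
    have e2 := congrArg (fun l : E →L[ℝ] F => l a) (e1.fderivWithin_eq_of_mem hx)
    rw [fderivWithin_clm_apply hs hφ2 (dΓ u v),
      fderivWithin_fun_add hs
        ((hcomp.differentiableWithinAt.clm_apply (dD u)).clm_apply (dD v))
        ((hφ3.clm_apply (c u)).clm_apply (c v))] at e2
    simp only [add_apply] at e2
    rw [fderivWithin_clm_apply₂ hs hcomp.differentiableWithinAt (dD u) (dD v), fD, fD,
      hcomp.fderivWithin hs, fderivWithin_clm_apply_const₂ hs hφ3] at e2
    simp only [ContinuousLinearMap.coe_comp, Function.comp_apply,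
      ContinuousLinearMap.flip_apply] at e2
    rw [fderivWithin_clm_apply_const₂ hs hΓ, add_comm] at e2
    exact e2
  have s3 : fderivWithin ℝ D2 s x u v w = fderivWithin ℝ D2 s x v u w := by
    have := hsymm3 u v
    rw [← hD2] at this
    rw [this]
  have s2 : D2 x u v = D2 x v u := hsymm u v
  have k1 := eq_sub_of_add_eq' (key u v w)
  have k2 := eq_sub_of_add_eq' (key v u w)
  rw [curvatureOp_apply, curvatureOp_apply]
  simp only [map_add, map_sub]
  rw [k1, k2, h0 u (Γ x v w), h0 v (Γ x u w), h0 v w, h0 u w, s3, s2]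
  simp only [map_add]
  abel

/-- The curvature endomorphisms are conjugate under `D`, and the trace is invariant under
conjugation. -/
lemma ricciForm_pullback {s : Set E} {s' : Set F} {x : E} {y : F}
    {Γ : E → E →L[ℝ] E →L[ℝ] E} {Γ' : F → F →L[ℝ] F →L[ℝ] F} (D : E ≃ₗ[ℝ] F)
    (h : ∀ u v w, D (curvatureOp s Γ x v w u) = curvatureOp s' Γ' y (D v) (D w) (D u)) (v w : E) :
    ricciForm s Γ x v w = ricciForm s' Γ' y (D v) (D w) := by
  rw [ricciForm, ricciForm, ← LinearMap.trace_conj' (curvatureOp s Γ x v w) D]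
  congr 1
  ext u
  rw [LinearEquiv.conj_apply_apply, h, D.apply_symm_apply]

/-- Invariance of metric traces under isometries. -/
lemma trace_eq_of_isometry {b h : E → E → ℝ} {b' : F →L[ℝ] F →L[ℝ] ℝ} {h' : F → F → ℝ}
    (D : E ≃ₗ[ℝ] F) (hb' : IsPosDefForm b') (hb : ∀ u v, b u v = b' (D u) (D v))
    (hh : ∀ u v, h u v = h' (D u) (D v)) {A : E →ₗ[ℝ] E} {A' : F →ₗ[ℝ] F}
    (hA : ∀ u v, b (A u) v = h u v) (hA' : ∀ u v, b' (A' u) v = h' u v) :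
    LinearMap.trace ℝ E A = LinearMap.trace ℝ F A' := by
  rw [← LinearMap.trace_conj' A D]
  congr 1
  ext u
  refine hb'.eq_of_forall fun z => ?_
  obtain ⟨w, rfl⟩ := D.surjective z
  obtain ⟨v, rfl⟩ := D.surjective u
  rw [LinearEquiv.conj_apply_apply, D.symm_apply_apply, ← hb, hA, hh, hA']

/-! ### Gradient fields with unit length -/

/-- The endomorphism `v ↦ ∇_v X`. -/
def covariantDerivOp (s : Set E) (Γ : E → E →L[ℝ] E →L[ℝ] E) (X : E → E) (x : E) : E →ₗ[ℝ] E :=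
  (fderivWithin ℝ X s x + (Γ x).flip (X x) : E →L[ℝ] E)

lemma covariantDerivOp_apply (s : Set E) (Γ : E → E →L[ℝ] E →L[ℝ] E) (X : E → E) (x v : E) :
    covariantDerivOp s Γ X x v = fderivWithin ℝ X s x v + Γ x v (X x) := rfl

/-- The covariant derivative of a gradient is the Hessian. -/
lemma IsLeviCivitaWithin.covariantDerivOp_eq_hessian {s : Set E} {B : E → E →L[ℝ] E →L[ℝ] ℝ}
    {Γ : E → E →L[ℝ] E →L[ℝ] E} {X : E → E} {t : E → ℝ} {x : E}
    (h : IsLeviCivitaWithin s B Γ x) (hs : UniqueDiffWithinAt ℝ s x) (hx : x ∈ s)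
    (hgrad : ∀ᶠ y in 𝓝[s] x, ∀ w, B y (X y) w = fderivWithin ℝ t s y w)
    (hB : DifferentiableWithinAt ℝ B s x) (hX : DifferentiableWithinAt ℝ X s x)
    (ht2 : DifferentiableWithinAt ℝ (fderivWithin ℝ t s) s x) (v w : E) :
    B x (covariantDerivOp s Γ X x v) w =
      fderivWithin ℝ (fderivWithin ℝ t s) s x v w - fderivWithin ℝ t s x (Γ x v w) := by
  have e1 : (fun y => B y (X y) w) =ᶠ[𝓝[s] x] fun y => fderivWithin ℝ t s y w :=
    hgrad.mono fun y hy => hy w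
  have c := differentiableWithinAt_const (𝕜 := ℝ) (s := s) (x := x) w
  have e2 := congrArg (fun l : E →L[ℝ] ℝ => l v) (e1.fderivWithin_eq_of_mem hx)
  rw [fderivWithin_clm_apply₂ hs hB hX c, fderivWithin_clm_apply hs ht2 c, h.metric] at e2
  simp at e2
  rw [covariantDerivOp_apply, ← hgrad.self_of_nhdsWithin hx, ← e2, map_add, add_apply]
  ring

/-- A unit gradient field is geodesic. -/
lemma IsLeviCivitaWithin.covariantDerivOp_self {s : Set E} {B : E → E →L[ℝ] E →L[ℝ] ℝ}
    {Γ : E → E →L[ℝ] E →L[ℝ] E} {X : E → E} {t : E → ℝ} {x : E}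
    (h : IsLeviCivitaWithin s B Γ x) (hs : UniqueDiffWithinAt ℝ s x) (hx : x ∈ s)
    (hpos : IsPosDefForm (B x))
    (hgrad : ∀ᶠ y in 𝓝[s] x, ∀ w, B y (X y) w = fderivWithin ℝ t s y w)
    (hunit : ∀ᶠ y in 𝓝[s] x, B y (X y) (X y) = 1)
    (hB : DifferentiableWithinAt ℝ B s x) (hX : DifferentiableWithinAt ℝ X s x)
    (ht2 : DifferentiableWithinAt ℝ (fderivWithin ℝ t s) s x)
    (hsymm : IsSymmSndFDerivWithinAt ℝ t s x) :
    covariantDerivOp s Γ X x (X x) = 0 := by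
  refine hpos.eq_of_forall fun v => ?_
  have H := h.covariantDerivOp_eq_hessian hs hx hgrad hB hX ht2
  -- Symmetry of the Hessian moves the derivative onto `v`: `⟨∇_X X, v⟩ = ⟨∇_v X, X⟩`, which is half
  -- the derivative of the constant `|X|² = 1`.
  rw [H, hsymm (X x) v, h.symm, ← H]
  have e1 : (fun y => B y (X y) (X y)) =ᶠ[𝓝[s] x] fun _ => 1 := hunit
  have e2 := congrArg (fun l : E →L[ℝ] ℝ => l v) (e1.fderivWithin_eq_of_mem hx)
  rw [fderivWithin_clm_apply₂ hs hB hX hX, h.metric, hpos.symm (X x) (Γ x v (X x)),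
    hpos.symm (X x) (fderivWithin ℝ X s x v)] at e2
  simp at e2
  rw [covariantDerivOp_apply, map_add, add_apply]
  simp
  linarith

end LocalConnection

section LocalConnection

variable {E F W : Type*} [NormedAddCommGroup E] [NormedSpace ℝ E]
  [NormedAddCommGroup F] [NormedSpace ℝ F] [NormedAddCommGroup W] [NormedSpace ℝ W]

/-! ### The Riccati equation -/

/-- Difference quotients of a strictly differentiable function, with moving base point. -/
lemma HasStrictFDerivAt.tendsto_slope_moving {f : E → W} {f' : E →L[ℝ] W} {x : E}
    (hf : HasStrictFDerivAt f f' x) {c : ℝ → E} {a : ℝ} (hc : ContinuousAt c a) (hca : c a = x)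
    (v : E) :
    Tendsto (fun p : ℝ × ℝ => p.1⁻¹ • (f (c p.2 + p.1 • v) - f (c p.2)))
      (𝓝[≠] 0 ×ˢ 𝓝 a) (𝓝 (f' v)) := by
  have hc2 : Tendsto (fun p : ℝ × ℝ => c p.2) (𝓝[≠] 0 ×ˢ 𝓝 a) (𝓝 x) := by
    rw [← hca]; exact hc.tendsto.comp tendsto_snd
  have h1 : Tendsto (fun p : ℝ × ℝ => p.1) (𝓝[≠] 0 ×ˢ 𝓝 a) (𝓝 0) :=
    (tendsto_fst (f := 𝓝[≠] (0:ℝ))).mono_right nhdsWithin_le_nhds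
  have hc1 : Tendsto (fun p : ℝ × ℝ => c p.2 + p.1 • v) (𝓝[≠] 0 ×ˢ 𝓝 a) (𝓝 x) := by
    simpa using hc2.add (h1.smul_const v)
  have ho := (hasStrictFDerivAt_iff_isLittleO.1 hf).comp_tendsto (hc1.prodMk_nhds hc2)
  have ho2 : (fun p : ℝ × ℝ => f (c p.2 + p.1 • v) - f (c p.2) - p.1 • f' v)
      =o[𝓝[≠] 0 ×ˢ 𝓝 a] fun p => p.1 := by
    have h3 : (fun p : ℝ × ℝ => p.1 • v) =O[𝓝[≠] 0 ×ˢ 𝓝 a] fun p => p.1 :=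
      Asymptotics.IsBigO.of_bound ‖v‖ (Eventually.of_forall fun p => by
        rw [norm_smul, mul_comm])
    refine Asymptotics.IsLittleO.trans_isBigO ?_ h3
    simpa [Function.comp_def] using ho
  have hne : ∀ᶠ p : ℝ × ℝ in 𝓝[≠] 0 ×ˢ 𝓝 a, p.1 ≠ 0 :=
    (tendsto_fst (f := 𝓝[≠] (0:ℝ))).eventually self_mem_nhdsWithin
  have h4 := (ho2.tendsto_inv_smul_nhds_zero).add_const (f' v)
  rw [zero_add] at h4
  refine h4.congr' (hne.mono fun p hp => ?_)
  simp only [smul_sub, smul_smul, inv_mul_cancel₀ hp, one_smul]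
  abel

/-- If `X` is of class `C¹` and `∇_X X` is strictly differentiable, then the derivative of `X` is
differentiable along the integral curves of `X`. -/
lemma hasDerivAt_fderiv_along_integralCurve {X : E → E} {x : E} {f : E → E} {f' : E →L[ℝ] E}
    (hX : ContDiffAt ℝ 1 X x) (hf : HasStrictFDerivAt f f' x)
    (hfX : ∀ᶠ y in 𝓝 x, fderiv ℝ X y (X y) = f y) {c : ℝ → E} (hc0 : c 0 = x)
    (hc : ∀ᶠ τ in 𝓝 0, HasDerivAt c (X (c τ)) τ) (v : E) :
    HasDerivAt (fun τ => fderiv ℝ X (c τ) v) (f' v - fderiv ℝ X x (fderiv ℝ X x v)) 0 := by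
  have hcc : ContinuousAt c 0 := hc.self_of_nhds.continuousAt
  have hXs : HasStrictFDerivAt X (fderiv ℝ X x) x := hX.hasStrictFDerivAt one_ne_zero
  have hdiff : ∀ᶠ y in 𝓝 x, DifferentiableAt ℝ X y :=
    (hX.eventually (by simp)).mono fun y hy => hy.differentiableAt one_ne_zero
  have hc2 : Tendsto (fun p : ℝ × ℝ => c p.2) (𝓝[≠] 0 ×ˢ 𝓝 0) (𝓝 x) := by
    rw [← hc0]; exact hcc.tendsto.comp tendsto_snd
  have h1 : Tendsto (fun p : ℝ × ℝ => p.1) (𝓝[≠] 0 ×ˢ 𝓝 (0:ℝ)) (𝓝 0) :=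
    (tendsto_fst (f := 𝓝[≠] (0:ℝ))).mono_right nhdsWithin_le_nhds
  have hc1 : Tendsto (fun p : ℝ × ℝ => c p.2 + p.1 • v) (𝓝[≠] 0 ×ˢ 𝓝 0) (𝓝 x) := by
    simpa using hc2.add (h1.smul_const v)
  -- This expression is the `τ`-derivative of the difference quotient of `X` in direction `v`.
  -- Writing `X (c τ)` as `X (c τ + ε v)` minus a difference lets `DX(X) = f` be used at both
  -- points, so only first derivatives of `X` and `f` enter.
  have hsl : Tendsto (fun p : ℝ × ℝ => p.1⁻¹ • (f (c p.2 + p.1 • v) - f (c p.2))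
      - fderiv ℝ X (c p.2 + p.1 • v) (p.1⁻¹ • (X (c p.2 + p.1 • v) - X (c p.2))))
      (𝓝[≠] 0 ×ˢ 𝓝 0) (𝓝 (f' v - fderiv ℝ X x (fderiv ℝ X x v))) := by
    refine (hf.tendsto_slope_moving hcc hc0 v).sub ?_
    have hcont : ContinuousAt (fderiv ℝ X) x := hX.continuousAt_fderiv one_ne_zero
    have hD : Tendsto (fun p : ℝ × ℝ => fderiv ℝ X (c p.2 + p.1 • v)) (𝓝[≠] 0 ×ˢ 𝓝 0)
        (𝓝 (fderiv ℝ X x)) := hcont.tendsto.comp hc1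
    exact (isBoundedBilinearMap_apply.continuous.tendsto (fderiv ℝ X x, fderiv ℝ X x v)).comp
      (hD.prodMk_nhds (hXs.tendsto_slope_moving hcc hc0 v))
  -- The difference quotients tend to `DX (c τ) v`, and their `τ`-derivatives converge jointly as
  -- `(ε, τ) → (0, 0)`. Limit and derivative may therefore be interchanged.
  refine hasDerivAt_of_tendstoUniformlyOnFilter (𝕜 := ℝ) (l := 𝓝[≠] (0:ℝ))
    (f := fun ε τ => ε⁻¹ • (X (c τ + ε • v) - X (c τ)))
    (f' := fun ε τ => ε⁻¹ • (f (c τ + ε • v) - f (c τ))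
      - fderiv ℝ X (c τ + ε • v) (ε⁻¹ • (X (c τ + ε • v) - X (c τ))))
    (g' := fun _ => f' v - fderiv ℝ X x (fderiv ℝ X x v)) ?_ ?_ ?_
  · exact tendsto_prod_filter_iff.1 hsl
  · have hcτ : ∀ᶠ p : ℝ × ℝ in 𝓝[≠] 0 ×ˢ 𝓝 0, HasDerivAt c (X (c p.2)) p.2 :=
      tendsto_snd.eventually hc
    filter_upwards [hcτ, hc1.eventually hdiff, hc2.eventually hdiff, hc1.eventually hfX,
      hc2.eventually hfX] with p hp d1 d2 e1 e2
    have k1 := d1.hasFDerivAt.comp_hasDerivAt p.2 (hp.add_const (p.1 • v))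
    have k2 := d2.hasFDerivAt.comp_hasDerivAt p.2 hp
    have k3 := (k1.sub k2).const_smul p.1⁻¹
    refine k3.congr_deriv ?_
    rw [e2, map_smul, map_sub, e1, ← smul_sub]
    congr 1
    abel
  · filter_upwards [hcc.tendsto.eventually (hc0 ▸ hdiff)] with τ hτ
    have := hτ.hasFDerivAt.hasLineDerivAt v
    simpa using this.tendsto_slope_zero

/-- The trace is a finite sum of coordinates of values on basis vectors, so differentiability on
each fixed vector suffices. -/
lemma hasDerivAt_trace [FiniteDimensional ℝ E] {T : ℝ → E →ₗ[ℝ] E} {L : E →ₗ[ℝ] E} {a : ℝ}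
    (h : ∀ v, HasDerivAt (fun τ => T τ v) (L v) a) :
    HasDerivAt (fun τ => LinearMap.trace ℝ E (T τ)) (LinearMap.trace ℝ E L) a := by
  have htr : ∀ S : E →ₗ[ℝ] E, LinearMap.trace ℝ E S
      = ∑ i, LinearMap.toContinuousLinearMap ((Module.finBasis ℝ E).coord i)
          (S (Module.finBasis ℝ E i)) := by
    intro S
    rw [LinearMap.trace_eq_matrix_trace ℝ (Module.finBasis ℝ E), Matrix.trace]
    simp [LinearMap.toMatrix_apply]
  simp only [htr]
  refine HasDerivAt.fun_sum fun i _ => ?_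
  exact ((ContinuousLinearMap.hasFDerivAt _).comp_hasDerivAt a (h _))

/-- The Riccati equation for the divergence of a geodesic gradient field `X` of class `C¹`. -/
lemma hasDerivAt_trace_covariantDerivOp [FiniteDimensional ℝ E] {s : Set E} {X : E → E} {x : E}
    {Γ : E → E →L[ℝ] E →L[ℝ] E} (hs : s ∈ 𝓝 x) (hX : ContDiffAt ℝ 1 X x)
    (hΓ : ContDiffAt ℝ 1 Γ x) (hsym : ∀ u v, Γ x u v = Γ x v u)
    (hgeo : ∀ᶠ y in 𝓝 x, covariantDerivOp s Γ X y (X y) = 0) {c : ℝ → E} (hc0 : c 0 = x)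
    (hc : ∀ᶠ τ in 𝓝 0, HasDerivAt c (X (c τ)) τ) :
    HasDerivAt (fun τ => LinearMap.trace ℝ E (covariantDerivOp s Γ X (c τ)))
      (- LinearMap.trace ℝ E (covariantDerivOp s Γ X x ∘ₗ covariantDerivOp s Γ X x)
        - ricciForm s Γ x (X x) (X x)) 0 := by
  have hss : ∀ᶠ y in 𝓝 x, s ∈ 𝓝 y := eventually_mem_nhds_iff.2 hs
  have hcc : ContinuousAt c 0 := hc.self_of_nhds.continuousAt
  have hXs : HasStrictFDerivAt X (fderiv ℝ X x) x := hX.hasStrictFDerivAt one_ne_zero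
  have hΓs : HasStrictFDerivAt Γ (fderiv ℝ Γ x) x := hΓ.hasStrictFDerivAt one_ne_zero
  have hf := ((hΓs.clm_apply hXs).clm_apply hXs).neg
  -- The geodesic equation: its right side is strictly differentiable since `X` and `Γ` are `C¹`.
  -- This replaces the missing second derivative of `X`.
  have hgeo' : ∀ᶠ y in 𝓝 x, fderiv ℝ X y (X y) = - Γ y (X y) (X y) := by
    filter_upwards [hgeo, hss] with y hy hsy
    rw [covariantDerivOp_apply, fderivWithin_of_mem_nhds hsy] at hy
    exact eq_neg_of_add_eq_zero_left hy
  have hA := hasDerivAt_fderiv_along_integralCurve hX hf hgeo' hc0 hc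
  have hc1 : HasDerivAt c (X x) 0 := by simpa [hc0] using hc.self_of_nhds
  have hB : ∀ v, HasDerivAt (fun τ => Γ (c τ) v (X (c τ)))
      (fderiv ℝ Γ x (X x) v (X x) + Γ x v (fderiv ℝ X x (X x))) 0 := by
    intro v
    have k1 : HasDerivAt (fun τ => Γ (c τ)) (fderiv ℝ Γ x (X x)) 0 :=
      HasFDerivAt.comp_hasDerivAt_of_eq 0 hΓs.hasFDerivAt hc1 hc0.symm
    have k2 : HasDerivAt (fun τ => X (c τ)) (fderiv ℝ X x (X x)) 0 :=
      HasFDerivAt.comp_hasDerivAt_of_eq 0 hXs.hasFDerivAt hc1 hc0.symm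
    simpa [hc0] using (k1.clm_apply (hasDerivAt_const 0 v)).clm_apply k2
  set A := covariantDerivOp s Γ X x with hAdef
  let G : E →ₗ[ℝ] E := ((Γ x).flip (X x) : E →L[ℝ] E)
  -- The covariant Riccati equation is `-R - A²`. The commutator with `G = Γ(·, X)` appears because
  -- the endomorphism is differentiated in coordinates, and it has trace zero.
  let L : E →ₗ[ℝ] E := -curvatureOp s Γ x (X x) (X x) - A ∘ₗ A + (A ∘ₗ G - G ∘ₗ A)
  have hL : ∀ v, HasDerivAt (fun τ => covariantDerivOp s Γ X (c τ) v) (L v) 0 := by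
    intro v
    have h1 := (hA v).add (hB v)
    have e : (fun τ => covariantDerivOp s Γ X (c τ) v) =ᶠ[𝓝 0]
        fun τ => fderiv ℝ X (c τ) v + Γ (c τ) v (X (c τ)) := by
      filter_upwards [hcc.tendsto.eventually (hc0 ▸ hss)] with τ hτ
      rw [covariantDerivOp_apply, fderivWithin_of_mem_nhds hτ]
    refine HasDerivAt.congr_deriv (h1.congr_of_eventuallyEq e) ?_
    simp only [L, G, hAdef, LinearMap.add_apply, LinearMap.sub_apply, LinearMap.neg_apply,
      LinearMap.comp_apply, curvatureOp_apply, covariantDerivOp_apply,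
      fderivWithin_of_mem_nhds hs, ContinuousLinearMap.coe_coe, ContinuousLinearMap.flip_apply,
      neg_apply, add_apply, ContinuousLinearMap.coe_comp,
      Function.comp_apply, hgeo'.self_of_nhds, map_add, map_neg]
    rw [hsym (X x) (fderiv ℝ X x v), hsym (X x) (Γ x v (X x))]
    abel
  refine (hasDerivAt_trace hL).congr_deriv ?_
  have hcomm : LinearMap.trace ℝ E (A ∘ₗ G) = LinearMap.trace ℝ E (G ∘ₗ A) :=
    LinearMap.trace_comp_comm' _ _
  simp only [L, map_add, map_sub, map_neg, hcomm, ricciForm]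
  ring

end LocalConnection

section LocalConnection

variable {E F W : Type*} [NormedAddCommGroup E] [NormedSpace ℝ E]
  [NormedAddCommGroup F] [NormedSpace ℝ F] [NormedAddCommGroup W] [NormedSpace ℝ W]

/-! ### Conformal changes -/

/-- The Levi-Civita connections of `B = t² G` and `G`, where `X` is the `B`-gradient of `t`. -/
lemma IsLeviCivitaWithin.conformal {s : Set E} {B G : E → E →L[ℝ] E →L[ℝ] ℝ}
    {Γ Γ' : E → E →L[ℝ] E →L[ℝ] E} {X : E → E} {t : E → ℝ} {x : E}
    (h : IsLeviCivitaWithin s B Γ x) (h' : IsLeviCivitaWithin s G Γ' x)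
    (hs : UniqueDiffWithinAt ℝ s x) (hx : x ∈ s) (hpos : IsPosDefForm (B x))
    (hpos' : IsPosDefForm (G x)) (ht0 : t x ≠ 0)
    (hconf : ∀ᶠ y in 𝓝[s] x, ∀ u v, B y u v = t y ^ 2 * G y u v)
    (hgrad : ∀ w, B x (X x) w = fderivWithin ℝ t s x w)
    (hB : DifferentiableWithinAt ℝ B s x) (hG : DifferentiableWithinAt ℝ G s x)
    (ht : DifferentiableWithinAt ℝ t s x) (u v : E) :
    Γ' x u v = Γ x u v - (t x)⁻¹ • (fderivWithin ℝ t s x u • v + fderivWithin ℝ t s x v • u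
      - B x u v • X x) := by
  have hc := hconf.self_of_nhdsWithin hx
  have key : ∀ u v w, fderivWithin ℝ B s x u v w =
      2 * t x * fderivWithin ℝ t s x u * G x v w + t x ^ 2 * fderivWithin ℝ G s x u v w := by
    intro u v w
    have e1 : (fun y => B y v w) =ᶠ[𝓝[s] x] fun y => t y ^ 2 * G y v w :=
      hconf.mono fun y hy => hy v w
    have e2 := congrArg (fun l : E →L[ℝ] ℝ => l u) (e1.fderivWithin_eq_of_mem hx)
    have hGvw : DifferentiableWithinAt ℝ (fun y => G y v w) s x :=
      (hG.clm_apply (differentiableWithinAt_const v)).clm_apply (differentiableWithinAt_const w)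
    have h2 := (ht.hasFDerivWithinAt.pow 2).mul hGvw.hasFDerivWithinAt
    rw [fderivWithin_clm_apply_const₂ hs hB] at e2
    rw [e2]
    refine (congrArg (fun l : E →L[ℝ] ℝ => l u) (h2.fderivWithin hs)).trans ?_
    simp [fderivWithin_clm_apply_const₂ hs hG]
    ring
  refine hpos.eq_of_forall fun w => ?_
  -- Koszul for both metrics. The derivative of the factor `t²` contributes the three terms with
  -- `dt`, the last of which is rewritten through `X`.
  have k0 := h.koszul hpos u v w
  have k1 := h'.koszul hpos' u v w
  have k2 : t x ^ 2 * (2 * G x (Γ' x u v) w) = 2 * B x (Γ' x u v) w := by rw [hc]; ring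
  rw [k1] at k2
  rw [key, key, key] at k0
  have k3 : ∀ a b, G x a b = (t x ^ 2)⁻¹ * B x a b := fun a b => by
    rw [hc]; field_simp
  rw [k3, k3, k3] at k0
  simp only [map_sub, map_add, map_smul, sub_apply, add_apply, smul_apply, smul_eq_mul, hgrad]
  have e1 : ∀ a b : ℝ, 2 * t x * a * ((t x ^ 2)⁻¹ * b) = 2 * ((t x)⁻¹ * (a * b)) := fun a b => by
    field_simp
  rw [e1, e1, e1] at k0
  linear_combination (1/2 : ℝ) * k2 * (-1) + (1/2 : ℝ) * k0 * (-1) + 0 * k1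

/-- The curvature of `G = t⁻² B` when `t` has unit gradient `X`. -/
lemma curvatureOp_conformal {s : Set E} {B : E → E →L[ℝ] E →L[ℝ] ℝ}
    {Γ Γ' : E → E →L[ℝ] E →L[ℝ] E} {X : E → E} {t : E → ℝ} {x : E}
    (hs : UniqueDiffWithinAt ℝ s x) (hx : x ∈ s) (ht0 : t x ≠ 0)
    (hLC : IsLeviCivitaWithin s B Γ x)
    (h : ∀ᶠ y in 𝓝[s] x, ∀ u v, Γ' y u v = Γ y u v - (t y)⁻¹ •
      (fderivWithin ℝ t s y u • v + fderivWithin ℝ t s y v • u - B y u v • X y))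
    (hgrad : ∀ᶠ y in 𝓝[s] x, ∀ w, B y (X y) w = fderivWithin ℝ t s y w)
    (hunit : B x (X x) (X x) = 1) (hpos : IsPosDefForm (B x))
    (hB : DifferentiableWithinAt ℝ B s x)
    (hΓ : DifferentiableWithinAt ℝ Γ s x) (hΓ' : DifferentiableWithinAt ℝ Γ' s x)
    (hX : DifferentiableWithinAt ℝ X s x) (ht : DifferentiableWithinAt ℝ t s x)
    (ht2 : DifferentiableWithinAt ℝ (fderivWithin ℝ t s) s x)
    (hsymm : IsSymmSndFDerivWithinAt ℝ t s x) (u v w : E) :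
    curvatureOp s Γ' x v w u = curvatureOp s Γ x v w u
      + (t x ^ 2)⁻¹ • (B x u w • v - B x v w • u)
      - (t x)⁻¹ • (B x u (covariantDerivOp s Γ X x w) • v - B x v (covariantDerivOp s Γ X x w) • u
        - B x v w • covariantDerivOp s Γ X x u + B x u w • covariantDerivOp s Γ X x v) := by
  set θ := fderivWithin ℝ t s with hθ
  set A := covariantDerivOp s Γ X x with hA
  have h0 := h.self_of_nhdsWithin hx
  have hH := hLC.covariantDerivOp_eq_hessian hs hx hgrad hB hX ht2
  have c : ∀ a : E, DifferentiableWithinAt ℝ (fun _ : E => a) s x :=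
    fun a => differentiableWithinAt_const a
  -- Ordinary second derivatives of `t` are exchanged for `A`, so that the final identity involves
  -- only tensors and terms in `Γ` that cancel.
  have hHess : ∀ a b, fderivWithin ℝ θ s x a b = B x a (A b) + θ x (Γ x a b) := by
    intro a b
    rw [hsymm a b, hLC.symm a b, hpos.symm, hH]; ring
  have key : ∀ a u v : E, fderivWithin ℝ Γ' s x a u v = fderivWithin ℝ Γ s x a u v
      + (θ x a * (t x ^ 2)⁻¹) • (θ x u • v + θ x v • u - B x u v • X x)
      - (t x)⁻¹ • (fderivWithin ℝ θ s x a u • v + fderivWithin ℝ θ s x a v • u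
        - fderivWithin ℝ B s x a u v • X x - B x u v • fderivWithin ℝ X s x a) := by
    intro a u v
    have e1 : (fun y => Γ' y u v) =ᶠ[𝓝[s] x] fun y => Γ y u v - (t y)⁻¹ •
      (θ y u • v + θ y v • u - B y u v • X y) := h.mono fun y hy => hy u v
    have e2 := congrArg (fun l : E →L[ℝ] E => l a) (e1.fderivWithin_eq_of_mem hx)
    rw [fderivWithin_clm_apply_const₂ hs hΓ'] at e2
    have d1 := (hΓ.clm_apply (c u)).clm_apply (c v)
    have d2 := (hasDerivAt_inv ht0).comp_hasFDerivWithinAt x ht.hasFDerivWithinAt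
    have d3 : ∀ b, DifferentiableWithinAt ℝ (fun y => θ y b) s x := fun b => ht2.clm_apply (c b)
    have d4 := (hB.clm_apply (c u)).clm_apply (c v)
    have d5 := (((d3 u).hasFDerivWithinAt.smul_const v).add
      ((d3 v).hasFDerivWithinAt.smul_const u)).sub
        (d4.hasFDerivWithinAt.smul hX.hasFDerivWithinAt)
    have d6 := d1.hasFDerivWithinAt.sub (d2.smul d5)
    have fθ : ∀ b, fderivWithin ℝ (fun y => θ y b) s x a = fderivWithin ℝ θ s x a b := fun b => by
      rw [fderivWithin_clm_apply hs ht2 (c b)]; simp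
    rw [e2]
    refine (congrArg (fun l : E →L[ℝ] E => l a) (d6.fderivWithin hs)).trans ?_
    simp [fθ, fderivWithin_clm_apply_const₂ hs hΓ, fderivWithin_clm_apply_const₂ hs hB]
    module
  have hX1 : θ x (X x) = 1 := by rw [← hgrad.self_of_nhdsWithin hx, hunit]
  have hBX : ∀ a, B x a (X x) = θ x a := fun a => by
    rw [hpos.symm, hgrad.self_of_nhdsWithin hx]
  have hDX : ∀ a, fderivWithin ℝ X s x a = A a - Γ x a (X x) := fun a => by
    rw [hA, covariantDerivOp_apply]; abel
  rw [curvatureOp_apply, curvatureOp_apply, key, key, h0 u (Γ' x v w), h0 v (Γ' x u w), h0 v w,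
    h0 u w, hLC.metric, hLC.metric, hHess, hHess, hHess, hHess, hDX, hDX]
  simp only [map_sub, map_add, map_smul, smul_eq_mul, hX1, hBX]
  rw [hLC.symm v u, hpos.symm v u, hpos.symm (Γ x u v) w,
    show B x v (A u) = B x u (A v) by
      rw [hpos.symm v, hH u v, hpos.symm u, hH v u, hsymm v u, hLC.symm v u]]
  -- With `r = t⁻¹` all coefficients are polynomial, and what is left is an identity of linear
  -- combinations of vectors.
  have hti : (t x ^ 2)⁻¹ = (t x)⁻¹ * (t x)⁻¹ := by rw [pow_two, mul_inv]
  rw [hti]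
  generalize (t x)⁻¹ = r
  module

/-- The Ricci curvature of `G = t⁻² B` when `t` has unit gradient `X`. -/
lemma ricciForm_conformal [FiniteDimensional ℝ E] {s : Set E} {b : E →L[ℝ] E →L[ℝ] ℝ}
    {Γ Γ' : E → E →L[ℝ] E →L[ℝ] E} {A : E →ₗ[ℝ] E} {t : ℝ} {x v w : E}
    (hA : ∀ v w, b (A v) w = b v (A w))
    (h : ∀ u, curvatureOp s Γ' x v w u = curvatureOp s Γ x v w u
      + (t ^ 2)⁻¹ • (b u w • v - b v w • u)
      - t⁻¹ • (b u (A w) • v - b v (A w) • u - b v w • A u + b u w • A v)) :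
    ricciForm s Γ' x v w = ricciForm s Γ x v w
      - (Module.finrank ℝ E - 1) * (t ^ 2)⁻¹ * b v w
      + t⁻¹ * ((Module.finrank ℝ E - 2) * b v (A w) + b v w * LinearMap.trace ℝ E A) := by
  -- As endomorphisms in `u`, all correction terms are rank one, scalar, or multiples of `A`. Each
  -- trace can be read off, and the identity contributes the dimension.
  have e : curvatureOp s Γ' x v w = curvatureOp s Γ x v w
      + (t ^ 2)⁻¹ • ((b.flip w).toLinearMap.smulRight v - b v w • LinearMap.id)
      - t⁻¹ • ((b.flip (A w)).toLinearMap.smulRight v - b v (A w) • LinearMap.id - b v w • A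
        + (b.flip w).toLinearMap.smulRight (A v)) := by
    ext u
    simp [h]
  rw [ricciForm, e]
  simp only [map_sub, map_add, map_smul, smul_eq_mul, LinearMap.trace_smulRight, LinearMap.trace_id,
    ContinuousLinearMap.coe_coe, ContinuousLinearMap.flip_apply, hA, ricciForm]
  ring

/-! ### Totally geodesic hypersurfaces -/

/-- Splitting of the trace along a hyperplane `ι F` and a complementary vector `X`. -/
lemma trace_eq_add_of_splitting [FiniteDimensional ℝ E] [FiniteDimensional ℝ F] {ι : F →ₗ[ℝ] E}
    {P : E →ₗ[ℝ] F} {θ : E →ₗ[ℝ] ℝ} {X : E}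
    (hsplit : ∀ v, v = ι (P v) + θ v • X) (T : E →ₗ[ℝ] E) :
    LinearMap.trace ℝ E T = LinearMap.trace ℝ F (P ∘ₗ T ∘ₗ ι) + θ (T X) := by
  have e : T = (T ∘ₗ ι) ∘ₗ P + θ.smulRight (T X) := by
    ext v
    conv_lhs => rw [hsplit v]
    simp
  conv_lhs => rw [e]
  rw [map_add, LinearMap.trace_comp_comm', LinearMap.trace_smulRight]

/-- The Levi-Civita connection of a hypersurface parametrized by a linear map. -/
lemma IsLeviCivitaWithin.restrict {s : Set E} {ι : F →L[ℝ] E} {B : E → E →L[ℝ] E →L[ℝ] ℝ}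
    {Γ : E → E →L[ℝ] E →L[ℝ] E} {b : F → F →L[ℝ] F →L[ℝ] ℝ} {γ : F → F →L[ℝ] F →L[ℝ] F} {z : F}
    (h : IsLeviCivitaWithin s B Γ (ι z)) (h' : IsLeviCivitaWithin univ b γ z)
    (hι : ∀ z, ι z ∈ s) (hb : ∀ᶠ y in 𝓝 z, ∀ a c, b y a c = B (ι y) (ι a) (ι c))
    (hB : DifferentiableWithinAt ℝ B s (ι z)) (hbd : DifferentiableAt ℝ b z)
    (hpos : IsPosDefForm (B (ι z))) (hposb : IsPosDefForm (b z))
    (htan : ∀ a c, ∃ d, Γ (ι z) (ι a) (ι c) = ι d) (a c : F) :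
    ι (γ z a c) = Γ (ι z) (ι a) (ι c) := by
  have hcomp : HasFDerivAt (fun y => B (ι y)) ((fderivWithin ℝ B s (ι z)).comp ι) z :=
    hB.hasFDerivWithinAt.comp_hasFDerivAt z ι.hasFDerivAt (Eventually.of_forall hι)
  have key : ∀ u v w : F, fderivWithin ℝ b univ z u v w
      = fderivWithin ℝ B s (ι z) (ι u) (ι v) (ι w) := by
    intro u v w
    rw [← fderivWithin_clm_apply_const₂ uniqueDiffWithinAt_univ hbd.differentiableWithinAt]
    have e1 : (fun y => b y v w) =ᶠ[𝓝[univ] z] fun y => B (ι y) (ι v) (ι w) := by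
      rw [nhdsWithin_univ]; exact hb.mono fun y hy => hy v w
    rw [e1.fderivWithin_eq_of_mem (mem_univ z), fderivWithin_clm_apply_const₂
      uniqueDiffWithinAt_univ hcomp.differentiableAt.differentiableWithinAt, fderivWithin_univ,
      hcomp.fderiv]
    rfl
  obtain ⟨d, hd⟩ := htan a c
  rw [hd]
  congr 1
  refine hposb.eq_of_forall fun w => ?_
  have k0 := h.koszul hpos (ι a) (ι c) (ι w)
  have k1 := h'.koszul hposb a c w
  rw [key, key, key, ← k0, hd, ← hb.self_of_nhds] at k1
  linarith

/-- The Gauss equation for a totally geodesic hypersurface parametrized by a linear map. -/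
lemma curvatureOp_restrict {s : Set E} {ι : F →L[ℝ] E}
    {Γ : E → E →L[ℝ] E →L[ℝ] E} {γ : F → F →L[ℝ] F →L[ℝ] F} {z : F}
    (hι : ∀ z, ι z ∈ s) (h : ∀ᶠ y in 𝓝 z, ∀ a c, ι (γ y a c) = Γ (ι y) (ι a) (ι c))
    (hΓ : DifferentiableWithinAt ℝ Γ s (ι z)) (hγ : DifferentiableAt ℝ γ z) (a c d : F) :
    ι (curvatureOp univ γ z c d a) = curvatureOp s Γ (ι z) (ι c) (ι d) (ι a) := by
  have hcomp : HasFDerivAt (fun y => Γ (ι y)) ((fderivWithin ℝ Γ s (ι z)).comp ι) z :=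
    hΓ.hasFDerivWithinAt.comp_hasFDerivAt z ι.hasFDerivAt (Eventually.of_forall hι)
  have key : ∀ u v w : F, ι (fderivWithin ℝ γ univ z u v w)
      = fderivWithin ℝ Γ s (ι z) (ι u) (ι v) (ι w) := by
    intro u v w
    have e1 : (fun y => ι (γ y v w)) =ᶠ[𝓝[univ] z] fun y => Γ (ι y) (ι v) (ι w) := by
      rw [nhdsWithin_univ]; exact h.mono fun y hy => hy v w
    have e2 := congrArg (fun l : F →L[ℝ] E => l u) (e1.fderivWithin_eq_of_mem (mem_univ z))
    rw [fderivWithin_clm_apply_const₂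
      uniqueDiffWithinAt_univ hcomp.differentiableAt.differentiableWithinAt, fderivWithin_univ,
      fderivWithin_univ, hcomp.fderiv] at e2
    refine Eq.trans ?_ e2
    have d1 : HasFDerivAt (fun y => γ y v w) (((fderiv ℝ γ z).flip v).flip w) z := by
      have := (hγ.hasFDerivAt.clm_apply (hasFDerivAt_const v z)).clm_apply (hasFDerivAt_const w z)
      refine this.congr_fderiv ?_
      ext; simp
    have d2 : HasFDerivAt (fun y => ι (γ y v w)) (ι.comp (((fderiv ℝ γ z).flip v).flip w)) z :=
      ι.hasFDerivAt.comp z d1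
    rw [d2.fderiv, fderivWithin_univ]
    rfl
  have h0 := h.self_of_nhds
  rw [curvatureOp_apply, curvatureOp_apply]
  simp only [map_add, map_sub, key, h0]

/-- Scalar curvature of a totally geodesic hypersurface with unit normal `X`:
`R = R_γ + 2 Ric(X, X)`. -/
lemma trace_ricci_restrict [FiniteDimensional ℝ E] [FiniteDimensional ℝ F] {s : Set E}
    {ι : F →L[ℝ] E} {B : E →L[ℝ] E →L[ℝ] ℝ} {b : F →L[ℝ] F →L[ℝ] ℝ}
    {Γ : E → E →L[ℝ] E →L[ℝ] E} {γ : F → F →L[ℝ] F →L[ℝ] F} {x X : E} {z : F} {P : E →ₗ[ℝ] F}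
    (hB : IsPosDefForm B) (hb : IsPosDefForm b) (hbB : ∀ a c, b a c = B (ι a) (ι c))
    (hperp : ∀ a, B X (ι a) = 0) (hP : ∀ a, P (ι a) = a)
    (hsplit : ∀ v, v = ι (P v) + B X v • X)
    (hcurv : ∀ a c d, ι (curvatureOp univ γ z c d a) = curvatureOp s Γ x (ι c) (ι d) (ι a))
    (hskew : ∀ u v w y, B (curvatureOp s Γ x v w u) y + B w (curvatureOp s Γ x v y u) = 0)
    {A : E →ₗ[ℝ] E} {A' : F →ₗ[ℝ] F} (hA : ∀ u v, B (A u) v = ricciForm s Γ x u v)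
    (hA' : ∀ u v, b (A' u) v = ricciForm univ γ z u v) :
    LinearMap.trace ℝ E A = LinearMap.trace ℝ F A' + 2 * ricciForm s Γ x X X := by
  have htr := fun T => trace_eq_add_of_splitting (ι := ι.toLinearMap) (P := P)
    (θ := (B X).toLinearMap) (X := X) hsplit T
  have hPb : ∀ v a, b (P v) a = B v (ι a) := by
    intro v a
    conv_rhs => rw [hsplit v]
    simp [hbB, hperp]
  set Q : F →ₗ[ℝ] F := P ∘ₗ (curvatureOp s Γ x X X) ∘ₗ ι.toLinearMap with hQ
  have hXX : curvatureOp s Γ x X X X = 0 := by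
    rw [curvatureOp_apply]; abel
  have hricX : ricciForm s Γ x X X = LinearMap.trace ℝ F Q := by
    rw [ricciForm, htr, hXX, map_zero, add_zero]
  -- Compressed to the hypersurface, the Ricci endomorphism is the intrinsic one plus `Q`, the
  -- compression of `R(·, X)X`, whose trace is `Ric(X, X)`. The normal direction contributes `Ric(X,
  -- X)` once more, whence the factor two.
  have hPA : P ∘ₗ A ∘ₗ ι.toLinearMap = A' + Q := by
    ext a
    refine hb.eq_of_forall fun c => ?_
    have h1 : ricciForm s Γ x (ι a) (ι c) = ricciForm univ γ z a c
        + B X (curvatureOp s Γ x (ι a) (ι c) X) := by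
      rw [ricciForm, htr, ricciForm]
      congr 2
      ext d
      simp [← hcurv, hP]
    -- Skew-symmetry in the metric, together with antisymmetry in the first pair, moves `X` into
    -- both inner slots.
    have h2 : B X (curvatureOp s Γ x (ι a) (ι c) X) = B (curvatureOp s Γ x X X (ι a)) (ι c) := by
      have := hskew X (ι a) (ι c) X
      have h3 := curvatureOp_swap s Γ x X (ι a) X
      rw [h3, map_neg, hB.symm (ι c)] at this
      rw [hB.symm X]
      linarith
    simp [hPb, hA, hA', h1, h2, hQ]
  rw [htr, hPA, map_add, ← hricX]
  simp only [ContinuousLinearMap.coe_coe]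
  rw [hB.symm, hA]
  ring

end LocalConnection

section Coordinates

variable {n : ℕ} {W : Type*} [NormedAddCommGroup W] [NormedSpace ℝ W]

/-! ## Coordinate expressions -/

/-- The `i`-th standard basis vector. -/
abbrev stdVec (i : Fin n) : EuclideanSpace ℝ (Fin n) := EuclideanSpace.single i (1 : ℝ)

lemma EuclideanSpace.clm_ext {f g : EuclideanSpace ℝ (Fin n) →L[ℝ] W}
    (h : ∀ i, f (stdVec i) = g (stdVec i)) : f = g := by
  have : f.toLinearMap = g.toLinearMap :=
    (EuclideanSpace.basisFun (Fin n) ℝ).toBasis.ext fun i => by simpa using h i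
  ext v
  exact congrArg (fun l => l v) this

lemma EuclideanSpace.trace_eq_sum (T : EuclideanSpace ℝ (Fin n) →ₗ[ℝ] EuclideanSpace ℝ (Fin n)) :
    LinearMap.trace ℝ _ T = ∑ i, T (stdVec i) i := by
  rw [LinearMap.trace_eq_matrix_trace ℝ (EuclideanSpace.basisFun (Fin n) ℝ).toBasis, Matrix.trace]
  simp [LinearMap.toMatrix_apply]

/-- The bilinear form with the given matrix. -/
def matrixForm (A : Matrix (Fin n) (Fin n) ℝ) :
    EuclideanSpace ℝ (Fin n) →L[ℝ] EuclideanSpace ℝ (Fin n) →L[ℝ] ℝ :=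
  ∑ i, ∑ j, A i j • (EuclideanSpace.proj i : EuclideanSpace ℝ (Fin n) →L[ℝ] ℝ).smulRight
    (EuclideanSpace.proj j : EuclideanSpace ℝ (Fin n) →L[ℝ] ℝ)

lemma matrixForm_apply (A : Matrix (Fin n) (Fin n) ℝ) (u v : EuclideanSpace ℝ (Fin n)) :
    matrixForm A u v = ∑ i, ∑ j, A i j * (u i * v j) := by
  simp [matrixForm, sum_apply]

@[simp] lemma matrixForm_single (A : Matrix (Fin n) (Fin n) ℝ) (i j : Fin n) :
    matrixForm A (stdVec i) (stdVec j) = A i j := by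
  rw [matrixForm_apply, Finset.sum_eq_single i, Finset.sum_eq_single j] <;>
    simp +contextual [PiLp.single_apply]

lemma matrixForm_single_right (A : Matrix (Fin n) (Fin n) ℝ) (u : EuclideanSpace ℝ (Fin n))
    (j : Fin n) : matrixForm A u (stdVec j) = ∑ i, u i * A i j := by
  rw [matrixForm_apply]
  refine Finset.sum_congr rfl fun i _ => ?_
  rw [Finset.sum_eq_single j] <;> simp +contextual [PiLp.single_apply, mul_comm]

lemma contDiffWithinAt_matrixForm {G : W → Matrix (Fin n) (Fin n) ℝ} {s : Set W} {x : W}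
    {m : WithTop ℕ∞} (h : ∀ i j, ContDiffWithinAt ℝ m (fun y => G y i j) s x) :
    ContDiffWithinAt ℝ m (fun y => matrixForm (G y)) s x := by
  unfold matrixForm
  exact ContDiffWithinAt.sum fun i _ => ContDiffWithinAt.sum fun j _ =>
    (h i j).smul contDiffWithinAt_const

lemma IsPosDefForm.matrix_symm {A : Matrix (Fin n) (Fin n) ℝ} (h : IsPosDefForm (matrixForm A))
    (i j : Fin n) : A i j = A j i := by
  simpa using h.symm (stdVec i) (stdVec j)

lemma IsPosDefForm.posDef {A : Matrix (Fin n) (Fin n) ℝ} (h : IsPosDefForm (matrixForm A)) :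
    A.PosDef := by
  refine Matrix.PosDef.of_dotProduct_mulVec_pos (Matrix.IsHermitian.ext fun i j => by
    simpa using h.matrix_symm j i) fun v hv => ?_
  have := h.pos (WithLp.toLp 2 v) (by simpa using hv)
  rw [matrixForm_apply] at this
  simpa [dotProduct, Matrix.mulVec, Finset.mul_sum, mul_left_comm, mul_assoc] using this

lemma IsPosDefForm.isUnit_det {A : Matrix (Fin n) (Fin n) ℝ} (h : IsPosDefForm (matrixForm A)) :
    IsUnit A.det := h.posDef.det_pos.ne'.isUnit

lemma IsPosDefForm.inv_symm {A : Matrix (Fin n) (Fin n) ℝ} (h : IsPosDefForm (matrixForm A))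
    (i j : Fin n) : A⁻¹ i j = A⁻¹ j i := by
  simpa using (h.posDef.inv.isHermitian.apply j i)

lemma ContDiffWithinAt.matrix_det {m : ℕ} {G : W → Matrix (Fin m) (Fin m) ℝ} {s : Set W} {x : W}
    {k : WithTop ℕ∞} (h : ∀ i j, ContDiffWithinAt ℝ k (fun y => G y i j) s x) :
    ContDiffWithinAt ℝ k (fun y => (G y).det) s x := by
  simp only [Matrix.det_apply]
  exact ContDiffWithinAt.sum fun σ _ => (contDiffWithinAt_prod fun i _ => h _ _).const_smul _

/-- Cramer's rule: the entries are determinants divided by a nonvanishing determinant. -/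
lemma ContDiffWithinAt.matrix_inv {G : W → Matrix (Fin n) (Fin n) ℝ} {s : Set W} {x : W}
    {k : WithTop ℕ∞} (h : ∀ i j, ContDiffWithinAt ℝ k (fun y => G y i j) s x)
    (hdet : (G x).det ≠ 0) (i j : Fin n) :
    ContDiffWithinAt ℝ k (fun y => (G y)⁻¹ i j) s x := by
  simp only [Matrix.inv_def, Matrix.smul_apply, Ring.inverse_eq_inv', Matrix.adjugate_apply,
    smul_eq_mul]
  refine ((ContDiffWithinAt.matrix_det h).inv hdet).mul (ContDiffWithinAt.matrix_det fun a b => ?_)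
  by_cases hab : a = j
  · subst hab; simpa using contDiffWithinAt_const
  · simpa [Matrix.updateRow_ne hab] using h a b

/-! ### Metric traces -/

/-- The trace of a bilinear form with respect to a metric. -/
lemma sum_inv_mul_eq_trace {A : Matrix (Fin n) (Fin n) ℝ} (h : IsPosDefForm (matrixForm A))
    {H : EuclideanSpace ℝ (Fin n) → EuclideanSpace ℝ (Fin n) → ℝ}
    {T : EuclideanSpace ℝ (Fin n) →ₗ[ℝ] EuclideanSpace ℝ (Fin n)}
    (hT : ∀ u v, matrixForm A (T u) v = H u v) :
    ∑ j, ∑ k, A⁻¹ j k * H (stdVec j) (stdVec k) = LinearMap.trace ℝ _ T := by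
  rw [EuclideanSpace.trace_eq_sum]
  refine Finset.sum_congr rfl fun j _ => ?_
  simp only [← hT, matrixForm_single_right, Finset.mul_sum]
  rw [Finset.sum_comm]
  have : ∀ m, ∑ k, A⁻¹ j k * (T (stdVec j) m * A m k) = T (stdVec j) m * (1 : Matrix _ _ ℝ) j m := by
    intro m
    rw [← Matrix.nonsing_inv_mul A h.isUnit_det, Matrix.mul_apply, Finset.mul_sum]
    refine Finset.sum_congr rfl fun k _ => ?_
    rw [h.matrix_symm m k]; ring
  simp [this, Matrix.one_apply]

/-- The matrix of an endomorphism representing a symmetric form. -/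
lemma trace_comp_self_eq_trace_mul {A H : Matrix (Fin n) (Fin n) ℝ}
    (h : IsPosDefForm (matrixForm A))
    {T : EuclideanSpace ℝ (Fin n) →ₗ[ℝ] EuclideanSpace ℝ (Fin n)}
    (hT : ∀ i j, matrixForm A (T (stdVec i)) (stdVec j) = H i j) (hH : ∀ i j, H i j = H j i) :
    LinearMap.trace ℝ _ (T ∘ₗ T) = (A⁻¹ * H * A⁻¹ * H).trace := by
  let b := (EuclideanSpace.basisFun (Fin n) ℝ).toBasis
  have e : LinearMap.toMatrix b b T = A⁻¹ * H := by
    have : A * LinearMap.toMatrix b b T = H := by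
      ext i j
      rw [hH, ← hT, matrixForm_single_right, Matrix.mul_apply]
      refine Finset.sum_congr rfl fun k _ => ?_
      rw [h.matrix_symm i k, LinearMap.toMatrix_apply, mul_comm]
      simp [b]
    rw [← this, ← Matrix.mul_assoc, Matrix.nonsing_inv_mul A h.isUnit_det, one_mul]
  rw [LinearMap.trace_eq_matrix_trace ℝ b, LinearMap.toMatrix_comp b b b, e, ← Matrix.mul_assoc]

lemma sum_inv_inv_mul_eq_trace {A H : Matrix (Fin n) (Fin n) ℝ}
    (h : IsPosDefForm (matrixForm A)) (hH : ∀ i j, H i j = H j i) :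
    ∑ i, ∑ j, ∑ k, ∑ l, A⁻¹ i k * A⁻¹ j l * H i j * H k l = (A⁻¹ * H * A⁻¹ * H).trace := by
  simp only [Matrix.trace, Matrix.diag, Matrix.mul_apply, Finset.sum_mul]
  refine Finset.sum_congr rfl fun i _ => Finset.sum_congr rfl fun j _ => ?_
  rw [Finset.sum_comm]
  refine Finset.sum_congr rfl fun l _ => Finset.sum_congr rfl fun k _ => ?_
  rw [h.inv_symm j l, hH i j]
  ring

-- Write `A⁻¹ = R* R`. By cyclicity the trace equals that of `S S*` with `S = R H R*`, a sum of
-- squares.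
open scoped MatrixOrder Matrix.Norms.L2Operator in
lemma trace_inv_mul_inv_mul_nonneg {A H : Matrix (Fin n) (Fin n) ℝ}
    (h : IsPosDefForm (matrixForm A)) (hH : ∀ i j, H i j = H j i) :
    0 ≤ (A⁻¹ * H * A⁻¹ * H).trace := by
  obtain ⟨R, hR⟩ := CStarAlgebra.nonneg_iff_eq_star_mul_self.1 h.posDef.inv.posSemidef.nonneg
  have hHt : H.conjTranspose = H := by ext i j; simpa using hH j i
  have e : (A⁻¹ * H * A⁻¹ * H).trace
      = ((R * H * R.conjTranspose) * (R * H * R.conjTranspose).conjTranspose).trace := by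
    rw [hR, Matrix.star_eq_conjTranspose]
    simp only [Matrix.conjTranspose_mul, Matrix.conjTranspose_conjTranspose, hHt]
    rw [Matrix.mul_assoc R.conjTranspose R H, Matrix.mul_assoc R.conjTranspose,
      Matrix.mul_assoc R.conjTranspose, Matrix.trace_mul_comm]
    simp only [Matrix.mul_assoc]
  rw [e]
  exact (Matrix.posSemidef_self_mul_conjTranspose _).trace_nonneg

/-! ### Christoffel symbols and curvature in coordinates -/

/-- The Christoffel symbols as a field of bilinear maps. -/
def christoffelForm (s : Set (EuclideanSpace ℝ (Fin n)))
    (G : EuclideanSpace ℝ (Fin n) → Matrix (Fin n) (Fin n) ℝ) (y : EuclideanSpace ℝ (Fin n)) :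
    EuclideanSpace ℝ (Fin n) →L[ℝ] EuclideanSpace ℝ (Fin n) →L[ℝ] EuclideanSpace ℝ (Fin n) :=
  ∑ i, ∑ j, ∑ k, christoffel s G k i j y •
    (EuclideanSpace.proj i : EuclideanSpace ℝ (Fin n) →L[ℝ] ℝ).smulRight
      ((EuclideanSpace.proj j : EuclideanSpace ℝ (Fin n) →L[ℝ] ℝ).smulRight (stdVec k))

@[simp] lemma christoffelForm_single (s : Set (EuclideanSpace ℝ (Fin n)))
    (G : EuclideanSpace ℝ (Fin n) → Matrix (Fin n) (Fin n) ℝ) (y : EuclideanSpace ℝ (Fin n))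
    (i j k : Fin n) :
    christoffelForm s G y (stdVec i) (stdVec j) k = christoffel s G k i j y := by
  have : christoffelForm s G y (stdVec i) (stdVec j) = ∑ k, christoffel s G k i j y • stdVec k := by
    simp only [christoffelForm, sum_apply]
    rw [Finset.sum_eq_single i, Finset.sum_eq_single j] <;>
      simp +contextual [PiLp.single_apply]
  rw [this]
  simp [Pi.single_apply]

/-- `G` is in a neighbourhood of `x` in `s` the matrix of a metric of class `C²`. -/
structure IsC2MetricWithinAt (s : Set (EuclideanSpace ℝ (Fin n)))
    (G : EuclideanSpace ℝ (Fin n) → Matrix (Fin n) (Fin n) ℝ) (x : EuclideanSpace ℝ (Fin n)) :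
    Prop where
  contDiff : ∀ i j, ContDiffWithinAt ℝ 2 (fun y => G y i j) s x
  posDef : ∀ᶠ y in 𝓝[s] x, IsPosDefForm (matrixForm (G y))

variable {s : Set (EuclideanSpace ℝ (Fin n))}
  {G : EuclideanSpace ℝ (Fin n) → Matrix (Fin n) (Fin n) ℝ} {x : EuclideanSpace ℝ (Fin n)}

lemma ContDiffWithinAt.eventually_nhdsWithin {V : Type*} [NormedAddCommGroup V] [NormedSpace ℝ V]
    {f : V → W} {s : Set V} {x : V} {k : ℕ} (h : ContDiffWithinAt ℝ k f s x) (hx : x ∈ s) :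
    ∀ᶠ y in 𝓝[s] x, ContDiffWithinAt ℝ k f s y := by
  have := h.eventually (by simp)
  rwa [insert_eq_of_mem hx] at this

lemma IsC2MetricWithinAt.eventually (h : IsC2MetricWithinAt s G x) (hx : x ∈ s) :
    ∀ᶠ y in 𝓝[s] x, IsC2MetricWithinAt s G y := by
  have h1 : ∀ᶠ y in 𝓝[s] x, ∀ i j, ContDiffWithinAt ℝ 2 (fun y => G y i j) s y := by
    simp only [Filter.eventually_all]
    exact fun i j => (h.contDiff i j).eventually_nhdsWithin hx
  filter_upwards [h1, eventually_eventually_nhdsWithin.2 h.posDef] with y hy1 hy2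
  exact ⟨hy1, hy2⟩

lemma IsC2MetricWithinAt.contDiff_matrixForm (h : IsC2MetricWithinAt s G x) :
    ContDiffWithinAt ℝ 2 (fun y => matrixForm (G y)) s x := contDiffWithinAt_matrixForm h.contDiff

/-- One derivative of `G` is used up. The curvature is thus only continuous, which is why later
arguments never differentiate it directly. -/
lemma IsC2MetricWithinAt.contDiff_christoffel (h : IsC2MetricWithinAt s G x) (hx : x ∈ s)
    (hs : UniqueDiffOn ℝ s) (k i j : Fin n) :
    ContDiffWithinAt ℝ 1 (christoffel s G k i j) s x := by
  have hp := h.posDef.self_of_nhdsWithin hx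
  have hd : ∀ a b c, ContDiffWithinAt ℝ 1 (partialDerivWithin s (fun z => G z a b) c) s x := by
    intro a b c
    exact ((h.contDiff a b).fderivWithin_right hs (by norm_num) hx).clm_apply contDiffWithinAt_const
  refine contDiffWithinAt_const.mul (ContDiffWithinAt.sum fun l _ => ?_)
  refine (ContDiffWithinAt.matrix_inv (fun a b => (h.contDiff a b).of_le (by norm_num))
    hp.isUnit_det.ne_zero k l).mul ?_
  exact ((hd _ _ _).add (hd _ _ _)).sub (hd _ _ _)

lemma IsC2MetricWithinAt.contDiff_christoffelForm (h : IsC2MetricWithinAt s G x) (hx : x ∈ s)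
    (hs : UniqueDiffOn ℝ s) : ContDiffWithinAt ℝ 1 (christoffelForm s G) s x := by
  unfold christoffelForm
  exact ContDiffWithinAt.sum fun i _ => ContDiffWithinAt.sum fun j _ =>
    ContDiffWithinAt.sum fun k _ => (h.contDiff_christoffel hx hs k i j).smul contDiffWithinAt_const

lemma IsC2MetricWithinAt.differentiable_matrixForm (h : IsC2MetricWithinAt s G x) :
    DifferentiableWithinAt ℝ (fun y => matrixForm (G y)) s x :=
  h.contDiff_matrixForm.differentiableWithinAt (by norm_num)

lemma IsC2MetricWithinAt.fderivWithin_matrixForm (h : IsC2MetricWithinAt s G x)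
    (hs : UniqueDiffWithinAt ℝ s x) (i j k : Fin n) :
    fderivWithin ℝ (fun y => matrixForm (G y)) s x (stdVec i) (stdVec j) (stdVec k)
      = partialDerivWithin s (fun z => G z j k) i x := by
  rw [← fderivWithin_clm_apply_const₂ hs h.differentiable_matrixForm, partialDerivWithin]
  simp

/-- The Christoffel symbols are those of the Levi-Civita connection. -/
lemma IsC2MetricWithinAt.isLeviCivitaWithin (h : IsC2MetricWithinAt s G x) (hx : x ∈ s)
    (hs : UniqueDiffWithinAt ℝ s x) :
    IsLeviCivitaWithin s (fun y => matrixForm (G y)) (christoffelForm s G) x := by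
  have hp := h.posDef.self_of_nhdsWithin hx
  have hsym : ∀ a b c, partialDerivWithin s (fun z => G z a b) c x
      = partialDerivWithin s (fun z => G z b a) c x := by
    intro a b c
    have : (fun z => G z a b) =ᶠ[𝓝[s] x] fun z => G z b a :=
      h.posDef.mono fun y hy => hy.matrix_symm a b
    rw [partialDerivWithin, partialDerivWithin, this.fderivWithin_eq_of_mem hx]
  have hlow : ∀ i j m, matrixForm (G x) (christoffelForm s G x (stdVec i) (stdVec j)) (stdVec m)
      = (1 / 2 : ℝ) * (partialDerivWithin s (fun z => G z j m) i x
        + partialDerivWithin s (fun z => G z i m) j x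
        - partialDerivWithin s (fun z => G z i j) m x) := by
    intro i j m
    rw [matrixForm_single_right]
    simp only [christoffelForm_single, christoffel, Finset.mul_sum, Finset.sum_mul]
    rw [Finset.sum_comm]
    have e : ∀ l, ∑ k, (1 / 2 : ℝ) * ((G x)⁻¹ k l *
        (partialDerivWithin s (fun z => G z j l) i x + partialDerivWithin s (fun z => G z i l) j x
        - partialDerivWithin s (fun z => G z i j) l x)) * G x k m
        = (1 : Matrix (Fin n) (Fin n) ℝ) m l * ((1 / 2 : ℝ) *
          (partialDerivWithin s (fun z => G z j l) i x + partialDerivWithin s (fun z => G z i l) j x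
            - partialDerivWithin s (fun z => G z i j) l x)) := by
      intro l
      rw [← Matrix.mul_nonsing_inv (G x) hp.isUnit_det, Matrix.mul_apply, Finset.sum_mul]
      refine Finset.sum_congr rfl fun k _ => ?_
      rw [hp.matrix_symm m k]; ring
    simp only [e]
    simp [Matrix.one_apply]
  set B := fun y => matrixForm (G y) with hB
  set Γ := christoffelForm s G with hΓ
  have hsymm : ∀ u v, Γ x u v = Γ x v u := by
    have e : Γ x = (Γ x).flip := by
      refine EuclideanSpace.clm_ext fun i => EuclideanSpace.clm_ext fun j => ?_
      ext k
      rw [ContinuousLinearMap.flip_apply, hΓ, christoffelForm_single, christoffelForm_single,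
        christoffel, christoffel]
      congr 1
      refine Finset.sum_congr rfl fun l _ => ?_
      rw [hsym i j l, add_comm (partialDerivWithin s (fun z => G z j l) i x)]
    intro u v
    conv_lhs => rw [e]
    rfl
  refine ⟨hsymm, ?_⟩
  -- Metric compatibility is known on basis vectors from `hlow`. It is extended by linearity one
  -- slot at a time.
  have h1 : ∀ i j, fderivWithin ℝ B s x (stdVec i) (stdVec j)
      = B x (Γ x (stdVec i) (stdVec j)) + (B x (stdVec j)).comp (Γ x (stdVec i)) := by
    refine fun i j => EuclideanSpace.clm_ext fun m => ?_
    rw [add_apply, ContinuousLinearMap.comp_apply, hp.symm (stdVec j), hB,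
      h.fderivWithin_matrixForm hs, hlow, hlow, hsym m j i]
    ring
  have h2 : ∀ i w, (fderivWithin ℝ B s x (stdVec i)).flip w
      = ((B x).flip w).comp (Γ x (stdVec i)) + (B x).flip (Γ x (stdVec i) w) := by
    refine fun i w => EuclideanSpace.clm_ext fun j => ?_
    simpa using congrArg (fun l => l w) (h1 i j)
  have h3 : ∀ v w, ((fderivWithin ℝ B s x).flip v).flip w
      = ((B x).flip w).comp ((Γ x).flip v) + (B x v).comp ((Γ x).flip w) := by
    refine fun v w => EuclideanSpace.clm_ext fun i => ?_
    simpa using congrArg (fun l => l v) (h2 i w)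
  intro u v w
  simpa using congrArg (fun l => l u) (h3 v w)

/-- The coordinate formula is the trace defining `ricciForm`, evaluated on the standard basis: `e`
handles the derivative terms and `e3` the quadratic ones. -/
lemma IsC2MetricWithinAt.ricciCoord_eq (h : IsC2MetricWithinAt s G x) (hx : x ∈ s)
    (hs : UniqueDiffOn ℝ s) (j k : Fin n) :
    ricciCoord s G j k x = ricciForm s (christoffelForm s G) x (stdVec j) (stdVec k) := by
  have hd := (h.contDiff_christoffelForm hx hs).differentiableWithinAt one_ne_zero
  have e : ∀ k i j l, partialDerivWithin s (christoffel s G k i j) l x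
      = fderivWithin ℝ (christoffelForm s G) s x (stdVec l) (stdVec i) (stdVec j) k := by
    intro k i j l
    have e1 : christoffel s G k i j = fun y =>
        (EuclideanSpace.proj k : EuclideanSpace ℝ (Fin n) →L[ℝ] ℝ)
          (christoffelForm s G y (stdVec i) (stdVec j)) := by ext y; simp
    have hd2 := (hd.clm_apply (differentiableWithinAt_const (stdVec i))).clm_apply
      (differentiableWithinAt_const (stdVec j))
    rw [partialDerivWithin, e1, ← fderivWithin_clm_apply_const₂ (hs x hx) hd]
    have := ((EuclideanSpace.proj k : EuclideanSpace ℝ (Fin n) →L[ℝ] ℝ).hasFDerivAt).comp_hasFDerivWithinAt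
      x hd2.hasFDerivWithinAt
    exact congrArg (fun f : EuclideanSpace ℝ (Fin n) →L[ℝ] ℝ => f (stdVec l))
      (this.fderivWithin (hs x hx))
  have e2 : ∀ (v : EuclideanSpace ℝ (Fin n)) i k, christoffelForm s G x (stdVec i) v k
      = ∑ p, christoffel s G k i p x * v p := by
    intro v i k
    have : (EuclideanSpace.proj k : EuclideanSpace ℝ (Fin n) →L[ℝ] ℝ).comp
        (christoffelForm s G x (stdVec i))
        = ∑ p, christoffel s G k i p x • (EuclideanSpace.proj p) := by
      refine EuclideanSpace.clm_ext fun j => ?_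
      simp [sum_apply, PiLp.single_apply]
    simpa [sum_apply] using congrArg (fun l => l v) this
  have e3 : ∀ i j l k, christoffelForm s G x (stdVec i) (christoffelForm s G x (stdVec j) (stdVec l)) k
      = ∑ p, christoffel s G k i p x * christoffel s G p j l x := by
    intro i j l k
    rw [e2]
    simp only [christoffelForm_single]
  rw [ricciForm, EuclideanSpace.trace_eq_sum, ricciCoord, ← Finset.sum_add_distrib]
  refine Finset.sum_congr rfl fun i _ => ?_
  rw [curvatureOp_apply, e, e]
  simp only [PiLp.add_apply, PiLp.sub_apply, e3, Finset.sum_sub_distrib]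
  ring

lemma IsC2MetricWithinAt.scalarCurvatureCoord_eq (h : IsC2MetricWithinAt s G x) (hx : x ∈ s)
    (hs : UniqueDiffOn ℝ s)
    {T : EuclideanSpace ℝ (Fin n) →ₗ[ℝ] EuclideanSpace ℝ (Fin n)}
    (hT : ∀ u v, matrixForm (G x) (T u) v = ricciForm s (christoffelForm s G) x u v) :
    scalarCurvatureCoord s G x = LinearMap.trace ℝ _ T := by
  rw [← sum_inv_mul_eq_trace (h.posDef.self_of_nhdsWithin hx) hT, scalarCurvatureCoord]
  simp only [h.ricciCoord_eq hx hs]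

lemma hessianCoord_eq (f : EuclideanSpace ℝ (Fin n) → ℝ) (hs : UniqueDiffWithinAt ℝ s x)
    (hf : DifferentiableWithinAt ℝ (fderivWithin ℝ f s) s x) (i j : Fin n) :
    hessianCoord s G f i j x = fderivWithin ℝ (fderivWithin ℝ f s) s x (stdVec i) (stdVec j)
      - fderivWithin ℝ f s x (christoffelForm s G x (stdVec i) (stdVec j)) := by
  have e1 : partialDerivWithin s (partialDerivWithin s f j) i x
      = fderivWithin ℝ (fderivWithin ℝ f s) s x (stdVec i) (stdVec j) := by
    unfold partialDerivWithin
    rw [fderivWithin_clm_apply hs hf (differentiableWithinAt_const _)]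
    simp
  have e2 : ∀ v : EuclideanSpace ℝ (Fin n), fderivWithin ℝ f s x v
      = ∑ k, v k * partialDerivWithin s f k x := by
    intro v
    have : fderivWithin ℝ f s x = ∑ k, partialDerivWithin s f k x • (EuclideanSpace.proj k) := by
      refine EuclideanSpace.clm_ext fun j => ?_
      simp [sum_apply, PiLp.single_apply, partialDerivWithin]
    conv_lhs => rw [this]
    simp [sum_apply, mul_comm]
  rw [hessianCoord, e1, e2]
  simp

/-- The gradient in coordinates. -/
def gradientCoord (s : Set (EuclideanSpace ℝ (Fin n)))
    (G : EuclideanSpace ℝ (Fin n) → Matrix (Fin n) (Fin n) ℝ)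
    (f : EuclideanSpace ℝ (Fin n) → ℝ) (y : EuclideanSpace ℝ (Fin n)) :
    EuclideanSpace ℝ (Fin n) :=
  WithLp.toLp 2 fun k => ∑ l, (G y)⁻¹ k l * partialDerivWithin s f l y

lemma matrixForm_gradientCoord {y : EuclideanSpace ℝ (Fin n)}
    (h : IsPosDefForm (matrixForm (G y))) (f : EuclideanSpace ℝ (Fin n) → ℝ)
    (w : EuclideanSpace ℝ (Fin n)) :
    matrixForm (G y) (gradientCoord s G f y) w = fderivWithin ℝ f s y w := by
  have : matrixForm (G y) (gradientCoord s G f y) = fderivWithin ℝ f s y := by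
    refine EuclideanSpace.clm_ext fun j => ?_
    rw [matrixForm_single_right]
    simp only [gradientCoord, Finset.sum_mul]
    rw [Finset.sum_comm]
    have e : ∀ l, ∑ k, (G y)⁻¹ k l * partialDerivWithin s f l y * G y k j
        = (1 : Matrix (Fin n) (Fin n) ℝ) j l * partialDerivWithin s f l y := by
      intro l
      rw [← Matrix.mul_nonsing_inv (G y) h.isUnit_det, Matrix.mul_apply, Finset.sum_mul]
      refine Finset.sum_congr rfl fun k _ => ?_
      rw [h.matrix_symm j k]; ring
    simp only [e]
    simp [Matrix.one_apply, partialDerivWithin]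
  rw [this]

lemma IsC2MetricWithinAt.contDiff_gradientCoord (h : IsC2MetricWithinAt s G x) (hx : x ∈ s)
    (hs : UniqueDiffOn ℝ s) {f : EuclideanSpace ℝ (Fin n) → ℝ} (hf : ContDiffWithinAt ℝ 2 f s x) :
    ContDiffWithinAt ℝ 1 (gradientCoord s G f) s x := by
  refine (contDiffWithinAt_euclidean (𝕜 := ℝ)).2 fun k => ?_
  change ContDiffWithinAt ℝ 1 (fun y => ∑ l, (G y)⁻¹ k l * partialDerivWithin s f l y) s x
  refine ContDiffWithinAt.sum fun l _ => ?_
  refine (ContDiffWithinAt.matrix_inv (fun a b => (h.contDiff a b).of_le (by norm_num))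
    (h.posDef.self_of_nhdsWithin hx).isUnit_det.ne_zero k l).mul ?_
  exact (hf.fderivWithin_right hs (by norm_num) hx).clm_apply contDiffWithinAt_const

end Coordinates

lemma ricciForm_pullback_of_inverse {E F : Type*} [NormedAddCommGroup E] [NormedSpace ℝ E]
    [NormedAddCommGroup F] [NormedSpace ℝ F] {s : Set E} {s' : Set F} {x : E} {y : F}
    {Γ : E → E →L[ℝ] E →L[ℝ] E} {Γ' : F → F →L[ℝ] F →L[ℝ] F} {D : E →L[ℝ] F} {D' : F →L[ℝ] E}
    (hD : ∀ v, D' (D v) = v) (hD' : ∀ v, D (D' v) = v)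
    (h : ∀ u v w, D (curvatureOp s Γ x v w u) = curvatureOp s' Γ' y (D v) (D w) (D u)) (v w : E) :
    ricciForm s Γ x v w = ricciForm s' Γ' y (D v) (D w) :=
  ricciForm_pullback (LinearEquiv.ofLinearMap D.toLinearMap D'.toLinearMap (by ext; simp [hD'])
    (by ext; simp [hD])) h v w

/-! ### Independence of the chart: components of a metric, Christoffel symbols and curvature on the
manifold. -/

section Charts

variable {M : Type*} [TopologicalSpace M] [ChartedSpace (EuclideanHalfSpace 4) M]

/-- The closed half-space. -/
abbrev halfSpace : Set E4 := range (𝓡∂ 4)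

lemma uniqueDiffOn_halfSpace : UniqueDiffOn ℝ halfSpace := (𝓡∂ 4).uniqueDiffOn

/-- The bilinear form `g x` on the coordinate space of the chart at `x`. -/
def BilinField.formAt (g : BilinField M) (x : M) : E4 →L[ℝ] E4 →L[ℝ] ℝ := g x

variable [IsManifold (𝓡∂ 4) ∞ M]

instance : IsManifold (𝓡∂ 4) 1 M := IsManifold.of_le (n := ∞) (by simp)

/-- The tangent space at a point is modelled on the chart preferred there, so the derivative of an
inverse chart is the derivative of a coordinate change into that chart. -/
lemma coordField_eq {x₀ : M} {y : E4} (hy : y ∈ (extChartAt (𝓡∂ 4) x₀).target) (i : Fin 4) :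
    coordField x₀ i y = tangentCoordChange (𝓡∂ 4) x₀ ((extChartAt (𝓡∂ 4) x₀).symm y)
      ((extChartAt (𝓡∂ 4) x₀).symm y) (stdVec i) := by
  obtain ⟨D, hD⟩ : ∃ D : E4 →L[ℝ] E4,
      D = mfderivWithin 𝓘(ℝ, E4) (𝓡∂ 4) (extChartAt (𝓡∂ 4) x₀).symm (range (𝓡∂ 4)) y := ⟨_, rfl⟩
  have e : coordField x₀ i y = D (stdVec i) := by rw [hD]; rfl
  have h : HasFDerivWithinAt (writtenInExtChartAt 𝓘(ℝ, E4) (𝓡∂ 4) y (extChartAt (𝓡∂ 4) x₀).symm) D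
      ((extChartAt 𝓘(ℝ, E4) y).symm ⁻¹' range (𝓡∂ 4) ∩ range 𝓘(ℝ, E4))
      (extChartAt 𝓘(ℝ, E4) y y) := by
    rw [hD]
    exact (mdifferentiableWithinAt_extChartAt_symm (I := 𝓡∂ 4) hy).hasMFDerivWithinAt.2
  clear hD
  simp only [writtenInExtChartAt, extChartAt_model_space_eq_id, PartialEquiv.refl_symm,
    PartialEquiv.refl_coe, Function.comp_id, modelWithCornersSelf_coe, range_id, inter_univ,
    preimage_id, id] at h
  rw [e, tangentCoordChange_def, (extChartAt (𝓡∂ 4) x₀).right_inv hy]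
  have h' := h.fderivWithin ((𝓡∂ 4).uniqueDiffOn y (extChartAt_target_subset_range x₀ hy))
  exact (congrArg (fun l : E4 →L[ℝ] E4 => l (stdVec i)) h').symm

/-- This links components in an arbitrary chart with the form `g z` itself. All transformation rules
follow by comparing two charts through it. -/
lemma matrixForm_matrix (g : BilinField M) {x₀ z : M} (hz : z ∈ (extChartAt (𝓡∂ 4) x₀).source)
    (u v : E4) :
    matrixForm (g.matrix x₀ (extChartAt (𝓡∂ 4) x₀ z)) u v
      = g.formAt z (tangentCoordChange (𝓡∂ 4) x₀ z z u) (tangentCoordChange (𝓡∂ 4) x₀ z z v) := by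
  have hy := (extChartAt (𝓡∂ 4) x₀).map_source hz
  set D : E4 →L[ℝ] E4 := tangentCoordChange (𝓡∂ 4) x₀ z z with hD
  have : matrixForm (g.matrix x₀ (extChartAt (𝓡∂ 4) x₀ z)) = (g.formAt z).bilinearComp D D := by
    refine EuclideanSpace.clm_ext fun i => EuclideanSpace.clm_ext fun j => ?_
    rw [matrixForm_single, ContinuousLinearMap.bilinearComp_apply]
    have key : ∀ w : M, w = z → (extChartAt (𝓡∂ 4) x₀).symm (extChartAt (𝓡∂ 4) x₀ z) = w →
      g.matrix x₀ (extChartAt (𝓡∂ 4) x₀ z) i j = g.formAt w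
        (tangentCoordChange (𝓡∂ 4) x₀ w w (stdVec i)) (tangentCoordChange (𝓡∂ 4) x₀ w w (stdVec j)) := by
      rintro w - rfl
      rw [BilinField.matrix, Matrix.of_apply, coordField_eq hy, coordField_eq hy]
      rfl
    exact key z rfl ((extChartAt (𝓡∂ 4) x₀).left_inv hz)
  rw [this]
  rfl

lemma matrixForm_matrix_self (g : BilinField M) (x : M) (u v : E4) :
    matrixForm (g.matrix x (coords x)) u v = g.formAt x u v := by
  rw [coords, matrixForm_matrix g (mem_extChartAt_source x),
    tangentCoordChange_self (mem_extChartAt_source x), 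
    tangentCoordChange_self (mem_extChartAt_source x)]

/-- The coordinate change between two charts. -/
def chartChange (x₀ x₁ : M) : E4 → E4 := extChartAt (𝓡∂ 4) x₁ ∘ (extChartAt (𝓡∂ 4) x₀).symm

lemma chartChange_apply {x₀ x₁ z : M} (hz : z ∈ (extChartAt (𝓡∂ 4) x₀).source) :
    chartChange x₀ x₁ (extChartAt (𝓡∂ 4) x₀ z) = extChartAt (𝓡∂ 4) x₁ z := by
  rw [chartChange, Function.comp_apply, (extChartAt (𝓡∂ 4) x₀).left_inv hz]

lemma fderivWithin_chartChange (x₀ x₁ z : M) :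
    fderivWithin ℝ (chartChange x₀ x₁) halfSpace (extChartAt (𝓡∂ 4) x₀ z)
      = tangentCoordChange (𝓡∂ 4) x₀ x₁ z := rfl

/-- The derivative of a coordinate change. -/
def coordChangeEquiv {x₀ x₁ z : M} (h₀ : z ∈ (extChartAt (𝓡∂ 4) x₀).source)
    (h₁ : z ∈ (extChartAt (𝓡∂ 4) x₁).source) : E4 ≃ₗ[ℝ] E4 :=
  LinearEquiv.ofLinearMap (tangentCoordChange (𝓡∂ 4) x₀ x₁ z : E4 →L[ℝ] E4).toLinearMap
    (tangentCoordChange (𝓡∂ 4) x₁ x₀ z : E4 →L[ℝ] E4).toLinearMap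
    (by ext1 v
        exact (tangentCoordChange_comp ⟨⟨h₁, h₀⟩, h₁⟩).trans (tangentCoordChange_self h₁))
    (by ext1 v
        exact (tangentCoordChange_comp ⟨⟨h₀, h₁⟩, h₀⟩).trans (tangentCoordChange_self h₀))

lemma matrixForm_coordChange (g : BilinField M) {x₀ x₁ z : M}
    (h₀ : z ∈ (extChartAt (𝓡∂ 4) x₀).source) (h₁ : z ∈ (extChartAt (𝓡∂ 4) x₁).source) (u v : E4) :
    matrixForm (g.matrix x₀ (extChartAt (𝓡∂ 4) x₀ z)) u v
      = matrixForm (g.matrix x₁ (extChartAt (𝓡∂ 4) x₁ z)) (tangentCoordChange (𝓡∂ 4) x₀ x₁ z u)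
        (tangentCoordChange (𝓡∂ 4) x₀ x₁ z v) := by
  have hz := mem_extChartAt_source (I := 𝓡∂ 4) z
  rw [matrixForm_matrix g h₀, matrixForm_matrix g h₁, tangentCoordChange_comp ⟨⟨h₀, h₁⟩, hz⟩,
    tangentCoordChange_comp ⟨⟨h₀, h₁⟩, hz⟩]

/-- Order three is what the tensoriality of curvature needs: the law for `Γ` contains a second
derivative and is differentiated once. -/
lemma contDiffWithinAt_chartChange {x₀ x₁ z : M} (h₀ : z ∈ (extChartAt (𝓡∂ 4) x₀).source)
    (h₁ : z ∈ (extChartAt (𝓡∂ 4) x₁).source) :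
    ContDiffWithinAt ℝ 3 (chartChange x₀ x₁) halfSpace (extChartAt (𝓡∂ 4) x₀ z) := by
  refine ContDiffWithinAt.of_le (n := ∞) ?_ (WithTop.coe_le_coe.2 (le_top : (3 : ℕ∞) ≤ ⊤))
  refine contDiffWithinAt_ext_coord_change x₁ x₀ ?_
  rw [PartialEquiv.trans_source'', PartialEquiv.symm_symm, PartialEquiv.symm_target]
  exact mem_image_of_mem _ ⟨h₀, h₁⟩

lemma extChartAt_mem_halfSpace (x₀ z : M) : extChartAt (𝓡∂ 4) x₀ z ∈ halfSpace := by
  simp [halfSpace]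

lemma tendsto_chartChange {x₀ x₁ z : M} (h₀ : z ∈ (extChartAt (𝓡∂ 4) x₀).source)
    (h₁ : z ∈ (extChartAt (𝓡∂ 4) x₁).source) :
    Tendsto (chartChange x₀ x₁) (𝓝[halfSpace] (extChartAt (𝓡∂ 4) x₀ z))
      (𝓝[halfSpace] (chartChange x₀ x₁ (extChartAt (𝓡∂ 4) x₀ z))) :=
  tendsto_nhdsWithin_iff.2 ⟨(contDiffWithinAt_chartChange h₀ h₁).continuousWithinAt.tendsto,
    .of_forall fun y => extChartAt_mem_halfSpace _ _⟩

/-- Points near `z` correspond to points near the coordinates of `z`. -/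
lemma eventually_extChartAt {x₀ z : M} (h₀ : z ∈ (extChartAt (𝓡∂ 4) x₀).source) {p : E4 → Prop}
    (h : ∀ᶠ w in 𝓝 z, p (extChartAt (𝓡∂ 4) x₀ w)) :
    ∀ᶠ y in 𝓝[halfSpace] (extChartAt (𝓡∂ 4) x₀ z), p y := by
  have e : Tendsto (extChartAt (𝓡∂ 4) x₀).symm (𝓝[halfSpace] (extChartAt (𝓡∂ 4) x₀ z)) (𝓝 z) := by
    have := (continuousAt_extChartAt_symm' h₀).tendsto
    rw [(extChartAt (𝓡∂ 4) x₀).left_inv h₀] at this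
    exact this.mono_left nhdsWithin_le_nhds
  have ht : (extChartAt (𝓡∂ 4) x₀).target ∈ 𝓝[halfSpace] (extChartAt (𝓡∂ 4) x₀ z) :=
    extChartAt_target_mem_nhdsWithin' h₀
  filter_upwards [e h, ht] with y hy hyt
  have : p (extChartAt (𝓡∂ 4) x₀ ((extChartAt (𝓡∂ 4) x₀).symm y)) := hy
  rwa [(extChartAt (𝓡∂ 4) x₀).right_inv hyt] at this

lemma tendsto_extChartAt_halfSpace {x₀ z : M} (h₀ : z ∈ (extChartAt (𝓡∂ 4) x₀).source) :
    Tendsto (extChartAt (𝓡∂ 4) x₀) (𝓝 z) (𝓝[halfSpace] (extChartAt (𝓡∂ 4) x₀ z)) :=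
  tendsto_nhdsWithin_iff.2 ⟨(continuousAt_extChartAt' h₀).tendsto,
    .of_forall fun y => extChartAt_mem_halfSpace _ _⟩

lemma contDiffWithinAt_inChart {t : M → ℝ} {x₀ z : M} (h₀ : z ∈ (extChartAt (𝓡∂ 4) x₀).source)
    (ht : ContMDiffAt (𝓡∂ 4) 𝓘(ℝ, ℝ) 2 t z) :
    ContDiffWithinAt ℝ 2 (inChart t x₀) halfSpace (extChartAt (𝓡∂ 4) x₀ z) := by
  have h1 := contMDiffWithinAt_extChartAt_symm_range (I := 𝓡∂ 4) (n := 2) x₀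
    ((extChartAt (𝓡∂ 4) x₀).map_source h₀)
  rw [← contMDiffWithinAt_iff_contDiffWithinAt]
  refine ContMDiffAt.comp_contMDiffWithinAt (I' := 𝓡∂ 4) _ ?_ h1
  rwa [(extChartAt (𝓡∂ 4) x₀).left_inv h₀]

/-- The components are the values of `g` on the local frame of the tangent bundle induced by the
trivialization at `x₀`. That frame is smooth and agrees with `coordField` over the chart domain. -/
lemma contDiffWithinAt_matrix {g : BilinField M} {k : ℕ∞} {x₀ z : M}
    (h₀ : z ∈ (extChartAt (𝓡∂ 4) x₀).source) (hg : g.ContMDiffAt k z) (i j : Fin 4) :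
    ContDiffWithinAt ℝ k (fun y => g.matrix x₀ y i j) halfSpace (extChartAt (𝓡∂ 4) x₀ z) := by
  let e := trivializationAt E4 (TangentSpace (𝓡∂ 4) : M → Type _) x₀
  let b := (EuclideanSpace.basisFun (Fin 4) ℝ).toBasis
  have hz : z ∈ e.baseSet := by simpa [e] using h₀
  have hV : ∀ i, ContMDiffAt (𝓡∂ 4) ((𝓡∂ 4).prod 𝓘(ℝ, E4)) (k : WithTop ℕ∞)
      (fun w => TotalSpace.mk' E4 w (e.localFrame b i w)) z := fun i =>
    ContMDiffAt.of_le (contMDiffAt_localFrame_of_mem (I := 𝓡∂ 4) (n := ∞) e b i hz)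
      (by exact_mod_cast le_top)
  have h1 : ContMDiffAt (𝓡∂ 4) ((𝓡∂ 4).prod 𝓘(ℝ, ℝ)) (k : WithTop ℕ∞)
      (fun w => TotalSpace.mk' ℝ (E := Bundle.Trivial M ℝ) w
        (g w (e.localFrame b i w) (e.localFrame b j w))) z :=
    ContMDiffAt.clm_bundle_apply₂ (F₁ := E4) (F₂ := E4) hg (hV i) (hV j)
  simp only [contMDiffAt_totalSpace] at h1
  have h2 := contMDiffWithinAt_extChartAt_symm_range (I := 𝓡∂ 4) (n := (k : WithTop ℕ∞)) x₀
    ((extChartAt (𝓡∂ 4) x₀).map_source h₀)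
  rw [← contMDiffWithinAt_iff_contDiffWithinAt]
  have h3 := ContMDiffAt.comp_contMDiffWithinAt (I' := 𝓡∂ 4) (extChartAt (𝓡∂ 4) x₀ z)
    (f := (extChartAt (𝓡∂ 4) x₀).symm) (by rw [(extChartAt (𝓡∂ 4) x₀).left_inv h₀]; exact h1.2) h2
  refine h3.congr_of_eventuallyEq_of_mem ?_ (extChartAt_mem_halfSpace _ _)
  filter_upwards [extChartAt_target_mem_nhdsWithin' (I := 𝓡∂ 4) h₀] with y hy
  have hw : (extChartAt (𝓡∂ 4) x₀).symm y ∈ (chartAt (EuclideanHalfSpace 4) x₀).source := by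
    simpa using (extChartAt (𝓡∂ 4) x₀).map_target hy
  have hf : ∀ i, e.localFrame b i ((extChartAt (𝓡∂ 4) x₀).symm y) = coordField x₀ i y := by
    intro i
    rw [coordField_eq hy, e.localFrame_apply_of_mem_baseSet b (by simpa [e] using hw)]
    refine Eq.trans ?_ (congrArg (fun l => l (stdVec i))
      (TangentBundle.symmL_trivializationAt_eq_core (I := 𝓡∂ 4) hw))
    simp only [Trivialization.basisAt, Module.Basis.map_apply]
    have hb : b i = stdVec i := by simp [b]
    rw [hb, Trivialization.symmL_apply _ (by simpa using hw)]
    rfl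
  change g.matrix x₀ y i j = g _ (e.localFrame b i ((extChartAt (𝓡∂ 4) x₀).symm y)) 
    (e.localFrame b j ((extChartAt (𝓡∂ 4) x₀).symm y))
  rw [hf, hf]
  rfl

/-- `g` is near `z` a metric of class `C²`. -/
structure BilinField.IsC2MetricAt (g : BilinField M) (z : M) : Prop where
  contMDiffAt : g.ContMDiffAt 2 z
  posDef : ∀ᶠ w in 𝓝 z, IsPosDefForm (g.formAt w)

lemma BilinField.IsC2MetricAt.eventually {g : BilinField M} {z : M} (h : g.IsC2MetricAt z) :
    ∀ᶠ w in 𝓝 z, g.IsC2MetricAt w := by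
  filter_upwards [(contMDiffAt_iff_contMDiffAt_nhds (by simp)).1 h.contMDiffAt,
    eventually_eventually_nhds.2 h.posDef] with w h1 h2
  exact ⟨h1, h2⟩

lemma eventually_mem_source {x₀ z : M} (h₀ : z ∈ (extChartAt (𝓡∂ 4) x₀).source) :
    ∀ᶠ w in 𝓝 z, w ∈ (extChartAt (𝓡∂ 4) x₀).source := extChartAt_source_mem_nhds' h₀

lemma IsPosDefForm.matrixForm_matrix {g : BilinField M} {x₀ z : M}
    (h : IsPosDefForm (g.formAt z)) (h₀ : z ∈ (extChartAt (𝓡∂ 4) x₀).source) :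
    IsPosDefForm (matrixForm (g.matrix x₀ (extChartAt (𝓡∂ 4) x₀ z))) := by
  refine ⟨fun v w => ?_, fun v hv => ?_⟩
  · rw [_root_.matrixForm_matrix g h₀, _root_.matrixForm_matrix g h₀]; exact h.symm _ _
  · rw [_root_.matrixForm_matrix g h₀]
    refine h.pos _ fun h0 => hv ?_
    exact (coordChangeEquiv h₀ (mem_extChartAt_source z)).map_eq_zero_iff.1 h0

lemma BilinField.IsC2MetricAt.isC2MetricWithinAt {g : BilinField M} {x₀ z : M}
    (h : g.IsC2MetricAt z) (h₀ : z ∈ (extChartAt (𝓡∂ 4) x₀).source) :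
    IsC2MetricWithinAt halfSpace (g.matrix x₀) (extChartAt (𝓡∂ 4) x₀ z) := by
  refine ⟨fun i j => contDiffWithinAt_matrix (k := 2) h₀ h.contMDiffAt i j,
    eventually_extChartAt h₀ ?_⟩
  filter_upwards [eventually_mem_source h₀, h.posDef] with w hw hp
  exact hp.matrixForm_matrix hw

/-- Symmetry of one-sided second derivatives holds up to the boundary because the half-space lies in
the closure of its interior. -/
lemma isSymmSndFDerivWithinAt_halfSpace {W : Type*} [NormedAddCommGroup W] [NormedSpace ℝ W]
    {f : E4 → W} {y : E4} (hy : y ∈ halfSpace) (hf : ContDiffWithinAt ℝ 2 f halfSpace y) :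
    IsSymmSndFDerivWithinAt ℝ f halfSpace y :=
  hf.isSymmSndFDerivWithinAt (by simp) uniqueDiffOn_halfSpace
    ((𝓡∂ 4).range_subset_closure_interior hy) hy

/-- A coordinate change is an isometry between the two component metrics on a whole neighbourhood,
so the general transformation law applies. -/
lemma christoffelForm_coordChange {g : BilinField M} {x₀ x₁ z : M} (h : g.IsC2MetricAt z)
    (h₀ : z ∈ (extChartAt (𝓡∂ 4) x₀).source) (h₁ : z ∈ (extChartAt (𝓡∂ 4) x₁).source) (u v : E4) :
    fderivWithin ℝ (chartChange x₀ x₁) halfSpace (extChartAt (𝓡∂ 4) x₀ z)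
        (christoffelForm halfSpace (g.matrix x₀) (extChartAt (𝓡∂ 4) x₀ z) u v) =
      christoffelForm halfSpace (g.matrix x₁) (chartChange x₀ x₁ (extChartAt (𝓡∂ 4) x₀ z))
        (fderivWithin ℝ (chartChange x₀ x₁) halfSpace (extChartAt (𝓡∂ 4) x₀ z) u)
        (fderivWithin ℝ (chartChange x₀ x₁) halfSpace (extChartAt (𝓡∂ 4) x₀ z) v)
      + fderivWithin ℝ (fderivWithin ℝ (chartChange x₀ x₁) halfSpace) halfSpace
        (extChartAt (𝓡∂ 4) x₀ z) u v := by
  have c := contDiffWithinAt_chartChange h₀ h₁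
  have m := extChartAt_mem_halfSpace x₀ z
  have u1 := uniqueDiffOn_halfSpace _ m
  have g0 := h.isC2MetricWithinAt h₀
  have g1 := h.isC2MetricWithinAt h₁
  have l1 := g1.isLeviCivitaWithin (extChartAt_mem_halfSpace x₁ z)
    (uniqueDiffOn_halfSpace _ (extChartAt_mem_halfSpace x₁ z))
  have hd := g1.differentiable_matrixForm
  have hp := g1.posDef.self_of_nhdsWithin (extChartAt_mem_halfSpace x₁ z)
  have ht := tendsto_chartChange h₀ h₁
  rw [← chartChange_apply h₀] at l1 hd hp
  refine (g0.isLeviCivitaWithin m u1).pullback l1 u1 m ?_ g0.differentiable_matrixForm hd hp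
    (g0.posDef.self_of_nhdsWithin m) (c.differentiableWithinAt (by simp)) ?_ ht
    (isSymmSndFDerivWithinAt_halfSpace m (c.of_le (by norm_num)))
    (coordChangeEquiv h₀ h₁).surjective u v
  · refine eventually_extChartAt h₀ ?_
    filter_upwards [eventually_mem_source h₀, eventually_mem_source h₁] with w hw0 hw1 a b
    rw [chartChange_apply hw0]
    exact matrixForm_coordChange g hw0 hw1 a b
  · exact (c.fderivWithin_right (m := 1) uniqueDiffOn_halfSpace (by norm_num) m).differentiableWithinAt
      one_ne_zero

lemma ricciForm_coordChange {g : BilinField M} {x₀ x₁ z : M} (h : g.IsC2MetricAt z)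
    (h₀ : z ∈ (extChartAt (𝓡∂ 4) x₀).source) (h₁ : z ∈ (extChartAt (𝓡∂ 4) x₁).source) (v w : E4) :
    ricciForm halfSpace (christoffelForm halfSpace (g.matrix x₀)) (extChartAt (𝓡∂ 4) x₀ z) v w =
      ricciForm halfSpace (christoffelForm halfSpace (g.matrix x₁)) (extChartAt (𝓡∂ 4) x₁ z)
        (tangentCoordChange (𝓡∂ 4) x₀ x₁ z v) (tangentCoordChange (𝓡∂ 4) x₀ x₁ z w) := by
  have c := contDiffWithinAt_chartChange h₀ h₁
  have m := extChartAt_mem_halfSpace x₀ z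
  have g0 := h.isC2MetricWithinAt h₀
  have g1 := h.isC2MetricWithinAt h₁
  have hd := (g1.contDiff_christoffelForm (extChartAt_mem_halfSpace x₁ z)
    uniqueDiffOn_halfSpace).differentiableWithinAt one_ne_zero
  have ht := tendsto_chartChange h₀ h₁
  have c1 : ContDiffWithinAt ℝ 2 (fderivWithin ℝ (chartChange x₀ x₁) halfSpace) halfSpace _ :=
    c.fderivWithin_right uniqueDiffOn_halfSpace (by norm_num) m
  have c2 : ContDiffWithinAt ℝ 1
      (fderivWithin ℝ (fderivWithin ℝ (chartChange x₀ x₁) halfSpace) halfSpace) halfSpace _ :=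
    c1.fderivWithin_right uniqueDiffOn_halfSpace (by norm_num) m
  rw [← chartChange_apply h₀] at hd
  have hΓ : ∀ᶠ y in 𝓝[halfSpace] (extChartAt (𝓡∂ 4) x₀ z), ∀ u v,
      fderivWithin ℝ (chartChange x₀ x₁) halfSpace y (christoffelForm halfSpace (g.matrix x₀) y u v)
        = christoffelForm halfSpace (g.matrix x₁) (chartChange x₀ x₁ y)
          (fderivWithin ℝ (chartChange x₀ x₁) halfSpace y u)
          (fderivWithin ℝ (chartChange x₀ x₁) halfSpace y v)
        + fderivWithin ℝ (fderivWithin ℝ (chartChange x₀ x₁) halfSpace) halfSpace y u v := by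
    refine eventually_extChartAt h₀ ?_
    filter_upwards [eventually_mem_source h₀, eventually_mem_source h₁, h.eventually]
      with p hp0 hp1 hp
    exact christoffelForm_coordChange hp hp0 hp1
  have key := curvatureOp_pullback (uniqueDiffOn_halfSpace _ m) m hΓ
    ((g0.contDiff_christoffelForm m uniqueDiffOn_halfSpace).differentiableWithinAt one_ne_zero) hd
    (c.differentiableWithinAt (by simp)) (c1.differentiableWithinAt (by simp))
    (c2.differentiableWithinAt one_ne_zero) ht
    (isSymmSndFDerivWithinAt_halfSpace m (c.of_le (by norm_num)))
    (isSymmSndFDerivWithinAt_halfSpace m c1)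
  rw [chartChange_apply h₀] at key
  simp only [fderivWithin_chartChange] at key
  generalize hD : (tangentCoordChange (𝓡∂ 4) x₀ x₁ z : E4 →L[ℝ] E4) = D at key ⊢
  generalize hD' : (tangentCoordChange (𝓡∂ 4) x₁ x₀ z : E4 →L[ℝ] E4) = D' at key ⊢
  have h1 : ∀ v, D' (D v) = v := by subst hD hD'; exact fun v => (coordChangeEquiv h₀ h₁).symm_apply_apply v
  have h2 : ∀ v, D (D' v) = v := by subst hD hD'; exact fun v => (coordChangeEquiv h₀ h₁).apply_symm_apply v
  clear hD hD' hΓ hd ht c1 c2 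
  generalize christoffelForm halfSpace (g.matrix x₀) = Γ₀ at key ⊢
  generalize christoffelForm halfSpace (g.matrix x₁) = Γ₁ at key ⊢
  generalize extChartAt (𝓡∂ 4) x₁ z = y₁ at key ⊢
  clear m g0 g1 c
  generalize extChartAt (𝓡∂ 4) x₀ z = y₀ at key ⊢
  exact ricciForm_pullback_of_inverse h1 h2 key v w

/-- Metric and Ricci form are both carried over by the same isomorphism, hence so is the metric
trace. -/
lemma scalarCurvatureCoord_coordChange {g : BilinField M} {x₀ x₁ z : M} (h : g.IsC2MetricAt z)
    (h₀ : z ∈ (extChartAt (𝓡∂ 4) x₀).source) (h₁ : z ∈ (extChartAt (𝓡∂ 4) x₁).source) :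
    scalarCurvatureCoord halfSpace (g.matrix x₀) (extChartAt (𝓡∂ 4) x₀ z)
      = scalarCurvatureCoord halfSpace (g.matrix x₁) (extChartAt (𝓡∂ 4) x₁ z) := by
  have g0 := h.isC2MetricWithinAt h₀
  have g1 := h.isC2MetricWithinAt h₁
  have m0 := extChartAt_mem_halfSpace x₀ z
  have m1 := extChartAt_mem_halfSpace x₁ z
  obtain ⟨T, hT⟩ := (g0.posDef.self_of_nhdsWithin m0).exists_endomorphism
    (ricciBilin halfSpace (christoffelForm halfSpace (g.matrix x₀)) (extChartAt (𝓡∂ 4) x₀ z))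
  obtain ⟨T', hT'⟩ := (g1.posDef.self_of_nhdsWithin m1).exists_endomorphism
    (ricciBilin halfSpace (christoffelForm halfSpace (g.matrix x₁)) (extChartAt (𝓡∂ 4) x₁ z))
  rw [g0.scalarCurvatureCoord_eq m0 uniqueDiffOn_halfSpace hT,
    g1.scalarCurvatureCoord_eq m1 uniqueDiffOn_halfSpace hT']
  exact trace_eq_of_isometry (coordChangeEquiv h₀ h₁) (g1.posDef.self_of_nhdsWithin m1)
    (matrixForm_coordChange g h₀ h₁) (ricciForm_coordChange h h₀ h₁) hT hT'

/-- The defining chart of the scalar curvature moves with the point. Working in one fixed chart is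
what makes continuity, and derivatives along curves, accessible. -/
lemma BilinField.IsC2MetricAt.scalarCurvature_eq {g : BilinField M} {x₀ z : M}
    (h : g.IsC2MetricAt z) (h₀ : z ∈ (extChartAt (𝓡∂ 4) x₀).source) :
    g.scalarCurvature z = scalarCurvatureCoord halfSpace (g.matrix x₀) (extChartAt (𝓡∂ 4) x₀ z) :=
  scalarCurvatureCoord_coordChange h (mem_extChartAt_source z) h₀

lemma IsC2MetricWithinAt.continuousWithinAt_scalarCurvatureCoord {n : ℕ}
    {s : Set (EuclideanSpace ℝ (Fin n))}
    {G : EuclideanSpace ℝ (Fin n) → Matrix (Fin n) (Fin n) ℝ} {x : EuclideanSpace ℝ (Fin n)}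
    (h : IsC2MetricWithinAt s G x) (hx : x ∈ s) (hs : UniqueDiffOn ℝ s) :
    ContinuousWithinAt (scalarCurvatureCoord s G) s x := by
  have hc : ∀ k i j, ContinuousWithinAt (christoffel s G k i j) s x := fun k i j =>
    (h.contDiff_christoffel hx hs k i j).continuousWithinAt
  have hp : ∀ k i j l, ContinuousWithinAt (partialDerivWithin s (christoffel s G k i j) l) s x := by
    intro k i j l
    have : ContDiffWithinAt ℝ 0 (fderivWithin ℝ (christoffel s G k i j) s) s x :=
      (h.contDiff_christoffel hx hs k i j).fderivWithin_right hs (by norm_num) hx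
    exact this.continuousWithinAt.clm_apply continuousWithinAt_const
  refine tendsto_finsetSum _ fun j _ => tendsto_finsetSum _ fun k _ => ?_
  refine ContinuousWithinAt.mul (ContDiffWithinAt.matrix_inv h.contDiff
    (h.posDef.self_of_nhdsWithin hx).isUnit_det.ne_zero j k).continuousWithinAt ?_
  refine ContinuousWithinAt.add (tendsto_finsetSum _ fun i _ => ?_)
    (tendsto_finsetSum _ fun i _ => tendsto_finsetSum _ fun p _ => ?_)
  · exact (hp _ _ _ _).sub (hp _ _ _ _)
  · exact ((hc _ _ _).mul (hc _ _ _)).sub ((hc _ _ _).mul (hc _ _ _))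

lemma BilinField.IsC2MetricAt.continuousAt_scalarCurvature {g : BilinField M} {z : M}
    (h : g.IsC2MetricAt z) : ContinuousAt g.scalarCurvature z := by
  have h₀ := mem_extChartAt_source (I := 𝓡∂ 4) z
  have h1 : ContinuousAt (fun w => scalarCurvatureCoord halfSpace (g.matrix z)
      (extChartAt (𝓡∂ 4) z w)) z :=
    ((h.isC2MetricWithinAt h₀).continuousWithinAt_scalarCurvatureCoord
      (extChartAt_mem_halfSpace z z) uniqueDiffOn_halfSpace).tendsto.comp
        (tendsto_extChartAt_halfSpace h₀)
  refine h1.congr ?_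
  filter_upwards [h.eventually, eventually_mem_source h₀] with w hw hw0
  exact (hw.scalarCurvature_eq hw0).symm

end Charts

/-! ### The gradient as an intrinsic `C¹` vector field and its flow lines. -/

section Gradient

variable {M : Type*} [TopologicalSpace M] [ChartedSpace (EuclideanHalfSpace 4) M]
  [IsManifold (𝓡∂ 4) ∞ M]

/-- The differential of `f` at `z`, in the chart at `z`. -/
def coordDeriv (f : M → ℝ) (z : M) : E4 →L[ℝ] ℝ := fderivWithin ℝ (inChart f z) halfSpace (coords z)

lemma hasMFDerivAt_coordDeriv {f : M → ℝ} {z : M} (hf : MDifferentiableAt (𝓡∂ 4) 𝓘(ℝ, ℝ) f z) :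
    HasMFDerivAt (𝓡∂ 4) 𝓘(ℝ, ℝ) f z (coordDeriv f z) := by
  exact ⟨hf.continuousAt, hf.differentiableWithinAt_writtenInExtChartAt.hasFDerivWithinAt⟩

lemma differentiableWithinAt_inChart {f : M → ℝ} {x₀ z : M}
    (h₀ : z ∈ (extChartAt (𝓡∂ 4) x₀).source) (hf : MDifferentiableAt (𝓡∂ 4) 𝓘(ℝ, ℝ) f z) :
    DifferentiableWithinAt ℝ (inChart f x₀) halfSpace (extChartAt (𝓡∂ 4) x₀ z) := by
  have h1 := mdifferentiableWithinAt_extChartAt_symm (I := 𝓡∂ 4)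
    ((extChartAt (𝓡∂ 4) x₀).map_source h₀)
  rw [← mdifferentiableWithinAt_iff_differentiableWithinAt]
  refine MDifferentiableAt.comp_mdifferentiableWithinAt (I' := 𝓡∂ 4) _ ?_ h1
  rwa [(extChartAt (𝓡∂ 4) x₀).left_inv h₀]

lemma fderivWithin_inChart_coordChange {f : M → ℝ} {x₀ x₁ z : M}
    (h₀ : z ∈ (extChartAt (𝓡∂ 4) x₀).source) (h₁ : z ∈ (extChartAt (𝓡∂ 4) x₁).source)
    (hf : MDifferentiableAt (𝓡∂ 4) 𝓘(ℝ, ℝ) f z) (w : E4) :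
    fderivWithin ℝ (inChart f x₀) halfSpace (extChartAt (𝓡∂ 4) x₀ z) w
      = fderivWithin ℝ (inChart f x₁) halfSpace (extChartAt (𝓡∂ 4) x₁ z)
        (tangentCoordChange (𝓡∂ 4) x₀ x₁ z w) := by
  have hd := differentiableWithinAt_inChart h₁ hf
  have e : inChart f x₀ =ᶠ[𝓝[halfSpace] (extChartAt (𝓡∂ 4) x₀ z)]
      inChart f x₁ ∘ chartChange x₀ x₁ := by
    refine eventually_extChartAt h₀ ?_
    filter_upwards [eventually_mem_source h₀, eventually_mem_source h₁] with p hp0 hp1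
    rw [Function.comp_apply, chartChange_apply hp0, inChart, inChart,
      (extChartAt (𝓡∂ 4) x₀).left_inv hp0, (extChartAt (𝓡∂ 4) x₁).left_inv hp1]
  have m := extChartAt_mem_halfSpace x₀ z
  rw [e.fderivWithin_eq_of_mem m]
  rw [← chartChange_apply h₀] at hd
  rw [fderivWithin_comp _ hd ((contDiffWithinAt_chartChange h₀ h₁).differentiableWithinAt (by simp))
    (fun y _ => extChartAt_mem_halfSpace _ _) (uniqueDiffOn_halfSpace _ m), chartChange_apply h₀]
  rfl

/-- The gradient, as a vector of the coordinate space. -/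
def gradVec (g : BilinField M) (f : M → ℝ) (z : M) : E4 :=
  gradientCoord halfSpace (g.matrix z) (inChart f z) (coords z)

lemma formAt_gradient {g : BilinField M} {z : M} (h : IsPosDefForm (g.formAt z)) (f : M → ℝ)
    (w : E4) : g.formAt z (gradVec g f z) w = coordDeriv f z w := by
  rw [← matrixForm_matrix_self]
  exact matrixForm_gradientCoord (h.matrixForm_matrix (mem_extChartAt_source z)) _ w

/-- The gradient is characterized by pairing to the differential. Since the metric and the
differential both transform correctly, nondegeneracy gives the same for the gradient. -/
lemma tangentCoordChange_gradientCoord {g : BilinField M} {f : M → ℝ} {x₀ z : M}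
    (h : IsPosDefForm (g.formAt z)) (hf : MDifferentiableAt (𝓡∂ 4) 𝓘(ℝ, ℝ) f z)
    (h₀ : z ∈ (extChartAt (𝓡∂ 4) x₀).source) :
    tangentCoordChange (𝓡∂ 4) x₀ z z
      (gradientCoord halfSpace (g.matrix x₀) (inChart f x₀) (extChartAt (𝓡∂ 4) x₀ z))
      = gradVec g f z := by
  have hz := mem_extChartAt_source (I := 𝓡∂ 4) z
  refine h.eq_of_forall fun w => ?_
  rw [formAt_gradient h]
  obtain ⟨w, rfl⟩ := (coordChangeEquiv h₀ hz).surjective w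
  change g.formAt z _ (tangentCoordChange (𝓡∂ 4) x₀ z z w) = _
  rw [← matrixForm_matrix g h₀, matrixForm_gradientCoord (h.matrixForm_matrix h₀),
    fderivWithin_inChart_coordChange h₀ hz hf]
  rfl

lemma tangentCoordChange_gradient {g : BilinField M} {f : M → ℝ} {x₀ z : M}
    (h : IsPosDefForm (g.formAt z)) (hf : MDifferentiableAt (𝓡∂ 4) 𝓘(ℝ, ℝ) f z)
    (h₀ : z ∈ (extChartAt (𝓡∂ 4) x₀).source) :
    tangentCoordChange (𝓡∂ 4) z x₀ z (gradVec g f z)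
      = gradientCoord halfSpace (g.matrix x₀) (inChart f x₀) (extChartAt (𝓡∂ 4) x₀ z) := by
  have hz := mem_extChartAt_source (I := 𝓡∂ 4) z
  rw [← tangentCoordChange_gradientCoord h hf h₀]
  exact (coordChangeEquiv h₀ hz).symm_apply_apply _

lemma matrixForm_gradientCoord_self {g : BilinField M} {f : M → ℝ} {x₀ z : M}
    (h : IsPosDefForm (g.formAt z)) (hf : MDifferentiableAt (𝓡∂ 4) 𝓘(ℝ, ℝ) f z)
    (h₀ : z ∈ (extChartAt (𝓡∂ 4) x₀).source) :
    matrixForm (g.matrix x₀ (extChartAt (𝓡∂ 4) x₀ z))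
      (gradientCoord halfSpace (g.matrix x₀) (inChart f x₀) (extChartAt (𝓡∂ 4) x₀ z))
      (gradientCoord halfSpace (g.matrix x₀) (inChart f x₀) (extChartAt (𝓡∂ 4) x₀ z))
      = g.formAt z (gradVec g f z) (gradVec g f z) := by
  rw [matrixForm_matrix g h₀, tangentCoordChange_gradientCoord h hf h₀]

/-- `g` is a `C²` metric and `f` a `C²` function near `z`. -/
structure IsC2PairAt (g : BilinField M) (f : M → ℝ) (z : M) : Prop where
  metric : g.IsC2MetricAt z
  fn : ContMDiffAt (𝓡∂ 4) 𝓘(ℝ, ℝ) 2 f z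

lemma IsC2PairAt.eventually {g : BilinField M} {f : M → ℝ} {z : M} (h : IsC2PairAt g f z) :
    ∀ᶠ w in 𝓝 z, IsC2PairAt g f w := by
  filter_upwards [h.metric.eventually, (contMDiffAt_iff_contMDiffAt_nhds (by simp)).1 h.fn]
    with w h1 h2
  exact ⟨h1, h2⟩

lemma IsC2PairAt.mdifferentiableAt {g : BilinField M} {f : M → ℝ} {z : M} (h : IsC2PairAt g f z) :
    MDifferentiableAt (𝓡∂ 4) 𝓘(ℝ, ℝ) f z := h.fn.mdifferentiableAt (by simp)

lemma IsC2PairAt.posDef {g : BilinField M} {f : M → ℝ} {z : M} (h : IsC2PairAt g f z) :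
    IsPosDefForm (g.formAt z) := h.metric.posDef.self_of_nhds

lemma IsC2PairAt.contDiff_gradientCoord {g : BilinField M} {f : M → ℝ} {x₀ z : M}
    (h : IsC2PairAt g f z) (h₀ : z ∈ (extChartAt (𝓡∂ 4) x₀).source) :
    ContDiffWithinAt ℝ 1 (gradientCoord halfSpace (g.matrix x₀) (inChart f x₀)) halfSpace
      (extChartAt (𝓡∂ 4) x₀ z) :=
  (h.metric.isC2MetricWithinAt h₀).contDiff_gradientCoord (extChartAt_mem_halfSpace _ _)
    uniqueDiffOn_halfSpace (contDiffWithinAt_inChart h₀ h.fn)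

/-- The gradient is a vector field of class `C¹`. -/
lemma IsC2PairAt.contMDiffAt_gradient {g : BilinField M} {f : M → ℝ} {z : M}
    (h : IsC2PairAt g f z) :
    ContMDiffAt (𝓡∂ 4) ((𝓡∂ 4).prod 𝓘(ℝ, E4)) 1
      (fun w => (⟨w, g.gradient f w⟩ : TangentBundle (𝓡∂ 4) M)) z := by
  have h₀ := mem_extChartAt_source (I := 𝓡∂ 4) z
  let e := trivializationAt E4 (TangentSpace (𝓡∂ 4) : M → Type _) z
  refine (e.contMDiffAt_section_iff (by simp [e])).2 ?_
  have h1 : ContMDiffAt (𝓡∂ 4) 𝓘(ℝ, E4) 1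
      (fun w => gradientCoord halfSpace (g.matrix z) (inChart f z) (extChartAt (𝓡∂ 4) z w)) z :=
    contMDiffWithinAt_univ.1 <| ContMDiffWithinAt.comp (t := halfSpace) (I' := 𝓘(ℝ, E4)) z
      (contMDiffWithinAt_iff_contDiffWithinAt.2 (h.contDiff_gradientCoord h₀))
      (contMDiffAt_extChartAt.contMDiffWithinAt) (fun w _ => extChartAt_mem_halfSpace _ _)
  refine h1.congr_of_eventuallyEq ?_
  filter_upwards [h.eventually, eventually_mem_source h₀] with w hw hw0
  exact tangentCoordChange_gradient hw.posDef hw.mdifferentiableAt hw0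

lemma IsC2PairAt.exists_isMIntegralCurveAt {g : BilinField M} {f : M → ℝ} {z : M} [T2Space M]
    (h : IsC2PairAt g f z) (hz : (𝓡∂ 4).IsInteriorPoint z) :
    ∃ σ : ℝ → M, σ 0 = z ∧ IsMIntegralCurveAt σ (g.gradient f) 0 :=
  exists_isMIntegralCurveAt_of_contMDiffAt 0 h.contMDiffAt_gradient hz

/-- Flow lines of a gradient, in coordinates. -/
lemma IsC2PairAt.hasDerivAt_flow {g : BilinField M} {f : M → ℝ} {z : M} (h : IsC2PairAt g f z)
    {σ : ℝ → M} (h0 : σ 0 = z) (hσ : IsMIntegralCurveAt σ (g.gradient f) 0) :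
    ∀ᶠ τ in 𝓝 (0 : ℝ), HasDerivAt (extChartAt (𝓡∂ 4) z ∘ σ)
      (gradientCoord halfSpace (g.matrix z) (inChart f z) ((extChartAt (𝓡∂ 4) z ∘ σ) τ)) τ := by
  have hc : Tendsto σ (𝓝 0) (𝓝 z) := h0 ▸ hσ.continuousAt.tendsto
  have h1 := hσ.eventually_hasDerivAt
  rw [h0] at h1
  filter_upwards [h1, hc h.eventually, hc (eventually_mem_source (mem_extChartAt_source z))]
    with τ hτ hp hs
  have hp' : IsC2PairAt g f (σ τ) := hp
  exact hτ.congr_deriv (tangentCoordChange_gradient hp'.posDef hp'.mdifferentiableAt hs)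

end Gradient

/-! ### Lengths of curves, distance to the boundary, and the Cauchy-Schwarz bound. -/

section Distance

variable {M : Type*} [TopologicalSpace M] [ChartedSpace (EuclideanHalfSpace 4) M]
  [IsManifold (𝓡∂ 4) ∞ M]

/-- The velocity of a curve, in the coordinate space. -/
def velocity (γ : ℝ → M) (s : Set ℝ) (τ : ℝ) : E4 :=
  mfderivWithin 𝓘(ℝ, ℝ) (𝓡∂ 4) γ s τ (1 : ℝ)

/-- The length of a curve. -/
def ContMetric.length (gbar : ContMetric M) (γ : ℝ → M) (a b : ℝ) : ℝ≥0∞ :=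
  letI : RiemannianBundle (fun x : M => TangentSpace (𝓡∂ 4) x) := ⟨gbar.toRiemannianMetric⟩
  Manifold.pathELength (𝓡∂ 4) γ a b

/-- The distance of two points. -/
def ContMetric.eDist (gbar : ContMetric M) (x y : M) : ℝ≥0∞ :=
  letI : RiemannianBundle (fun x : M => TangentSpace (𝓡∂ 4) x) := ⟨gbar.toRiemannianMetric⟩
  Manifold.riemannianEDist (𝓡∂ 4) x y

variable (gbar : ContMetric M)

lemma ContMetric.isPosDefForm (z : M) : IsPosDefForm (BilinField.formAt gbar.inner z) :=
  ⟨gbar.symm z, gbar.pos z⟩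

lemma ContMetric.length_eq (γ : ℝ → M) (a b : ℝ) :
    gbar.length γ a b = ∫⁻ τ in Icc a b, ENNReal.ofReal √(BilinField.formAt gbar.inner (γ τ)
      (velocity γ (Icc a b) τ) (velocity γ (Icc a b) τ)) := by
  letI : RiemannianBundle (fun x : M => TangentSpace (𝓡∂ 4) x) := ⟨gbar.toRiemannianMetric⟩
  have e : ∀ (x : M) (v : TangentSpace (𝓡∂ 4) x), ‖v‖ₑ = ENNReal.ofReal √(gbar.inner x v v) := by
    intro x v
    rw [← ofReal_norm, norm_eq_sqrt_real_inner]
    rfl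
  unfold ContMetric.length
  rw [Manifold.pathELength_eq_lintegral_mfderivWithin_Icc]
  simp only [e]
  rfl

lemma ContMetric.length_add (γ : ℝ → M) {a b c : ℝ} (h : a ≤ b) (h' : b ≤ c) :
    gbar.length γ a b + gbar.length γ b c = gbar.length γ a c := 
  letI : RiemannianBundle (fun x : M => TangentSpace (𝓡∂ 4) x) := ⟨gbar.toRiemannianMetric⟩
  Manifold.pathELength_add h h'

lemma ContMetric.eDist_le_length {γ : ℝ → M} {a b : ℝ}
    (hγ : ContMDiffOn 𝓘(ℝ, ℝ) (𝓡∂ 4) 1 γ (Icc a b)) (hab : a ≤ b) :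
    gbar.eDist (γ a) (γ b) ≤ gbar.length γ a b :=
  letI : RiemannianBundle (fun x : M => TangentSpace (𝓡∂ 4) x) := ⟨gbar.toRiemannianMetric⟩
  Manifold.riemannianEDist_le_pathELength hγ rfl rfl hab

lemma ContMetric.eDist_comm (x y : M) : gbar.eDist x y = gbar.eDist y x :=
  letI : RiemannianBundle (fun x : M => TangentSpace (𝓡∂ 4) x) := ⟨gbar.toRiemannianMetric⟩
  Manifold.riemannianEDist_comm

lemma ContMetric.exists_eDist_lt_subset [RegularSpace M] {x : M} {s : Set M} (hs : s ∈ 𝓝 x) :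
    ∃ c > (0 : ℝ), ∀ y, gbar.eDist x y < ENNReal.ofReal c → y ∈ s := by
  letI : RiemannianBundle (fun x : M => TangentSpace (𝓡∂ 4) x) := ⟨gbar.toRiemannianMetric⟩
  obtain ⟨c, hc, h⟩ := setOfPred_riemannianEDist_lt_subset_nhds (𝓡∂ 4) hs
  exact ⟨c, hc, fun y hy => h (by rw [ENNReal.ofReal_coe_nnreal] at hy; exact hy)⟩

lemma distToBoundary_le {p : M} (hp : p ∈ (𝓡∂ 4).boundary M) (x : M) :
    distToBoundary gbar x ≤ gbar.eDist p x := iInf₂_le p hp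

lemma distToBoundary_triangle (x y : M) :
    distToBoundary gbar y ≤ distToBoundary gbar x + gbar.eDist x y := by
  letI : RiemannianBundle (fun x : M => TangentSpace (𝓡∂ 4) x) := ⟨gbar.toRiemannianMetric⟩
  have : ∀ p ∈ (𝓡∂ 4).boundary M, distToBoundary gbar y ≤ gbar.eDist p x + gbar.eDist x y :=
    fun p hp => (distToBoundary_le gbar hp y).trans Manifold.riemannianEDist_triangle
  refine le_trans (le_iInf₂ this) ?_
  unfold distToBoundary
  simp only [ENNReal.iInf_add]
  exact le_rfl

lemma exists_curve_of_distToBoundary_lt {x : M} {r : ℝ≥0∞} (h : distToBoundary gbar x < r) :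
    ∃ γ : ℝ → M, γ 0 ∈ (𝓡∂ 4).boundary M ∧ γ 1 = x ∧
      ContMDiffOn 𝓘(ℝ, ℝ) (𝓡∂ 4) 1 γ (Icc 0 1) ∧ gbar.length γ 0 1 < r := by
  letI : RiemannianBundle (fun x : M => TangentSpace (𝓡∂ 4) x) := ⟨gbar.toRiemannianMetric⟩
  unfold distToBoundary at h
  simp only [iInf_lt_iff] at h
  obtain ⟨p, hp, h⟩ := h
  obtain ⟨γ, h0, h1, hγ, hl⟩ := Manifold.exists_lt_of_riemannianEDist_lt h
  exact ⟨γ, h0 ▸ hp, h1, hγ, hl⟩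

/-- The chain rule along a curve. -/
lemma hasDerivWithinAt_comp_curve {f : M → ℝ} {γ : ℝ → M} {s : Set ℝ} {τ : ℝ}
    (hf : MDifferentiableAt (𝓡∂ 4) 𝓘(ℝ, ℝ) f (γ τ))
    (hγ : MDifferentiableWithinAt 𝓘(ℝ, ℝ) (𝓡∂ 4) γ s τ) :
    HasDerivWithinAt (f ∘ γ) (coordDeriv f (γ τ) (velocity γ s τ)) s τ := by
  obtain ⟨D, hD⟩ : ∃ D : ℝ →L[ℝ] E4, D = mfderivWithin 𝓘(ℝ, ℝ) (𝓡∂ 4) γ s τ := ⟨_, rfl⟩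
  have e : velocity γ s τ = D 1 := by rw [hD]; rfl
  have h := (hasMFDerivAt_coordDeriv hf).comp_hasMFDerivWithinAt τ hγ.hasMFDerivWithinAt
  rw [hasMFDerivWithinAt_iff_hasFDerivWithinAt] at h
  have h' : HasFDerivWithinAt (f ∘ γ) ((coordDeriv f (γ τ)).comp D) s τ := by rw [hD]; exact h
  rw [e]
  exact h'.hasDerivWithinAt

/-- The Cauchy-Schwarz inequality for the gradient. -/
lemma abs_coordDeriv_le (f : M → ℝ) (z : M) (v : E4) :
    |coordDeriv f z v| ≤ √(BilinField.formAt gbar.inner z (gradVec gbar.inner f z)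
      (gradVec gbar.inner f z)) * √(BilinField.formAt gbar.inner z v v) := by
  have hp := gbar.isPosDefForm z
  rw [← formAt_gradient hp]
  set b := BilinField.formAt gbar.inner z
  set w := gradVec gbar.inner f z
  rw [← Real.sqrt_mul (hp.nonneg w)]
  refine Real.abs_le_sqrt ?_
  -- The quadratic `r ↦ b (w + r v) (w + r v)` is nonnegative, so its discriminant is at most zero.
  have key : ∀ r : ℝ, 0 ≤ b v v * (r * r) + 2 * b w v * r + b w w := by
    intro r
    have := hp.nonneg (w + r • v)
    simp only [map_add, map_smul, add_apply, smul_apply, smul_eq_mul, hp.symm v w] at this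
    linarith
  have := discrim_le_zero key
  rw [discrim] at this
  nlinarith

variable {gbar}

lemma IsC2PairAt.continuousAt_normSq_gradVec {g : BilinField M} {f : M → ℝ} {z : M}
    (h : IsC2PairAt g f z) :
    ContinuousAt (fun w => g.formAt w (gradVec g f w) (gradVec g f w)) z := by
  have h₀ := mem_extChartAt_source (I := 𝓡∂ 4) z
  have h1 : ContinuousWithinAt (fun y => matrixForm (g.matrix z y)
      (gradientCoord halfSpace (g.matrix z) (inChart f z) y)
      (gradientCoord halfSpace (g.matrix z) (inChart f z) y)) halfSpace (extChartAt (𝓡∂ 4) z z) :=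
    ((h.metric.isC2MetricWithinAt h₀).contDiff_matrixForm.continuousWithinAt.clm_apply
      (h.contDiff_gradientCoord h₀).continuousWithinAt).clm_apply
      (h.contDiff_gradientCoord h₀).continuousWithinAt
  refine ContinuousAt.congr (h1.tendsto.comp (tendsto_extChartAt_halfSpace h₀)) ?_
  filter_upwards [h.eventually, eventually_mem_source h₀] with w hw hw0
  exact matrixForm_gradientCoord_self hw.posDef hw.mdifferentiableAt hw0

end Distance

/-! ### The eikonal equation for the distance to the boundary. -/

section Eikonal

variable {M : Type*} [TopologicalSpace M] [ChartedSpace (EuclideanHalfSpace 4) M]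
  [IsManifold (𝓡∂ 4) ∞ M]

lemma velocity_of_hasMFDerivAt {γ : ℝ → M} {s : Set ℝ} {τ : ℝ} {v : ∀ x : M, TangentSpace (𝓡∂ 4) x}
    (h : HasMFDerivAt 𝓘(ℝ, ℝ) (𝓡∂ 4) γ τ ((1 : ℝ →L[ℝ] ℝ).smulRight (v (γ τ))))
    (hs : UniqueDiffWithinAt ℝ s τ) : velocity γ s τ = v (γ τ) := by
  have := h.hasMFDerivWithinAt.mfderivWithin (s := s) hs.uniqueMDiffWithinAt
  unfold velocity
  rw [this]
  exact one_smul ℝ _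

/-- Flow lines of a gradient are of class `C¹`. -/
lemma IsC2PairAt.contMDiffAt_flow {g : BilinField M} {f : M → ℝ} {z : M} (h : IsC2PairAt g f z)
    {σ : ℝ → M} (h0 : σ 0 = z) (hσ : IsMIntegralCurveAt σ (g.gradient f) 0) :
    ContMDiffAt 𝓘(ℝ, ℝ) (𝓡∂ 4) 1 σ 0 := by
  have h₀ := mem_extChartAt_source (I := 𝓡∂ 4) z
  have hc : Tendsto σ (𝓝 0) (𝓝 z) := h0 ▸ hσ.continuousAt.tendsto
  have hX : ∀ᶠ τ in 𝓝 (0 : ℝ), ContinuousAt (fun τ => gradientCoord halfSpace (g.matrix z)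
      (inChart f z) ((extChartAt (𝓡∂ 4) z ∘ σ) τ)) τ := by
    filter_upwards [h.hasDerivAt_flow h0 hσ, hc h.eventually, hc (eventually_mem_source h₀)]
      with τ h1 h2 h3
    refine (IsC2PairAt.contDiff_gradientCoord h2 h3).continuousWithinAt.tendsto.comp ?_
    exact tendsto_nhdsWithin_iff.2 ⟨h1.continuousAt, .of_forall fun y => extChartAt_mem_halfSpace _ _⟩
  have h1 : ContDiffAt ℝ 1 (extChartAt (𝓡∂ 4) z ∘ σ) 0 := by
    refine contDiffAt_one_iff.2 ⟨fun τ => (1 : ℝ →L[ℝ] ℝ).smulRight (gradientCoord halfSpace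
      (g.matrix z) (inChart f z) ((extChartAt (𝓡∂ 4) z ∘ σ) τ)), _,
      (hX.and (h.hasDerivAt_flow h0 hσ)), fun τ hτ => ?_, fun τ hτ => hτ.2.hasFDerivAt⟩
    exact ((ContinuousLinearMap.smulRightL ℝ ℝ E4 (1 : ℝ →L[ℝ] ℝ)).continuous.continuousAt.comp
      hτ.1).continuousWithinAt
  have h2 : ContMDiffAt 𝓘(ℝ, ℝ) (𝓡∂ 4) 1 ((extChartAt (𝓡∂ 4) z).symm ∘ (extChartAt (𝓡∂ 4) z ∘ σ)) 0 := by
    refine contMDiffWithinAt_univ.1 <| ContMDiffWithinAt.comp (t := halfSpace) (I' := 𝓘(ℝ, E4)) 0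
      ?_ h1.contMDiffAt.contMDiffWithinAt (fun w _ => extChartAt_mem_halfSpace _ _)
    rw [Function.comp_apply, h0]
    exact contMDiffWithinAt_extChartAt_symm_range (I := 𝓡∂ 4) z ((extChartAt (𝓡∂ 4) z).map_source h₀)
  refine h2.congr_of_eventuallyEq ?_
  filter_upwards [hc (eventually_mem_source h₀)] with τ hτ
  exact ((extChartAt (𝓡∂ 4) z).left_inv hτ).symm

lemma le_of_hasDerivAt_of_eventually_le {f : ℝ → ℝ} {a f' K : ℝ} (hf : HasDerivAt f f' a)
    (h : ∀ᶠ s in 𝓝[>] a, f s ≤ f a + K * (s - a)) : f' ≤ K := by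
  have h1 := (hasDerivWithinAt_iff_tendsto_slope' (self_notMem_Ioi)).1 (hf.hasDerivWithinAt (s := Ioi a))
  refine le_of_tendsto h1 ?_
  filter_upwards [h, self_mem_nhdsWithin] with s hs hsa
  have : 0 < s - a := sub_pos.2 hsa
  rw [slope_def_field, div_le_iff₀ this]
  linarith

/-- A function which is a distance to the boundary has gradient of norm at most one. -/
lemma normSq_gradVec_le_one [T2Space M] {gbar : ContMetric M} {t : M → ℝ} {y : M}
    (h : IsC2PairAt gbar.inner t y) (hy : y ∈ (𝓡∂ 4).interior M) (ht : ∀ x, 0 ≤ t x)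
    (hdist : ∀ x, ENNReal.ofReal (t x) = distToBoundary gbar x) :
    BilinField.formAt gbar.inner y (gradVec gbar.inner t y) (gradVec gbar.inner t y) ≤ 1 := by
  obtain ⟨σ, h0, hσ⟩ := h.exists_isMIntegralCurveAt hy
  have hc : Tendsto σ (𝓝 0) (𝓝 y) := h0 ▸ hσ.continuousAt.tendsto
  set N := fun w => BilinField.formAt gbar.inner w (gradVec gbar.inner t w) (gradVec gbar.inner t w)
    with hN
  have hder : HasDerivAt (t ∘ σ) (N y) 0 := by
    have hm := hσ.hasMFDerivAt
    have h1 := hasDerivWithinAt_comp_curve (s := univ) (h0 ▸ h.mdifferentiableAt)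
      hm.mdifferentiableAt.mdifferentiableWithinAt
    rw [hasDerivWithinAt_univ, velocity_of_hasMFDerivAt hm uniqueDiffWithinAt_univ, h0] at h1
    exact h1.congr_deriv (formAt_gradient h.posDef t _).symm
  -- Near `y` the flow line has speed `√N < K`, so its length over `[0, s]` is at most `K s`. The
  -- triangle inequality bounds the growth of `t` by the same amount, whereas `t` grows at rate `N
  -- y`.
  have key : ∀ K, √(N y) < K → N y ≤ K := by
    intro K hK
    have hNc : ∀ᶠ w in 𝓝 y, √(N w) < K :=
      (h.continuousAt_normSq_gradVec.sqrt).tendsto.eventually (gt_mem_nhds hK)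
    have hev : ∀ᶠ τ in 𝓝 (0 : ℝ), √(N (σ τ)) < K ∧ ContMDiffAt 𝓘(ℝ, ℝ) (𝓡∂ 4) 1 σ τ ∧
        HasMFDerivAt 𝓘(ℝ, ℝ) (𝓡∂ 4) σ τ ((1 : ℝ →L[ℝ] ℝ).smulRight
          (BilinField.gradient gbar.inner t (σ τ))) :=
      (hc.eventually hNc).and (((contMDiffAt_iff_contMDiffAt_nhds (by simp)).1
        (h.contMDiffAt_flow h0 hσ)).and hσ)
    obtain ⟨δ, hδ, hball⟩ := Metric.eventually_nhds_iff.1 hev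
    refine le_of_hasDerivAt_of_eventually_le hder ?_
    filter_upwards [Ioo_mem_nhdsGT hδ] with s hs
    have hin : ∀ τ ∈ Icc 0 s, dist τ 0 < δ := by
      intro τ hτ
      rw [Real.dist_eq, sub_zero, abs_of_nonneg hτ.1]
      exact hτ.2.trans_lt hs.2
    have hK0 : 0 ≤ K := (Real.sqrt_nonneg _).trans hK.le
    have hlen : gbar.length σ 0 s ≤ ENNReal.ofReal (K * s) := by
      rw [gbar.length_eq]
      refine (MeasureTheory.setLIntegral_mono' (g := fun _ => ENNReal.ofReal K) measurableSet_Icc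
        fun τ hτ => ENNReal.ofReal_le_ofReal ?_).trans ?_
      · rw [velocity_of_hasMFDerivAt (hball (hin τ hτ)).2.2 (uniqueDiffOn_Icc hs.1 τ hτ)]
        exact (hball (hin τ hτ)).1.le
      · rw [MeasureTheory.setLIntegral_const, Real.volume_Icc, sub_zero, ← ENNReal.ofReal_mul hK0]
    have h2 : ENNReal.ofReal (t (σ s)) ≤ ENNReal.ofReal (t y + K * s) := by
      rw [ENNReal.ofReal_add (ht y) (mul_nonneg hK0 hs.1.le), hdist, hdist]
      refine (distToBoundary_triangle gbar y (σ s)).trans ?_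
      gcongr
      refine le_trans ?_ hlen
      have := gbar.eDist_le_length (γ := σ) (a := 0) (b := s)
        (fun τ hτ => (hball (hin τ hτ)).2.1.contMDiffWithinAt) hs.1.le
      rwa [h0] at this
    have h3 := (ENNReal.ofReal_le_ofReal_iff (add_nonneg (ht y) (mul_nonneg hK0 hs.1.le))).1 h2
    simpa [h0] using h3
  -- Letting `K` decrease to `√N` gives `N ≤ √N`, which forces `N ≤ 1`.
  have hle : N y ≤ √(N y) := le_of_forall_gt_imp_ge_of_dense key
  have hn : 0 ≤ N y := h.posDef.nonneg _
  have hs := Real.sq_sqrt hn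
  have hs0 := Real.sqrt_nonneg (N y)
  change N y ≤ 1
  nlinarith

/-- The slope bound along a curve. -/
lemma ofReal_sub_le_length {gbar : ContMetric M} {t : M → ℝ} {γ : ℝ → M} {a b θ : ℝ} (hab : a ≤ b)
    (hθ : 0 ≤ θ) (hγ : ContMDiffOn 𝓘(ℝ, ℝ) (𝓡∂ 4) 1 γ (Icc a b))
    (hreg : ∀ τ ∈ Icc a b, ContMDiffAt (𝓡∂ 4) 𝓘(ℝ, ℝ) 1 t (γ τ))
    (hN : ∀ τ ∈ Icc a b, √(BilinField.formAt gbar.inner (γ τ) (gradVec gbar.inner t (γ τ))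
      (gradVec gbar.inner t (γ τ))) ≤ θ) :
    ENNReal.ofReal (t (γ b) - t (γ a)) ≤ ENNReal.ofReal θ * gbar.length γ a b := by
  have hC : ContDiffOn ℝ 1 (t ∘ γ) (Icc a b) := by
    rw [← contMDiffOn_iff_contDiffOn]
    exact fun τ hτ => (hreg τ hτ).comp_contMDiffWithinAt τ (hγ τ hτ)
  have h1 := enorm_sub_le_lintegral_derivWithin_Icc_of_contDiffOn_Icc hC hab
  refine le_trans ?_ (h1.trans ?_)
  · rw [Real.enorm_eq_ofReal_abs]
    exact ENNReal.ofReal_le_ofReal (le_abs_self _)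
  · rw [gbar.length_eq, ← MeasureTheory.lintegral_const_mul' _ _ ENNReal.ofReal_ne_top]
    rcases hab.eq_or_lt with rfl | hlt
    · simp
    refine MeasureTheory.setLIntegral_mono' measurableSet_Icc fun τ hτ => ?_
    have hd := hasDerivWithinAt_comp_curve ((hreg τ hτ).mdifferentiableAt one_ne_zero)
      ((hγ τ hτ).mdifferentiableWithinAt one_ne_zero)
    rw [hd.derivWithin (uniqueDiffOn_Icc hlt τ hτ), Real.enorm_eq_ofReal_abs, ← ENNReal.ofReal_mul hθ]
    refine ENNReal.ofReal_le_ofReal ((abs_coordDeriv_le gbar t _ _).trans ?_)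
    gcongr
    exact hN τ hτ

/-- If `|∇t| < θ < 1` near `y`, then `t` grows by at most `θ` times length there. A curve from the
boundary to `y` must travel at least some fixed `c` inside this neighbourhood, so it is too long by
`(1 - θ) c`, contradicting near-minimality. -/
lemma one_le_normSq_gradVec [RegularSpace M] {gbar : ContMetric M} {t : M → ℝ} {y : M}
    (h : IsC2PairAt gbar.inner t y) (hy : y ∈ (𝓡∂ 4).interior M) (ht : ∀ x, 0 ≤ t x)
    (hdist : ∀ x, ENNReal.ofReal (t x) = distToBoundary gbar x) :
    1 ≤ BilinField.formAt gbar.inner y (gradVec gbar.inner t y) (gradVec gbar.inner t y) := by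
  by_contra! hlt
  set N := fun w => BilinField.formAt gbar.inner w (gradVec gbar.inner t w) (gradVec gbar.inner t w)
    with hN
  have hn : 0 ≤ N y := h.posDef.nonneg _
  have hs1 : √(N y) < 1 := by rw [Real.sqrt_lt' one_pos]; simpa using hlt
  obtain ⟨θ, hθ, hθ1⟩ := exists_between hs1
  have hθ0 : 0 ≤ θ := (Real.sqrt_nonneg _).trans hθ.le
  have hU : ∀ᶠ w in 𝓝 y, √(N w) < θ ∧ ContMDiffAt (𝓡∂ 4) 𝓘(ℝ, ℝ) 1 t w ∧ 
      w ∈ (𝓡∂ 4).interior M := by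
    filter_upwards [(h.continuousAt_normSq_gradVec.sqrt).tendsto.eventually (gt_mem_nhds hθ),
      h.eventually, ((𝓡∂ 4).isOpen_interior (n := ∞) (M := M) (by simp)).mem_nhds hy] with w h1 h2 h3
    exact ⟨h1, h2.fn.of_le (by norm_num), h3⟩
  obtain ⟨V, hVn, hVc, hVU⟩ := exists_mem_nhds_isClosed_subset hU
  obtain ⟨c, hc, hball⟩ := gbar.exists_eDist_lt_subset (interior_mem_nhds.2 hVn)
  -- The curve is allowed an excess of half of the length that is bound to be wasted.
  have hδ : 0 < (1 - θ) * c / 2 := by have := sub_pos.2 hθ1; positivity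
  obtain ⟨γ, hγ0, hγ1, hγ, hlen⟩ := exists_curve_of_distToBoundary_lt gbar (x := y)
    (r := ENNReal.ofReal (t y + (1 - θ) * c / 2)) (by
      rw [← hdist]
      exact (ENNReal.ofReal_lt_ofReal_iff (by have := ht y; linarith)).2 (by linarith))
  have hγc : ContinuousOn γ (Icc 0 1) := hγ.continuousOn
  -- the last time outside of the neighbourhood
  have hSc : IsCompact (Icc (0 : ℝ) 1 ∩ γ ⁻¹' (interior V)ᶜ) :=
    isCompact_Icc.of_isClosed_subset
      (hγc.preimage_isClosed_of_isClosed isClosed_Icc isOpen_interior.isClosed_compl) inter_subset_left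
  have hSne : (Icc (0 : ℝ) 1 ∩ γ ⁻¹' (interior V)ᶜ).Nonempty := by
    refine ⟨0, by simp, fun h0 => ?_⟩
    have h1 := (hVU (interior_subset h0)).2.2
    exact ((𝓡∂ 4).isInteriorPoint_iff_not_isBoundaryPoint _).1 h1 hγ0
  obtain ⟨a, ⟨⟨ha0, ha1⟩, haV⟩, hmax⟩ := hSc.exists_isGreatest hSne
  have hlt1 : a < 1 := by
    refine lt_of_le_of_ne ha1 ?_
    rintro rfl
    exact haV (by rw [hγ1]; exact mem_interior_iff_mem_nhds.2 hVn)
  have hin : ∀ τ ∈ Ioc a 1, γ τ ∈ interior V := by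
    intro τ hτ
    by_contra hcon
    exact absurd (hmax ⟨⟨ha0.trans hτ.1.le, hτ.2⟩, hcon⟩) (not_le.2 hτ.1)
  -- Closedness of `V` keeps the exit point itself inside the region of small gradient, so the slope
  -- bound covers the closed interval `[a, 1]`.
  have haV' : γ a ∈ V := by
    have h1 : Tendsto γ (𝓝[Ioc a 1] a) (𝓝 (γ a)) :=
      ((hγc a ⟨ha0, ha1⟩).mono fun τ hτ => ⟨ha0.trans hτ.1.le, hτ.2⟩)
    have : (𝓝[Ioc a 1] a).NeBot := by rw [nhdsWithin_Ioc_eq_nhdsGT hlt1]; infer_instance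
    exact hVc.mem_of_tendsto h1 (eventually_mem_nhdsWithin.mono fun τ hτ => interior_subset (hin τ hτ))
  have hinV : ∀ τ ∈ Icc a 1, γ τ ∈ V := by
    intro τ hτ
    rcases hτ.1.eq_or_lt with rfl | h1
    · exact haV'
    · exact interior_subset (hin τ ⟨h1, hτ.2⟩)
  have hsub1 : Icc a 1 ⊆ Icc 0 1 := Icc_subset_Icc_left ha0
  have hsub0 : Icc 0 a ⊆ Icc 0 1 := Icc_subset_Icc_right ha1
  have hadd := gbar.length_add γ ha0 ha1
  have hfin : gbar.length γ 0 a + gbar.length γ a 1 ≠ ⊤ := by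
    rw [hadd]; exact (hlen.trans ENNReal.ofReal_lt_top).ne
  obtain ⟨hf0, hf1⟩ := ENNReal.add_ne_top.1 hfin
  have e0 : ENNReal.ofReal (t (γ a)) ≤ gbar.length γ 0 a := by
    rw [hdist]
    exact (distToBoundary_le gbar hγ0 _).trans (gbar.eDist_le_length (hγ.mono hsub0) ha0)
  have e1 : ENNReal.ofReal c ≤ gbar.length γ a 1 := by
    refine le_trans ?_ (gbar.eDist_le_length (hγ.mono hsub1) ha1)
    rw [hγ1, gbar.eDist_comm]
    by_contra! hcon
    exact haV (hball _ hcon)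
  have e2 := ofReal_sub_le_length (gbar := gbar) (t := t) ha1 hθ0 (hγ.mono hsub1)
    (fun τ hτ => (hVU (hinV τ hτ)).2.1) (fun τ hτ => (hVU (hinV τ hτ)).1.le)
  rw [hγ1] at e2
  rw [← hadd] at hlen
  lift gbar.length γ 0 a to NNReal using hf0 with L0
  lift gbar.length γ a 1 to NNReal using hf1 with L1
  have r0 : t (γ a) ≤ L0 := by
    rw [ENNReal.ofReal_le_iff_le_toReal ENNReal.coe_ne_top] at e0; simpa using e0
  have r1 : c ≤ L1 := by
    rw [ENNReal.ofReal_le_iff_le_toReal ENNReal.coe_ne_top] at e1; simpa using e1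
  have r2 : t y - t (γ a) ≤ θ * L1 := by
    rw [ENNReal.ofReal_le_iff_le_toReal (by finiteness), ENNReal.toReal_mul,
      ENNReal.toReal_ofReal hθ0] at e2
    simpa using e2
  have r3 : (L0 : ℝ) + L1 < t y + (1 - θ) * c / 2 := by
    rw [ENNReal.lt_ofReal_iff_toReal_lt (by finiteness),
      ENNReal.toReal_add ENNReal.coe_ne_top ENNReal.coe_ne_top] at hlen
    simpa using hlen
  -- Now `t y ≤ L0 + θ L1 = (L0 + L1) - (1 - θ) L1 < t y - (1 - θ) c / 2`, a contradiction.
  have r4 : (1 - θ) * c ≤ (1 - θ) * L1 := by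
    have := sub_pos.2 hθ1; gcongr
  nlinarith

end Eikonal

/-! ### Curvature identities in a chart for a function with unit gradient. -/

section UnitGradient

/-- In the half-space, `G` is a `C²` metric near `y` and `T` a `C²` function with gradient of norm
one. -/
structure IsUnitPairWithinAt (G : E4 → Matrix (Fin 4) (Fin 4) ℝ) (T : E4 → ℝ) (y : E4) :
    Prop where
  mem : y ∈ halfSpace
  metric : IsC2MetricWithinAt halfSpace G y
  fn : ContDiffWithinAt ℝ 2 T halfSpace y
  unit : ∀ᶠ z in 𝓝[halfSpace] y, matrixForm (G z) (gradientCoord halfSpace G T z)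
    (gradientCoord halfSpace G T z) = 1

variable {G G' : E4 → Matrix (Fin 4) (Fin 4) ℝ} {T : E4 → ℝ} {y : E4}

/-- The shape operator of the level sets of `T`. -/
def shapeOp (G : E4 → Matrix (Fin 4) (Fin 4) ℝ) (T : E4 → ℝ) (y : E4) : E4 →ₗ[ℝ] E4 :=
  covariantDerivOp halfSpace (christoffelForm halfSpace G) (gradientCoord halfSpace G T) y

namespace IsUnitPairWithinAt

lemma posDef (h : IsUnitPairWithinAt G T y) : IsPosDefForm (matrixForm (G y)) :=
  h.metric.posDef.self_of_nhdsWithin h.mem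

lemma uniqueDiff (h : IsUnitPairWithinAt G T y) : UniqueDiffWithinAt ℝ halfSpace y :=
  uniqueDiffOn_halfSpace y h.mem

lemma levi (h : IsUnitPairWithinAt G T y) : IsLeviCivitaWithin halfSpace
    (fun z => matrixForm (G z)) (christoffelForm halfSpace G) y :=
  h.metric.isLeviCivitaWithin h.mem h.uniqueDiff

lemma grad (h : IsUnitPairWithinAt G T y) : ∀ᶠ z in 𝓝[halfSpace] y, ∀ w,
    matrixForm (G z) (gradientCoord halfSpace G T z) w = fderivWithin ℝ T halfSpace z w :=
  h.metric.posDef.mono fun z hz w => matrixForm_gradientCoord hz T w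

lemma diff_grad (h : IsUnitPairWithinAt G T y) :
    DifferentiableWithinAt ℝ (gradientCoord halfSpace G T) halfSpace y :=
  (h.metric.contDiff_gradientCoord h.mem uniqueDiffOn_halfSpace h.fn).differentiableWithinAt
    one_ne_zero

lemma diff_fderiv (h : IsUnitPairWithinAt G T y) :
    DifferentiableWithinAt ℝ (fderivWithin ℝ T halfSpace) halfSpace y :=
  (h.fn.fderivWithin_right (m := 1) uniqueDiffOn_halfSpace (by norm_num)
    h.mem).differentiableWithinAt one_ne_zero

lemma diff_christoffel (h : IsUnitPairWithinAt G T y) :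
    DifferentiableWithinAt ℝ (christoffelForm halfSpace G) halfSpace y :=
  (h.metric.contDiff_christoffelForm h.mem uniqueDiffOn_halfSpace).differentiableWithinAt
    one_ne_zero

lemma symm (h : IsUnitPairWithinAt G T y) : IsSymmSndFDerivWithinAt ℝ T halfSpace y :=
  isSymmSndFDerivWithinAt_halfSpace h.mem h.fn

lemma unit_self (h : IsUnitPairWithinAt G T y) : matrixForm (G y)
    (gradientCoord halfSpace G T y) (gradientCoord halfSpace G T y) = 1 :=
  h.unit.self_of_nhdsWithin h.mem

lemma shapeOp_eq_hessian (h : IsUnitPairWithinAt G T y) (v w : E4) :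
    matrixForm (G y) (shapeOp G T y v) w
      = fderivWithin ℝ (fderivWithin ℝ T halfSpace) halfSpace y v w
        - fderivWithin ℝ T halfSpace y (christoffelForm halfSpace G y v w) :=
  h.levi.covariantDerivOp_eq_hessian h.uniqueDiff h.mem h.grad h.metric.differentiable_matrixForm
    h.diff_grad h.diff_fderiv v w

lemma shapeOp_selfAdjoint (h : IsUnitPairWithinAt G T y) (v w : E4) :
    matrixForm (G y) (shapeOp G T y v) w = matrixForm (G y) v (shapeOp G T y w) := by
  rw [h.posDef.symm v, h.shapeOp_eq_hessian, h.shapeOp_eq_hessian, h.levi.symm v w, h.symm v w]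

lemma shapeOp_grad (h : IsUnitPairWithinAt G T y) :
    shapeOp G T y (gradientCoord halfSpace G T y) = 0 :=
  h.levi.covariantDerivOp_self h.uniqueDiff h.mem h.posDef h.grad h.unit
    h.metric.differentiable_matrixForm h.diff_grad h.diff_fderiv h.symm

lemma eventually (h : IsUnitPairWithinAt G T y) :
    ∀ᶠ z in 𝓝[halfSpace] y, IsUnitPairWithinAt G T z := by
  filter_upwards [h.metric.eventually h.mem, h.fn.eventually_nhdsWithin h.mem,
    eventually_eventually_nhdsWithin.2 h.unit, self_mem_nhdsWithin] with z h1 h2 h3 h4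
  exact ⟨h4, h1, h2, h3⟩

/-- Raising one index turns the Hessian into the shape operator, so contracting both pairs of
indices gives `tr A²`. -/
lemma hessianNormSqCoord_eq (h : IsUnitPairWithinAt G T y) :
    hessianNormSqCoord halfSpace G T y = LinearMap.trace ℝ _ (shapeOp G T y ∘ₗ shapeOp G T y) := by
  have e : ∀ i j, matrixForm (G y) (shapeOp G T y (stdVec i)) (stdVec j)
      = hessianCoord halfSpace G T i j y := by
    intro i j
    rw [h.shapeOp_eq_hessian, hessianCoord_eq T h.uniqueDiff h.diff_fderiv]
  have hs : ∀ i j, hessianCoord halfSpace G T i j y = hessianCoord halfSpace G T j i y := by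
    intro i j
    rw [← e, ← e, h.shapeOp_selfAdjoint, h.posDef.symm]
  rw [trace_comp_self_eq_trace_mul (H := Matrix.of fun i j => hessianCoord halfSpace G T i j y)
    h.posDef (fun i j => e i j) (fun i j => hs i j)]
  exact sum_inv_inv_mul_eq_trace h.posDef fun i j => hs i j

lemma hessianNormSqCoord_nonneg (h : IsUnitPairWithinAt G T y) :
    0 ≤ hessianNormSqCoord halfSpace G T y := by
  have e : ∀ i j, matrixForm (G y) (shapeOp G T y (stdVec i)) (stdVec j)
      = hessianCoord halfSpace G T i j y := by
    intro i j
    rw [h.shapeOp_eq_hessian, hessianCoord_eq T h.uniqueDiff h.diff_fderiv]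
  have hs : ∀ i j, hessianCoord halfSpace G T i j y = hessianCoord halfSpace G T j i y := by
    intro i j
    rw [← e, ← e, h.shapeOp_selfAdjoint, h.posDef.symm]
  exact (trace_inv_mul_inv_mul_nonneg (H := Matrix.of fun i j => hessianCoord halfSpace G T i j y)
    h.posDef fun i j => hs i j).trans_eq (sum_inv_inv_mul_eq_trace h.posDef fun i j => hs i j).symm

/-- Dimension four gives the conformal coefficients `3` and `2`. The term `-3 t⁻² gbar` of the
conformal formula equals `-3 g`, so it cancels the Einstein term. -/
lemma ricciForm_eq (h : IsUnitPairWithinAt G T y) (hT : T y ≠ 0)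
    (hG' : IsC2MetricWithinAt halfSpace G' y)
    (hconf : ∀ᶠ z in 𝓝[halfSpace] y, ∀ u v, matrixForm (G z) u v = T z ^ 2 * matrixForm (G' z) u v)
    (hric : ∀ v w, ricciForm halfSpace (christoffelForm halfSpace G') y v w
      = -3 * matrixForm (G' y) v w) (v w : E4) :
    ricciForm halfSpace (christoffelForm halfSpace G) y v w
      = -(T y)⁻¹ * (2 * matrixForm (G y) (shapeOp G T y v) w
        + LinearMap.trace ℝ _ (shapeOp G T y) * matrixForm (G y) v w) := by
  have hTc : ∀ᶠ z in 𝓝[halfSpace] y, T z ≠ 0 :=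
    h.fn.continuousWithinAt.tendsto.eventually (isOpen_ne.mem_nhds hT)
  have hev : ∀ᶠ z in 𝓝[halfSpace] y, ∀ u v, christoffelForm halfSpace G' z u v
      = christoffelForm halfSpace G z u v - (T z)⁻¹ • (fderivWithin ℝ T halfSpace z u • v
        + fderivWithin ℝ T halfSpace z v • u
        - matrixForm (G z) u v • gradientCoord halfSpace G T z) := by
    filter_upwards [h.eventually, hTc, hG'.eventually h.mem,
      eventually_eventually_nhdsWithin.2 hconf] with z h1 h2 h3 h4
    exact h1.levi.conformal (h3.isLeviCivitaWithin h1.mem h1.uniqueDiff) h1.uniqueDiff h1.mem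
      h1.posDef (h3.posDef.self_of_nhdsWithin h1.mem) h2 h4 (h1.grad.self_of_nhdsWithin h1.mem)
      h1.metric.differentiable_matrixForm h3.differentiable_matrixForm
      (h1.fn.differentiableWithinAt (by norm_num))
  have hcurv := curvatureOp_conformal h.uniqueDiff h.mem hT h.levi hev h.grad h.unit_self h.posDef
    h.metric.differentiable_matrixForm h.diff_christoffel
    ((hG'.contDiff_christoffelForm h.mem uniqueDiffOn_halfSpace).differentiableWithinAt
      one_ne_zero) h.diff_grad (h.fn.differentiableWithinAt (by norm_num)) h.diff_fderiv h.symm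
  have key := ricciForm_conformal (A := shapeOp G T y) h.shapeOp_selfAdjoint
    (fun u => hcurv u v w)
  have hc := hconf.self_of_nhdsWithin h.mem v w
  rw [hric] at key
  have hd : (Module.finrank ℝ E4 : ℝ) = 4 := by simp
  rw [hd, h.posDef.symm v, h.posDef.symm, ← h.shapeOp_selfAdjoint] at key
  rw [hc] at key ⊢
  have : (T y ^ 2)⁻¹ * (T y ^ 2 * matrixForm (G' y) v w) = matrixForm (G' y) v w := by
    field_simp
  linear_combination (-1 : ℝ) * key + 3 * this

/-- Trace of the Ricci formula: `2 tr A` from the Hessian and `4 tr A` from the metric. -/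
lemma scalarCurvatureCoord_eq (h : IsUnitPairWithinAt G T y)
    (hric : ∀ v w, ricciForm halfSpace (christoffelForm halfSpace G) y v w
      = -(T y)⁻¹ * (2 * matrixForm (G y) (shapeOp G T y v) w
        + LinearMap.trace ℝ _ (shapeOp G T y) * matrixForm (G y) v w)) :
    scalarCurvatureCoord halfSpace G y = -6 * (T y)⁻¹ * LinearMap.trace ℝ _ (shapeOp G T y) := by
  have hd : (Module.finrank ℝ E4 : ℝ) = 4 := by simp
  rw [h.metric.scalarCurvatureCoord_eq h.mem uniqueDiffOn_halfSpace
    (T := (-(T y)⁻¹) • ((2 : ℝ) • shapeOp G T y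
      + LinearMap.trace ℝ _ (shapeOp G T y) • LinearMap.id)) fun u v => ?_]
  · simp only [map_smul, map_add, LinearMap.trace_id, smul_eq_mul, hd]
    ring
  · rw [hric]
    simp [mul_comm]
    ring

/-- The Hessian term disappears because the gradient is geodesic. Compared with the full trace,
exactly one sixth remains. -/
lemma ricciForm_grad (h : IsUnitPairWithinAt G T y)
    (hric : ∀ v w, ricciForm halfSpace (christoffelForm halfSpace G) y v w
      = -(T y)⁻¹ * (2 * matrixForm (G y) (shapeOp G T y v) w
        + LinearMap.trace ℝ _ (shapeOp G T y) * matrixForm (G y) v w)) :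
    ricciForm halfSpace (christoffelForm halfSpace G) y (gradientCoord halfSpace G T y)
      (gradientCoord halfSpace G T y) = -(T y)⁻¹ * LinearMap.trace ℝ _ (shapeOp G T y) := by
  rw [hric, h.shapeOp_grad, h.unit_self]
  simp

lemma contDiffAt (h : IsUnitPairWithinAt G T y) (hy : halfSpace ∈ 𝓝 y) :
    ContDiffAt ℝ 1 (gradientCoord halfSpace G T) y ∧
      ContDiffAt ℝ 1 (christoffelForm halfSpace G) y :=
  ⟨(h.metric.contDiff_gradientCoord h.mem uniqueDiffOn_halfSpace h.fn).contDiffAt hy,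
    (h.metric.contDiff_christoffelForm h.mem uniqueDiffOn_halfSpace).contDiffAt hy⟩

/-- The derivative of the scalar curvature along a flow line of the gradient. -/
lemma hasDerivAt_scalarCurvature (h : IsUnitPairWithinAt G T y) (hy : halfSpace ∈ 𝓝 y)
    (hT : T y ≠ 0)
    (hric : ∀ᶠ z in 𝓝 y, ∀ v w, ricciForm halfSpace (christoffelForm halfSpace G) z v w
      = -(T z)⁻¹ * (2 * matrixForm (G z) (shapeOp G T z v) w
        + LinearMap.trace ℝ _ (shapeOp G T z) * matrixForm (G z) v w))
    {c : ℝ → E4} (hc0 : c 0 = y)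
    (hc : ∀ᶠ τ in 𝓝 0, HasDerivAt c (gradientCoord halfSpace G T (c τ)) τ) :
    HasDerivAt (fun τ => scalarCurvatureCoord halfSpace G (c τ))
      (6 * (T y)⁻¹ * hessianNormSqCoord halfSpace G T y) 0 := by
  have hn : 𝓝[halfSpace] y = 𝓝 y := nhdsWithin_eq_nhds.2 hy
  have hev := h.eventually
  rw [hn] at hev
  have hcc : Tendsto c (𝓝 0) (𝓝 y) := hc0 ▸ hc.self_of_nhds.continuousAt.tendsto
  have hA : HasDerivAt (fun τ => LinearMap.trace ℝ E4 (shapeOp G T (c τ)))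
      (- LinearMap.trace ℝ E4 (shapeOp G T y ∘ₗ shapeOp G T y)
        - ricciForm halfSpace (christoffelForm halfSpace G) y (gradientCoord halfSpace G T y)
          (gradientCoord halfSpace G T y)) 0 :=
    hasDerivAt_trace_covariantDerivOp hy (h.contDiffAt hy).1 (h.contDiffAt hy).2 h.levi.symm
      (hev.mono fun z hz => hz.shapeOp_grad) hc0 hc
  rw [h.ricciForm_grad hric.self_of_nhds] at hA
  -- Along a flow line `t` increases at rate `|∇t|² = 1`.
  have hTd : HasDerivAt (fun τ => T (c τ)) 1 0 := by
    have h1 : HasFDerivAt T (fderivWithin ℝ T halfSpace y) (c 0) := by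
      rw [hc0]
      exact (h.fn.differentiableWithinAt (by norm_num)).hasFDerivWithinAt.hasFDerivAt hy
    have h2 := h1.comp_hasDerivAt 0 hc.self_of_nhds
    rw [hc0, ← h.grad.self_of_nhdsWithin h.mem, h.unit_self] at h2
    exact h2
  have hTi := hTd.inv (by rwa [hc0])
  -- Product rule for `-6 t⁻¹ tr A`: the term from `(t⁻¹)' = -t⁻²` cancels against the term of the
  -- Riccati equation with `Ric(X, X) = -t⁻¹ tr A`.
  have hfin := (hTi.const_mul (-6)).mul hA
  have e : (fun τ => scalarCurvatureCoord halfSpace G (c τ)) =ᶠ[𝓝 0]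
      fun τ => -6 * (T (c τ))⁻¹ * LinearMap.trace ℝ E4 (shapeOp G T (c τ)) := by
    filter_upwards [hcc hev, hcc hric] with τ h1 h2
    exact scalarCurvatureCoord_eq h1 h2
  refine (hfin.congr_of_eventuallyEq e).congr_deriv ?_
  simp only [Pi.inv_apply, hc0]
  rw [h.hessianNormSqCoord_eq]
  field_simp
  ring

end IsUnitPairWithinAt

end UnitGradient

/-! ### Einstein metric and geodesic compactification on the manifold. -/

section Compactification

variable {M : Type*} [TopologicalSpace M] [ChartedSpace (EuclideanHalfSpace 4) M]
  [IsManifold (𝓡∂ 4) ∞ M] {g : BilinField M} {t : M → ℝ} {gbar : ContMetric M}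

lemma isOpen_interior_manifold : IsOpen ((𝓡∂ 4).interior M) :=
  (𝓡∂ 4).isOpen_interior (n := ∞) (by simp)

lemma IsEinsteinMetric.isC2MetricAt (hg : IsEinsteinMetric g) {x : M}
    (hx : x ∈ (𝓡∂ 4).interior M) : g.IsC2MetricAt x := by
  refine ⟨ContMDiffAt.of_le (hg.smooth x hx) (WithTop.coe_le_coe.2 le_top), ?_⟩
  filter_upwards [isOpen_interior_manifold.mem_nhds hx] with w hw
  exact ⟨hg.symm w hw, hg.pos w hw⟩

/-- The hypothesis concerns basis vectors in the preferred chart only. Bilinearity extends it to all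
vectors and tensoriality to all charts. -/
lemma IsEinsteinMetric.ricciForm_eq (hg : IsEinsteinMetric g) {x₀ z : M}
    (hz : z ∈ (𝓡∂ 4).interior M) (h₀ : z ∈ (extChartAt (𝓡∂ 4) x₀).source) (v w : E4) :
    ricciForm halfSpace (christoffelForm halfSpace (g.matrix x₀)) (extChartAt (𝓡∂ 4) x₀ z) v w
      = -3 * matrixForm (g.matrix x₀ (extChartAt (𝓡∂ 4) x₀ z)) v w := by
  have h := hg.isC2MetricAt hz
  have hs := mem_extChartAt_source (I := 𝓡∂ 4) z
  obtain ⟨B, hB⟩ : ∃ B : E4 →ₗ[ℝ] E4 →ₗ[ℝ] ℝ, ∀ u v, B u v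
      = -3 * matrixForm (g.matrix z (extChartAt (𝓡∂ 4) z z)) u v :=
    ⟨LinearMap.mk₂ ℝ (fun u v => -3 * matrixForm (g.matrix z (extChartAt (𝓡∂ 4) z z)) u v)
      (fun _ _ _ => by rw [map_add, add_apply]; ring)
      (fun _ _ _ => by rw [map_smul, smul_apply]; simp only [smul_eq_mul]; ring)
      (fun _ _ _ => by rw [map_add]; ring)
      (fun _ _ _ => by rw [map_smul]; simp only [smul_eq_mul]; ring), fun _ _ => rfl⟩
  have key : ricciBilin halfSpace (christoffelForm halfSpace (g.matrix z))
      (extChartAt (𝓡∂ 4) z z) = B := by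
    refine LinearMap.ext_basis (EuclideanSpace.basisFun (Fin 4) ℝ).toBasis
      (EuclideanSpace.basisFun (Fin 4) ℝ).toBasis fun i j => ?_
    simp only [OrthonormalBasis.coe_toBasis, EuclideanSpace.basisFun_apply]
    rw [ricciBilin_apply, ← (h.isC2MetricWithinAt hs).ricciCoord_eq (extChartAt_mem_halfSpace _ _)
      uniqueDiffOn_halfSpace, hB, matrixForm_single]
    exact hg.einstein z hz i j
  rw [ricciForm_coordChange h h₀ hs, matrixForm_coordChange g h₀ hs, ← ricciBilin_apply, key, hB]

namespace IsC2GeodesicCompactification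

lemma isC2PairAt (h : IsC2GeodesicCompactification g t gbar) {z : M} (hz : z ∉ cutLocus gbar) :
    IsC2PairAt gbar.inner t z :=
  ⟨⟨h.contMDiffAt_metric z hz, .of_forall gbar.isPosDefForm⟩, h.contMDiffAt_defining z hz⟩

lemma nonneg (h : IsC2GeodesicCompactification g t gbar) (x : M) : 0 ≤ t x := by
  rcases (𝓡∂ 4).isInteriorPoint_or_isBoundaryPoint x with hx | hx
  · exact (h.pos x hx).le
  · exact (h.zero x hx).ge

lemma notMem_cutLocus_of_boundary {x : M} (hx : x ∈ (𝓡∂ 4).boundary M) : x ∉ cutLocus gbar :=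
  fun hc => ((𝓡∂ 4).isInteriorPoint_iff_not_isBoundaryPoint x).1 hc.1 hx

/-- The defining function solves the eikonal equation off the cut locus. -/
lemma eventually_unit [T2Space M] (h : IsC2GeodesicCompactification g t gbar) {z : M}
    (hp : IsC2PairAt gbar.inner t z) : ∀ᶠ w in 𝓝 z, BilinField.formAt gbar.inner w
      (gradVec gbar.inner t w) (gradVec gbar.inner t w) = 1 := by
  rcases (𝓡∂ 4).isInteriorPoint_or_isBoundaryPoint z with hi | hb
  · have : LocallyCompactSpace M := Manifold.locallyCompact_of_finiteDimensional (𝓡∂ 4)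
    filter_upwards [hp.eventually, isOpen_interior_manifold.mem_nhds hi]
      with w hw hwi
    exact le_antisymm (normSq_gradVec_le_one hw hwi h.nonneg h.dist)
      (one_le_normSq_gradVec hw hwi h.nonneg h.dist)
  -- At boundary points the two distance estimates, proved for interior points, are not available on
  -- a full neighbourhood, so the collar condition takes over.
  · obtain ⟨U, hU, hbU, hu⟩ := h.collar
    filter_upwards [hU.mem_nhds (hbU hb)] with w hw
    exact hu w hw

lemma isUnitPairWithinAt [T2Space M] (h : IsC2GeodesicCompactification g t gbar) {x₀ z : M}
    (hp : IsC2PairAt gbar.inner t z) (h₀ : z ∈ (extChartAt (𝓡∂ 4) x₀).source) :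
    IsUnitPairWithinAt (BilinField.matrix gbar.inner x₀) (inChart t x₀)
      (extChartAt (𝓡∂ 4) x₀ z) := by
  refine ⟨extChartAt_mem_halfSpace _ _, hp.metric.isC2MetricWithinAt h₀,
    contDiffWithinAt_inChart h₀ hp.fn, eventually_extChartAt h₀ ?_⟩
  filter_upwards [hp.eventually, eventually_mem_source h₀, h.eventually_unit hp] with w h1 h2 h3
  rw [matrixForm_gradientCoord_self h1.posDef h1.mdifferentiableAt h2, h3]

lemma inChart_extChartAt {f : M → ℝ} {x₀ z : M} (h₀ : z ∈ (extChartAt (𝓡∂ 4) x₀).source) :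
    inChart f x₀ (extChartAt (𝓡∂ 4) x₀ z) = f z := by
  rw [inChart, (extChartAt (𝓡∂ 4) x₀).left_inv h₀]

/-- The Ricci curvature of the compactified metric in terms of the shape operator. -/
lemma ricciForm_eq [T2Space M] (h : IsC2GeodesicCompactification g t gbar)
    (hg : IsEinsteinMetric g) {x₀ z : M} (hp : IsC2PairAt gbar.inner t z) (hi : z ∈ (𝓡∂ 4).interior M)
    (h₀ : z ∈ (extChartAt (𝓡∂ 4) x₀).source) (v w : E4) :
    ricciForm halfSpace (christoffelForm halfSpace (BilinField.matrix gbar.inner x₀))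
        (extChartAt (𝓡∂ 4) x₀ z) v w
      = -(inChart t x₀ (extChartAt (𝓡∂ 4) x₀ z))⁻¹ *
        (2 * matrixForm (BilinField.matrix gbar.inner x₀ (extChartAt (𝓡∂ 4) x₀ z))
          (shapeOp (BilinField.matrix gbar.inner x₀) (inChart t x₀) (extChartAt (𝓡∂ 4) x₀ z) v) w
        + LinearMap.trace ℝ _ (shapeOp (BilinField.matrix gbar.inner x₀) (inChart t x₀)
            (extChartAt (𝓡∂ 4) x₀ z))
          * matrixForm (BilinField.matrix gbar.inner x₀ (extChartAt (𝓡∂ 4) x₀ z)) v w) := by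
  refine (h.isUnitPairWithinAt hp h₀).ricciForm_eq ?_
    ((hg.isC2MetricAt hi).isC2MetricWithinAt h₀) (eventually_extChartAt h₀ ?_)
    (hg.ricciForm_eq hi h₀) v w
  · rw [inChart_extChartAt h₀]
    exact (h.pos z hi).ne'
  · filter_upwards [eventually_mem_source h₀, isOpen_interior_manifold.mem_nhds hi] with w hw hwi u v
    rw [inChart_extChartAt hw, matrixForm_matrix _ hw, matrixForm_matrix _ hw]
    exact h.conformal w hwi _ _

variable [T2Space M]

lemma mul_hessianNormSq_nonneg (h : IsC2GeodesicCompactification g t gbar) {x : M}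
    (hp : IsC2PairAt gbar.inner t x) :
    0 ≤ 6 * (t x)⁻¹ * BilinField.hessianNormSq gbar.inner t x :=
  mul_nonneg (mul_nonneg (by norm_num) (inv_nonneg.2 (h.nonneg x)))
    (h.isUnitPairWithinAt hp (mem_extChartAt_source x)).hessianNormSqCoord_nonneg

/-- The derivative of the scalar curvature along flow lines. -/
lemma hasDerivAt_scalarCurvature (h : IsC2GeodesicCompactification g t gbar)
    (hg : IsEinsteinMetric g) {x : M} (hp : IsC2PairAt gbar.inner t x) (hi : x ∈ (𝓡∂ 4).interior M)
    {σ : ℝ → M} (h0 : σ 0 = x) (hσ : IsMIntegralCurveAt σ (BilinField.gradient gbar.inner t) 0) :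
    HasDerivAt (fun τ => BilinField.scalarCurvature gbar.inner (σ τ))
      (6 * (t x)⁻¹ * BilinField.hessianNormSq gbar.inner t x) 0 := by
  have hs := mem_extChartAt_source (I := 𝓡∂ 4) x
  have hn : 𝓝[halfSpace] (extChartAt (𝓡∂ 4) x x) = 𝓝 (extChartAt (𝓡∂ 4) x x) :=
    nhdsWithin_eq_nhds.2 (range_mem_nhds_isInteriorPoint hi)
  have hreg : ∀ᶠ w in 𝓝 x, IsC2PairAt gbar.inner t w ∧ w ∈ (𝓡∂ 4).interior M ∧
      w ∈ (extChartAt (𝓡∂ 4) x).source := by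
    filter_upwards [hp.eventually, isOpen_interior_manifold.mem_nhds hi, eventually_mem_source hs]
      with w h1 h2 h3
    exact ⟨h1, h2, h3⟩
  have hu := h.isUnitPairWithinAt hp hs
  have hric : ∀ᶠ z in 𝓝 (extChartAt (𝓡∂ 4) x x), ∀ v w, ricciForm halfSpace
      (christoffelForm halfSpace (BilinField.matrix gbar.inner x)) z v w
      = -(inChart t x z)⁻¹ * (2 * matrixForm (BilinField.matrix gbar.inner x z)
        (shapeOp (BilinField.matrix gbar.inner x) (inChart t x) z v) w
        + LinearMap.trace ℝ _ (shapeOp (BilinField.matrix gbar.inner x) (inChart t x) z)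
          * matrixForm (BilinField.matrix gbar.inner x z) v w) := by
    rw [← hn]
    refine eventually_extChartAt hs ?_
    exact hreg.mono fun w hw => h.ricciForm_eq hg hw.1 hw.2.1 hw.2.2
  have key := hu.hasDerivAt_scalarCurvature (range_mem_nhds_isInteriorPoint hi)
    (by rw [inChart_extChartAt hs]; exact (h.pos x hi).ne') hric (c := extChartAt (𝓡∂ 4) x ∘ σ)
    (by rw [Function.comp_apply, h0]) (hp.hasDerivAt_flow h0 hσ)
  rw [inChart_extChartAt hs] at key
  refine key.congr_of_eventuallyEq ?_
  have hc : Tendsto σ (𝓝 0) (𝓝 x) := h0 ▸ hσ.continuousAt.tendsto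
  filter_upwards [hc hreg] with τ hτ
  exact BilinField.IsC2MetricAt.scalarCurvature_eq hτ.1.metric hτ.2.2

end IsC2GeodesicCompactification

end Compactification

/-! ### Monotonicity of the scalar curvature along minimizing curves. -/

section Minimizing

variable {M : Type*} [TopologicalSpace M] [ChartedSpace (EuclideanHalfSpace 4) M]
  [IsManifold (𝓡∂ 4) ∞ M] {g : BilinField M} {t : M → ℝ} {gbar : ContMetric M}

/-- The product `⟨∇f, ∇t⟩` is `df(∇t)`, the derivative of `f` along any flow line, and derivatives
are unique. -/
lemma formAt_gradient_of_hasDerivAt {f : M → ℝ} {x : M} {σ : ℝ → M} {d : ℝ}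
    (hf : MDifferentiableAt (𝓡∂ 4) 𝓘(ℝ, ℝ) f x) (h0 : σ 0 = x)
    (hσ : IsMIntegralCurveAt σ (BilinField.gradient gbar.inner t) 0)
    (hd : HasDerivAt (fun τ => f (σ τ)) d 0) :
    BilinField.formAt gbar.inner x (gradVec gbar.inner f x) (gradVec gbar.inner t x) = d := by
  subst h0
  have hm := hσ.hasMFDerivAt
  have h1 := hasDerivWithinAt_comp_curve (s := univ) hf
    hm.mdifferentiableAt.mdifferentiableWithinAt
  rw [velocity_of_hasMFDerivAt hm uniqueDiffWithinAt_univ, hasDerivWithinAt_univ] at h1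
  rw [formAt_gradient (gbar.isPosDefForm _)]
  exact h1.unique hd

namespace IsMinimizingFromBoundary

variable {σ : ℝ → M} {b : ℝ}

lemma defining_eq (h : IsMinimizingFromBoundary gbar σ b)
    (hc : IsC2GeodesicCompactification g t gbar) {τ : ℝ} (hτ : τ ∈ Icc 0 b) : t (σ τ) = τ := by
  have h1 := hc.dist (σ τ)
  rw [h.minimizing τ hτ] at h1
  exact (ENNReal.ofReal_eq_ofReal_iff (hc.nonneg _) hτ.1).1 h1

lemma mem_interior (h : IsMinimizingFromBoundary gbar σ b)
    (hc : IsC2GeodesicCompactification g t gbar) {τ : ℝ} (hτ : τ ∈ Icc 0 b) (h0 : 0 < τ) :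
    σ τ ∈ (𝓡∂ 4).interior M := by
  refine ((𝓡∂ 4).isInteriorPoint_iff_not_isBoundaryPoint _).2 fun hb => h0.ne' ?_
  rw [← h.defining_eq hc hτ, hc.zero _ hb]

/-- Each point strictly before the end has the curve itself as witness that minimization continues
past it. The starting point is on the boundary, which the cut locus avoids. -/
lemma notMem_cutLocus (h : IsMinimizingFromBoundary gbar σ b) {τ : ℝ} (h0 : 0 ≤ τ) (hb : τ < b) :
    σ τ ∉ cutLocus gbar := by
  rcases h0.eq_or_lt with rfl | h0
  · exact IsC2GeodesicCompactification.notMem_cutLocus_of_boundary h.start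
  · exact fun hx => hx.2 ⟨σ, b, τ, h, h0, hb, rfl⟩

/-- Minimizing curves are flow lines of the gradient of the defining function. -/
lemma isMIntegralCurveAt [T2Space M] (h : IsMinimizingFromBoundary gbar σ b)
    (hc : IsC2GeodesicCompactification g t gbar) {τ : ℝ} (hτ : τ ∈ Ioo 0 b) :
    IsMIntegralCurveAt σ (BilinField.gradient gbar.inner t) τ := by
  have key : ∀ τ ∈ Ioo 0 b, HasMFDerivAt 𝓘(ℝ, ℝ) (𝓡∂ 4) σ τ
      ((1 : ℝ →L[ℝ] ℝ).smulRight (BilinField.gradient gbar.inner t (σ τ))) := by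
    intro τ hτ
    have hτ' := Ioo_subset_Icc_self hτ
    have hp := hc.isC2PairAt (h.notMem_cutLocus hτ.1.le hτ.2)
    have hm := (h.contMDiffOn τ hτ').mdifferentiableWithinAt one_ne_zero
    have hu : UniqueDiffWithinAt ℝ (Icc 0 b) τ := uniqueDiffOn_Icc (hτ.1.trans hτ.2) τ hτ'
    -- Minimality means `t (σ τ) = τ`. Differentiating gives `⟨∇t, σ'⟩ = 1`.
    have h1 : coordDeriv t (σ τ) (velocity σ (Icc 0 b) τ) = 1 := by
      have h2 := hasDerivWithinAt_comp_curve hp.mdifferentiableAt hm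
      refine (hu.eq_deriv _ h2 ?_)
      exact (hasDerivWithinAt_id τ _).congr (fun s hs => h.defining_eq hc hs)
        (h.defining_eq hc hτ')
    have h3 : BilinField.formAt gbar.inner (σ τ) (velocity σ (Icc 0 b) τ)
      (velocity σ (Icc 0 b) τ) = 1 := h.unit_speed τ hτ'
    have h4 := (hc.eventually_unit hp).self_of_nhds
    rw [← formAt_gradient hp.posDef] at h1
    -- Two unit vectors with inner product one coincide: `|σ' - ∇t|² = 1 - 1 - 1 + 1 = 0`.
    have hv : velocity σ (Icc 0 b) τ = gradVec gbar.inner t (σ τ) := by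
      by_contra hne
      have hpos := hp.posDef.pos _ (sub_ne_zero.2 hne)
      rw [map_sub, map_sub, sub_apply, sub_apply, h3, h4, h1, hp.posDef.symm, h1] at hpos
      norm_num at hpos
    have hd := hm.hasMFDerivWithinAt.hasMFDerivAt (Icc_mem_nhds hτ.1 hτ.2)
    obtain ⟨D, hD⟩ : ∃ D : ℝ →L[ℝ] E4, D = mfderivWithin 𝓘(ℝ, ℝ) (𝓡∂ 4) σ (Icc 0 b) τ :=
      ⟨_, rfl⟩
    have hD1 : D 1 = gradVec gbar.inner t (σ τ) := by rw [← hv, hD]; rfl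
    have e : D = (1 : ℝ →L[ℝ] ℝ).smulRight (gradVec gbar.inner t (σ τ)) := by
      ext1
      rw [hD1]
      exact (one_smul ℝ _).symm
    have hd' : HasMFDerivAt 𝓘(ℝ, ℝ) (𝓡∂ 4) σ τ D := by rw [hD]; exact hd
    rw [e] at hd'
    exact hd'
  filter_upwards [Ioo_mem_nhds hτ.1 hτ.2] with s hs using key s hs

lemma hasDerivAt_scalarCurvature [T2Space M] (h : IsMinimizingFromBoundary gbar σ b)
    (hc : IsC2GeodesicCompactification g t gbar) (hg : IsEinsteinMetric g) {τ : ℝ}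
    (hτ : τ ∈ Ioo 0 b) :
    HasDerivAt (fun s => BilinField.scalarCurvature gbar.inner (σ s))
      (6 * (t (σ τ))⁻¹ * BilinField.hessianNormSq gbar.inner t (σ τ)) τ := by
  have h1 := (isMIntegralCurveAt_comp_add (dt := τ)).2 (h.isMIntegralCurveAt hc hτ)
  rw [sub_self] at h1
  have h2 := hc.hasDerivAt_scalarCurvature hg (hc.isC2PairAt (h.notMem_cutLocus hτ.1.le hτ.2))
    (h.mem_interior hc (Ioo_subset_Icc_self hτ) hτ.1) (by simp) h1
  have h3 := HasDerivAt.comp_sub_const τ τ (f := fun s => BilinField.scalarCurvature gbar.inner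
    ((σ ∘ (· + τ)) s)) (by rw [sub_self]; exact h2)
  simpa using h3

/-- The scalar curvature does not decrease along minimizing curves. -/
lemma scalarCurvature_le [T2Space M] (h : IsMinimizingFromBoundary gbar σ b)
    (hc : IsC2GeodesicCompactification g t gbar) (hg : IsEinsteinMetric g) {s : ℝ} (h0 : 0 < s)
    (hs : s < b) : BilinField.scalarCurvature gbar.inner (σ 0)
      ≤ BilinField.scalarCurvature gbar.inner (σ s) := by
  -- Continuity is required down to `τ = 0` on the boundary, while the derivative formula holds only
  -- for `τ > 0`. The mean value argument needs no more.
  have hcont : ContinuousOn (fun τ => BilinField.scalarCurvature gbar.inner (σ τ)) (Icc 0 s) := by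
    intro τ hτ
    have h1 := (hc.isC2PairAt
      (h.notMem_cutLocus hτ.1 (hτ.2.trans_lt hs))).metric.continuousAt_scalarCurvature
    exact h1.comp_continuousWithinAt ((h.contMDiffOn.continuousOn τ
      ⟨hτ.1, hτ.2.trans hs.le⟩).mono (Icc_subset_Icc_right hs.le))
  have hd : ∀ τ ∈ interior (Icc 0 s), HasDerivAt
      (fun s => BilinField.scalarCurvature gbar.inner (σ s))
      (6 * (t (σ τ))⁻¹ * BilinField.hessianNormSq gbar.inner t (σ τ)) τ := by
    intro τ hτ
    rw [interior_Icc] at hτ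
    exact h.hasDerivAt_scalarCurvature hc hg ⟨hτ.1, hτ.2.trans hs⟩
  refine monotoneOn_of_deriv_nonneg (convex_Icc 0 s) hcont
    (fun τ hτ => (hd τ hτ).differentiableAt.differentiableWithinAt) (fun τ hτ => ?_)
    (left_mem_Icc.2 h0.le) (right_mem_Icc.2 h0.le) h0.le
  rw [(hd τ hτ).deriv]
  rw [interior_Icc] at hτ
  have hp := hc.isC2PairAt (h.notMem_cutLocus hτ.1.le (hτ.2.trans hs))
  exact hc.mul_hessianNormSq_nonneg hp

end IsMinimizingFromBoundary

end Minimizing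

/-! ### The boundary in a half-space chart: it is totally geodesic, and the Gauss equation applies.
-/

section Boundary

abbrev E3 : Type := EuclideanSpace ℝ (Fin 3)

/-- The inclusion of the boundary of the half-space as a continuous linear map. -/
def boundaryInclL : E3 →L[ℝ] E4 :=
  LinearMap.toContinuousLinearMap
    { toFun := boundaryIncl
      map_add' := fun a b => by
        ext i; refine Fin.cases ?_ (fun j => ?_) i <;> simp [boundaryIncl]
      map_smul' := fun a b => by
        ext i; refine Fin.cases ?_ (fun j => ?_) i <;> simp [boundaryIncl] }

/-- The projection to the boundary of the half-space as a linear map. -/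
def boundaryProjL : E4 →ₗ[ℝ] E3 where
  toFun := boundaryProj
  map_add' _ _ := rfl
  map_smul' _ _ := rfl

lemma boundaryInclL_apply (z : E3) : boundaryInclL z = boundaryIncl z := rfl

lemma boundaryProjL_apply (y : E4) : boundaryProjL y = boundaryProj y := rfl

@[simp] lemma boundaryProjL_boundaryInclL (z : E3) : boundaryProjL (boundaryInclL z) = z := rfl

lemma boundaryInclL_zero_apply (z : E3) : boundaryInclL z 0 = 0 := rfl

lemma boundaryInclL_injective : Function.Injective boundaryInclL :=
  Function.LeftInverse.injective boundaryProjL_boundaryInclL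

lemma boundaryInclL_boundaryProjL {y : E4} (h : y 0 = 0) : boundaryInclL (boundaryProjL y) = y := by
  ext i
  refine Fin.cases ?_ (fun j => ?_) i
  · exact h.symm
  · rfl

lemma eq_boundary_add (y : E4) :
    y = boundaryInclL (boundaryProjL y) + y 0 • (stdVec 0 : E4) := by
  ext i
  refine Fin.cases ?_ (fun j => ?_) i
  · simp [boundaryInclL_zero_apply]
  · simp [boundaryInclL_apply, boundaryProjL_apply, boundaryIncl, boundaryProj]

lemma boundaryInclL_mem_halfSpace (z : E3) : boundaryInclL z ∈ halfSpace := by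
  rw [halfSpace, range_modelWithCornersEuclideanHalfSpace]
  exact (boundaryInclL_zero_apply z).ge

lemma boundaryInclL_stdVec (a : Fin 3) : boundaryInclL (stdVec a) = stdVec a.succ := by
  ext i
  refine Fin.cases ?_ (fun j => ?_) i
  · rw [boundaryInclL_zero_apply, PiLp.single_apply, if_neg (Fin.succ_ne_zero a).symm]
  · change (stdVec a : E3) j = (stdVec a.succ : E4) j.succ
    rw [PiLp.single_apply, PiLp.single_apply]
    simp only [Fin.succ_inj]

/-- The matrix of the restriction of a metric to the boundary of the half-space. -/
def restrictMatrix (G : E4 → Matrix (Fin 4) (Fin 4) ℝ) (z : E3) : Matrix (Fin 3) (Fin 3) ℝ :=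
  Matrix.of fun a b => G (boundaryInclL z) a.succ b.succ

lemma matrixForm_restrictMatrix (G : E4 → Matrix (Fin 4) (Fin 4) ℝ) (z a c : E3) :
    matrixForm (restrictMatrix G z) a c
      = matrixForm (G (boundaryInclL z)) (boundaryInclL a) (boundaryInclL c) := by
  have : matrixForm (restrictMatrix G z)
      = (matrixForm (G (boundaryInclL z))).bilinearComp boundaryInclL boundaryInclL := by
    refine EuclideanSpace.clm_ext fun i => EuclideanSpace.clm_ext fun j => ?_
    rw [matrixForm_single, ContinuousLinearMap.bilinearComp_apply, boundaryInclL_stdVec,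
      boundaryInclL_stdVec, matrixForm_single]
    rfl
  rw [this, ContinuousLinearMap.bilinearComp_apply]

lemma tendsto_boundaryInclL (z : E3) :
    Tendsto boundaryInclL (𝓝 z) (𝓝[halfSpace] (boundaryInclL z)) :=
  tendsto_nhdsWithin_iff.2 ⟨boundaryInclL.continuous.continuousAt,
    .of_forall boundaryInclL_mem_halfSpace⟩

lemma IsC2MetricWithinAt.restrictMatrix {G : E4 → Matrix (Fin 4) (Fin 4) ℝ} {z : E3}
    (h : IsC2MetricWithinAt halfSpace G (boundaryInclL z)) :
    IsC2MetricWithinAt univ (restrictMatrix G) z := by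
  refine ⟨fun a b => ?_, ?_⟩
  · exact (h.contDiff a.succ b.succ).comp z boundaryInclL.contDiff.contDiffAt.contDiffWithinAt
      fun w _ => boundaryInclL_mem_halfSpace w
  · rw [nhdsWithin_univ]
    filter_upwards [(tendsto_boundaryInclL z).eventually h.posDef] with w hw
    refine ⟨fun u v => ?_, fun v hv => ?_⟩
    · rw [matrixForm_restrictMatrix, matrixForm_restrictMatrix, hw.symm]
    · rw [matrixForm_restrictMatrix]
      exact hw.pos _ ((map_ne_zero_iff _ boundaryInclL_injective).2 hv)

lemma continuousWithinAt_trace {n : ℕ} {W : Type*} [TopologicalSpace W] {s : Set W} {x : W}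
    {A : W → EuclideanSpace ℝ (Fin n) →ₗ[ℝ] EuclideanSpace ℝ (Fin n)}
    (h : ∀ v, ContinuousWithinAt (fun y => A y v) s x) :
    ContinuousWithinAt (fun y => LinearMap.trace ℝ _ (A y)) s x := by
  simp only [EuclideanSpace.trace_eq_sum]
  refine tendsto_finsetSum _ fun i _ => ?_
  exact (EuclideanSpace.proj i : EuclideanSpace ℝ (Fin n) →L[ℝ] ℝ).continuous.continuousAt
    |>.comp_continuousWithinAt (h _)

namespace IsUnitPairWithinAt

variable {G : E4 → Matrix (Fin 4) (Fin 4) ℝ} {T : E4 → ℝ} {y : E4}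

/-- Continuity up to the boundary is all the regularity a `C²` metric leaves for its curvature. It
is enough, since the boundary identities arise as limits from the interior. -/
lemma continuousWithinAt_ricciForm (h : IsUnitPairWithinAt G T y) {X Y : E4 → E4}
    (hX : ContinuousWithinAt X halfSpace y) (hY : ContinuousWithinAt Y halfSpace y) :
    ContinuousWithinAt (fun z => ricciForm halfSpace (christoffelForm halfSpace G) z (X z) (Y z))
      halfSpace y := by
  have hc := h.metric.contDiff_christoffelForm h.mem uniqueDiffOn_halfSpace
  have h0 := hc.continuousWithinAt
  have h1 : ContinuousWithinAt (fderivWithin ℝ (christoffelForm halfSpace G) halfSpace)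
      halfSpace y := (hc.fderivWithin_right (m := 0) uniqueDiffOn_halfSpace (by norm_num)
        h.mem).continuousWithinAt
  refine continuousWithinAt_trace fun v => ?_
  simp only [curvatureOp_apply]
  have hv : ContinuousWithinAt (fun _ : E4 => v) halfSpace y := continuousWithinAt_const
  exact ((((h1.clm_apply hv).clm_apply hX).clm_apply hY).sub
    (((h1.clm_apply hX).clm_apply hv).clm_apply hY)).add
      ((h0.clm_apply hv).clm_apply ((h0.clm_apply hX).clm_apply hY)) |>.sub
      ((h0.clm_apply hX).clm_apply ((h0.clm_apply hv).clm_apply hY))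

lemma continuousWithinAt_grad (h : IsUnitPairWithinAt G T y) :
    ContinuousWithinAt (gradientCoord halfSpace G T) halfSpace y :=
  h.diff_grad.continuousWithinAt

lemma continuousWithinAt_shapeOp (h : IsUnitPairWithinAt G T y) (v : E4) :
    ContinuousWithinAt (fun z => shapeOp G T z v) halfSpace y := by
  have hc := h.metric.contDiff_gradientCoord h.mem uniqueDiffOn_halfSpace h.fn
  have h1 : ContinuousWithinAt (fderivWithin ℝ (gradientCoord halfSpace G T) halfSpace)
      halfSpace y := (hc.fderivWithin_right (m := 0) uniqueDiffOn_halfSpace (by norm_num)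
        h.mem).continuousWithinAt
  have hv : ContinuousWithinAt (fun _ : E4 => v) halfSpace y := continuousWithinAt_const
  exact (h1.clm_apply hv).add
    ((h.diff_christoffel.continuousWithinAt.clm_apply hv).clm_apply h.continuousWithinAt_grad)

/-- The formula for the Ricci curvature of the conformal compactification of an Einstein metric. -/
def HasEinsteinRicci (G : E4 → Matrix (Fin 4) (Fin 4) ℝ) (T : E4 → ℝ) (z : E4) : Prop :=
  ∀ v w, ricciForm halfSpace (christoffelForm halfSpace G) z v w
    = -(T z)⁻¹ * (2 * matrixForm (G z) (shapeOp G T z v) w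
      + LinearMap.trace ℝ _ (shapeOp G T z) * matrixForm (G z) v w)

lemma neBot_interior (hy : y ∈ halfSpace) : (𝓝[interior halfSpace] y).NeBot :=
  mem_closure_iff_nhdsWithin_neBot.1 ((𝓡∂ 4).range_subset_closure_interior hy)

/-- The boundary is totally geodesic. -/
lemma shapeOp_eq_zero (h : IsUnitPairWithinAt G T y) (hT : T y = 0)
    (hric : ∀ᶠ z in 𝓝[interior halfSpace] y, T z ≠ 0 ∧ HasEinsteinRicci G T z) :
    shapeOp G T y = 0 := by
  have hne := neBot_interior h.mem
  -- In the interior `t Ric + 2 D²t + (tr A) gbar` vanishes. It is continuous up to the boundary,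
  -- where the factor `t` kills the Ricci term.
  have key : ∀ v w, 2 * matrixForm (G y) (shapeOp G T y v) w
      + LinearMap.trace ℝ _ (shapeOp G T y) * matrixForm (G y) v w = 0 := by
    intro v w
    have hv : ContinuousWithinAt (fun _ : E4 => v) halfSpace y := continuousWithinAt_const
    have hw : ContinuousWithinAt (fun _ : E4 => w) halfSpace y := continuousWithinAt_const
    have hG := h.metric.contDiff_matrixForm.continuousWithinAt
    have hF : ContinuousWithinAt (fun z =>
        T z * ricciForm halfSpace (christoffelForm halfSpace G) z v w
        + (2 * matrixForm (G z) (shapeOp G T z v) w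
        + LinearMap.trace ℝ _ (shapeOp G T z) * matrixForm (G z) v w)) halfSpace y :=
      (h.fn.continuousWithinAt.mul (h.continuousWithinAt_ricciForm hv hw)).add
        ((continuousWithinAt_const.mul
          ((hG.clm_apply (h.continuousWithinAt_shapeOp v)).clm_apply hw)).add
          ((continuousWithinAt_trace h.continuousWithinAt_shapeOp).mul
            ((hG.clm_apply hv).clm_apply hw)))
    have h1 := tendsto_nhds_unique_of_eventuallyEq (hF.mono interior_subset)
      (tendsto_const_nhds (x := (0 : ℝ))) (hric.mono fun z hz => by
        beta_reduce
        have h0 := hz.1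
        rw [hz.2]
        field_simp
        ring)
    beta_reduce at h1
    rwa [hT, zero_mul, zero_add] at h1
  -- Inserting the unit gradient, which `A` annihilates, isolates the trace.
  have htr : LinearMap.trace ℝ _ (shapeOp G T y) = 0 := by
    have := key (gradientCoord halfSpace G T y) (gradientCoord halfSpace G T y)
    rwa [h.shapeOp_grad, h.unit_self, map_zero, zero_apply, mul_zero, zero_add, mul_one] at this
  ext1 v
  refine h.posDef.eq_of_forall fun w => ?_
  have := key v w
  rw [htr, zero_mul, add_zero] at this
  rw [LinearMap.zero_apply, map_zero, zero_apply]
  linarith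

/-- In the interior the two sides are `-6 t⁻¹ tr A` and six times `-t⁻¹ tr A`. The identity passes
to the limit although these expressions are meaningless at `t = 0`. -/
lemma scalarCurvatureCoord_eq_ricciForm_grad (h : IsUnitPairWithinAt G T y)
    (hric : ∀ᶠ z in 𝓝[interior halfSpace] y, T z ≠ 0 ∧ HasEinsteinRicci G T z) :
    scalarCurvatureCoord halfSpace G y = 6 * ricciForm halfSpace (christoffelForm halfSpace G) y
      (gradientCoord halfSpace G T y) (gradientCoord halfSpace G T y) := by
  have hne := neBot_interior h.mem
  refine tendsto_nhds_unique_of_eventuallyEq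
    ((h.metric.continuousWithinAt_scalarCurvatureCoord h.mem uniqueDiffOn_halfSpace).mono
      interior_subset)
    ((continuousWithinAt_const.mul (h.continuousWithinAt_ricciForm h.continuousWithinAt_grad
      h.continuousWithinAt_grad)).mono interior_subset) ?_
  filter_upwards [hric, h.eventually.filter_mono (nhdsWithin_mono y interior_subset)] with z h1 h2
  rw [Pi.mul_apply, h2.scalarCurvatureCoord_eq h1.2, h2.ricciForm_grad h1.2]
  ring

variable {z : E3}

lemma fderivWithin_boundaryInclL (h : IsUnitPairWithinAt G T (boundaryInclL z))
    (hT : ∀ᶠ w in 𝓝 z, T (boundaryInclL w) = 0) (a : E3) :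
    fderivWithin ℝ T halfSpace (boundaryInclL z) (boundaryInclL a) = 0 := by
  have h1 := (h.fn.differentiableWithinAt (by norm_num)).hasFDerivWithinAt.comp_hasFDerivAt z
    boundaryInclL.hasFDerivAt (.of_forall boundaryInclL_mem_halfSpace)
  have h2 : HasFDerivAt (T ∘ boundaryInclL) (0 : E3 →L[ℝ] ℝ) z :=
    (hasFDerivAt_const (0 : ℝ) z).congr_of_eventuallyEq hT
  exact congrArg (fun l : E3 →L[ℝ] ℝ => l a) (h1.unique h2)

/-- The differential of `T` vanishes on boundary directions, and a unit gradient prevents it from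
vanishing on `∂₀`. Its kernel is therefore tangent to the boundary. -/
lemma apply_zero_eq_zero (h : IsUnitPairWithinAt G T (boundaryInclL z))
    (hT : ∀ᶠ w in 𝓝 z, T (boundaryInclL w) = 0) {v : E4}
    (hv : fderivWithin ℝ T halfSpace (boundaryInclL z) v = 0) : v 0 = 0 := by
  have h0 := h.fderivWithin_boundaryInclL hT
  have h1 : ∀ v : E4, fderivWithin ℝ T halfSpace (boundaryInclL z) v
      = v 0 * fderivWithin ℝ T halfSpace (boundaryInclL z) (stdVec 0) := by
    intro v
    conv_lhs => rw [eq_boundary_add v]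
    rw [map_add, h0, zero_add, map_smul, smul_eq_mul]
  have h2 := h.unit_self
  rw [h.grad.self_of_nhdsWithin h.mem, h1] at h2
  rw [h1] at hv
  exact (mul_eq_zero.1 hv).resolve_right fun h3 => by simp [h3] at h2

/-- Along the boundary the derivatives of `T` in tangential directions vanish identically, so their
tangential derivatives do too. A vanishing Hessian then puts `Γ(a, c)` in the kernel of the
differential. -/
lemma exists_christoffelForm_eq (h : IsUnitPairWithinAt G T (boundaryInclL z))
    (hT : ∀ᶠ w in 𝓝 z, T (boundaryInclL w) = 0)
    (hS : shapeOp G T (boundaryInclL z) = 0) (a c : E3) :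
    ∃ d, christoffelForm halfSpace G (boundaryInclL z) (boundaryInclL a) (boundaryInclL c)
      = boundaryInclL d := by
  refine ⟨_, (boundaryInclL_boundaryProjL (h.apply_zero_eq_zero hT ?_)).symm⟩
  have h1 := h.shapeOp_eq_hessian (boundaryInclL a) (boundaryInclL c)
  rw [hS, LinearMap.zero_apply, map_zero, zero_apply] at h1
  have hev : ∀ᶠ w in 𝓝 z, fderivWithin ℝ T halfSpace (boundaryInclL w) (boundaryInclL c) = 0 := by
    filter_upwards [(tendsto_boundaryInclL z).eventually h.eventually,
      eventually_eventually_nhds.2 hT] with w h2 h3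
    exact h2.fderivWithin_boundaryInclL h3 c
  have h4 := (h.diff_fderiv.clm_apply (differentiableWithinAt_const (boundaryInclL c)))
  have h5 := h4.hasFDerivWithinAt.comp_hasFDerivAt z
    boundaryInclL.hasFDerivAt (.of_forall boundaryInclL_mem_halfSpace)
  have h6 := congrArg (fun l : E3 →L[ℝ] ℝ => l a)
    (h5.unique ((hasFDerivAt_const (0 : ℝ) z).congr_of_eventuallyEq hev))
  have h7 : fderivWithin ℝ (fderivWithin ℝ T halfSpace) halfSpace (boundaryInclL z)
      (boundaryInclL a) (boundaryInclL c) = 0 := by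
    rw [fderivWithin_clm_apply h.uniqueDiff h.diff_fderiv (differentiableWithinAt_const _)] at h6
    simpa using h6
  linarith

/-- The relation is needed on a neighbourhood of `z` in the boundary, because the Gauss equation
differentiates it. -/
lemma eventually_christoffelForm_restrict (h : IsUnitPairWithinAt G T (boundaryInclL z))
    (hT : ∀ᶠ w in 𝓝 z, T (boundaryInclL w) = 0)
    (hric : ∀ᶠ y in 𝓝 (boundaryInclL z), y ∈ interior halfSpace →
      T y ≠ 0 ∧ HasEinsteinRicci G T y) :
    ∀ᶠ w in 𝓝 z, ∀ a c, boundaryInclL (christoffelForm univ (restrictMatrix G) w a c)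
      = christoffelForm halfSpace G (boundaryInclL w) (boundaryInclL a) (boundaryInclL c) := by
  filter_upwards [(tendsto_boundaryInclL z).eventually h.eventually,
    eventually_eventually_nhds.2 hT, boundaryInclL.continuous.continuousAt.eventually
      (eventually_eventually_nhds.2 hric)] with w h1 h2 h3
  have hmw := h1.metric.restrictMatrix
  have hS := h1.shapeOp_eq_zero h2.self_of_nhds (eventually_nhdsWithin_iff.2 h3)
  exact h1.levi.restrict (hmw.isLeviCivitaWithin (mem_univ w) uniqueDiffWithinAt_univ)
    boundaryInclL_mem_halfSpace (.of_forall fun y => matrixForm_restrictMatrix G y)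
    h1.metric.differentiable_matrixForm
    (differentiableWithinAt_univ.1 hmw.differentiable_matrixForm) h1.posDef
    (hmw.posDef.self_of_nhdsWithin (mem_univ w)) (h1.exists_christoffelForm_eq h2 hS)

lemma curvatureOp_skew (h : IsUnitPairWithinAt G T y) (u v w x : E4) :
    matrixForm (G y) (curvatureOp halfSpace (christoffelForm halfSpace G) y v w u) x
      + matrixForm (G y) w (curvatureOp halfSpace (christoffelForm halfSpace G) y v x u) = 0 := by
  obtain ⟨B, hB⟩ : ∃ B : E4 → E4 →L[ℝ] E4 →L[ℝ] ℝ, B = fun z => matrixForm (G z) := ⟨_, rfl⟩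
  have hm := h.metric.contDiff_matrixForm
  have hd := h.metric.differentiable_matrixForm
  have h1 : ∀ᶠ z in 𝓝[halfSpace] y, IsLeviCivitaWithin halfSpace B
      (christoffelForm halfSpace G) z := by
    rw [hB]
    exact h.eventually.mono fun y hy => hy.levi
  rw [← hB] at hm hd
  have h2 : ContDiffWithinAt ℝ 1 (fderivWithin ℝ B halfSpace) halfSpace y :=
    hm.fderivWithin_right uniqueDiffOn_halfSpace (by norm_num) h.mem
  have h3 := isSymmSndFDerivWithinAt_halfSpace h.mem hm
  have h4 := IsLeviCivitaWithin.curvatureOp_skew h1 h.mem h.uniqueDiff hd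
    (h2.differentiableWithinAt one_ne_zero) h3 h.diff_christoffel u v w x
  rw [hB] at h4
  exact h4

/-- The scalar curvature at a totally geodesic boundary. -/
lemma scalarCurvatureCoord_boundary (h : IsUnitPairWithinAt G T (boundaryInclL z))
    (hT : ∀ᶠ w in 𝓝 z, T (boundaryInclL w) = 0)
    (hric : ∀ᶠ y in 𝓝 (boundaryInclL z), y ∈ interior halfSpace →
      T y ≠ 0 ∧ HasEinsteinRicci G T y) :
    scalarCurvatureCoord halfSpace G (boundaryInclL z)
      = 3 / 2 * scalarCurvatureCoord univ (restrictMatrix G) z := by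
  have hm := h.metric.restrictMatrix
  have hevΓ := h.eventually_christoffelForm_restrict hT hric
  have hγ : DifferentiableAt ℝ (christoffelForm univ (restrictMatrix G)) z :=
    differentiableWithinAt_univ.1 ((hm.contDiff_christoffelForm (mem_univ z)
      uniqueDiffOn_univ).differentiableWithinAt one_ne_zero)
  have hcurv := curvatureOp_restrict boundaryInclL_mem_halfSpace hevΓ h.diff_christoffel hγ
  have hskew := h.curvatureOp_skew
  have hposb := hm.posDef.self_of_nhdsWithin (mem_univ z)
  obtain ⟨A, hA⟩ := h.posDef.exists_endomorphism
    (ricciBilin halfSpace (christoffelForm halfSpace G) (boundaryInclL z))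
  obtain ⟨A', hA'⟩ := hposb.exists_endomorphism
    (ricciBilin univ (christoffelForm univ (restrictMatrix G)) z)
  simp only [ricciBilin_apply] at hA hA'
  have hg := h.grad.self_of_nhdsWithin h.mem
  have hu := h.unit_self
  have hθ := h.fderivWithin_boundaryInclL hT
  have hker : ∀ v, fderivWithin ℝ T halfSpace (boundaryInclL z) v = 0 → v 0 = 0 :=
    fun v hv => h.apply_zero_eq_zero hT hv
  have h6 := h.scalarCurvatureCoord_eq_ricciForm_grad (eventually_nhdsWithin_iff.2 hric)
  have hpos := h.posDef
  rw [h.metric.scalarCurvatureCoord_eq h.mem uniqueDiffOn_halfSpace hA] at h6 ⊢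
  rw [hm.scalarCurvatureCoord_eq (mem_univ z) uniqueDiffOn_univ hA']
  have hbB := matrixForm_restrictMatrix G z
  generalize gradientCoord halfSpace G T (boundaryInclL z) = X at *
  generalize fderivWithin ℝ T halfSpace (boundaryInclL z) = θ at *
  generalize matrixForm (G (boundaryInclL z)) = B at *
  rw [hg] at hu
  -- `P` is the projection onto the boundary along `X`: the vector `v - θ(v) X` lies in the kernel
  -- of `θ`, hence is tangential.
  obtain ⟨P, hP, hsplit⟩ : ∃ P : E4 →ₗ[ℝ] E3, (∀ a, P (boundaryInclL a) = a) ∧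
      ∀ v, v = boundaryInclL (P v) + B X v • X := by
    refine ⟨boundaryProjL ∘ₗ (LinearMap.id - θ.toLinearMap.smulRight X),
      fun a => by simp [hθ], fun v => ?_⟩
    have := boundaryInclL_boundaryProjL (hker (v - θ v • X) (by
      rw [map_sub, map_smul, hu, smul_eq_mul, mul_one, sub_self]))
    rw [hg]
    exact eq_add_of_sub_eq this.symm
  have hperp : ∀ a, B X (boundaryInclL a) = 0 := fun a => by rw [hg, hθ]
  clear hγ hevΓ hm hric hT h hker hθ
  generalize christoffelForm halfSpace G = Γ at *
  generalize christoffelForm univ (restrictMatrix G) = γ at *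
  generalize matrixForm (restrictMatrix G z) = b at *
  -- With `s = s_γ + 2 Ric(X, X)` and `s = 6 Ric(X, X)`, eliminating the Ricci term leaves `(2/3) s
  -- = s_γ`.
  have htr := trace_ricci_restrict (E := E4) (F := E3) (s := halfSpace) (ι := boundaryInclL)
    (B := B) (b := b) (Γ := Γ) (γ := γ) (x := boundaryInclL z) (X := X) (z := z) (P := P)
    hpos hposb hbB hperp hP hsplit hcurv hskew (A := A) (A' := A') hA hA'
  linarith

end IsUnitPairWithinAt

end Boundary

/-! ### Transfer of the boundary identity to the manifold. -/

section BoundaryCurvature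

variable {M : Type*} [TopologicalSpace M] [ChartedSpace (EuclideanHalfSpace 4) M]
  [IsManifold (𝓡∂ 4) ∞ M] {g : BilinField M} {t : M → ℝ} {gbar : ContMetric M}

lemma isInteriorPoint_iff_extChartAt_mem {x₀ w : M} (h₀ : w ∈ (extChartAt (𝓡∂ 4) x₀).source) :
    w ∈ (𝓡∂ 4).interior M ↔ extChartAt (𝓡∂ 4) x₀ w ∈ interior halfSpace := by
  rw [extChartAt_source] at h₀
  refine ((𝓡∂ 4).isInteriorPoint_iff_of_mem_atlas (n := ∞) (by simp) (chart_mem_atlas _ x₀)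
    h₀).trans ⟨fun h => OpenPartialHomeomorph.interior_extend_target_subset_interior_range _ h,
    fun h => (chartAt (EuclideanHalfSpace 4) x₀).mem_interior_extend_target
      ((chartAt (EuclideanHalfSpace 4) x₀).map_source h₀) h⟩

lemma mem_interior_halfSpace {y : E4} : y ∈ interior halfSpace ↔ 0 < y 0 := by
  rw [halfSpace, interior_range_modelWithCornersEuclideanHalfSpace]
  rfl

/-- The scalar curvature on the boundary of a geodesic compactification. -/
theorem IsC2GeodesicCompactification.scalarCurvature_boundary [T2Space M]
    (h : IsC2GeodesicCompactification g t gbar) (hg : IsEinsteinMetric g) {p : M}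
    (hp : p ∈ (𝓡∂ 4).boundary M) : BilinField.scalarCurvature gbar.inner p
      = 3 / 2 * BilinField.boundaryScalarCurvature gbar.inner p := by
  have hs := mem_extChartAt_source (I := 𝓡∂ 4) p
  have hpair := h.isC2PairAt (notMem_cutLocus_of_boundary hp)
  have hz : boundaryInclL (boundaryProj (coords p)) = coords p := by
    refine boundaryInclL_boundaryProjL (le_antisymm (not_lt.1 fun h0 => ?_) ?_)
    · exact ((𝓡∂ 4).isInteriorPoint_iff_not_isBoundaryPoint p).1
        ((isInteriorPoint_iff_extChartAt_mem hs).2 (mem_interior_halfSpace.2 h0)) hp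
    · have := extChartAt_mem_halfSpace p p
      rw [halfSpace, range_modelWithCornersEuclideanHalfSpace] at this
      exact this
  have hu := h.isUnitPairWithinAt hpair hs
  change IsUnitPairWithinAt _ _ (coords p) at hu
  -- Points of the chart with vanishing first coordinate are boundary points of the manifold, where
  -- `t` is zero.
  have hT : ∀ᶠ w in 𝓝 (boundaryProj (coords p)), inChart t p (boundaryInclL w) = 0 := by
    have h1 : ∀ᶠ y in 𝓝[halfSpace] (coords p), y ∉ interior halfSpace → inChart t p y = 0 := by
      refine eventually_extChartAt hs ?_
      filter_upwards [eventually_mem_source hs] with w hw hb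
      rw [inChart_extChartAt hw]
      refine h.zero w (((𝓡∂ 4).isInteriorPoint_or_isBoundaryPoint w).resolve_left fun hi => hb ?_)
      exact (isInteriorPoint_iff_extChartAt_mem hw).1 hi
    rw [← hz] at h1
    filter_upwards [(tendsto_boundaryInclL _).eventually h1] with w hw
    refine hw fun hi => (mem_interior_halfSpace.1 hi).ne' (boundaryInclL_zero_apply w)
  have hric : ∀ᶠ y in 𝓝 (coords p), y ∈ interior halfSpace → inChart t p y ≠ 0 ∧
      IsUnitPairWithinAt.HasEinsteinRicci (BilinField.matrix gbar.inner p) (inChart t p) y := by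
    have h1 : ∀ᶠ y in 𝓝[halfSpace] (coords p), y ∈ interior halfSpace → inChart t p y ≠ 0 ∧
        IsUnitPairWithinAt.HasEinsteinRicci (BilinField.matrix gbar.inner p) (inChart t p) y := by
      refine eventually_extChartAt hs ?_
      filter_upwards [eventually_mem_source hs, hpair.eventually] with w hw hw2 hi
      have hi' := (isInteriorPoint_iff_extChartAt_mem hw).2 hi
      refine ⟨?_, h.ricciForm_eq hg hw2 hi' hw⟩
      rw [inChart_extChartAt hw]
      exact (h.pos w hi').ne'
    exact (eventually_nhdsWithin_iff.1 h1).mono fun y hy hi => hy (interior_subset hi) hi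
  rw [← hz] at hu hric
  have key := hu.scalarCurvatureCoord_boundary hT hric
  rw [hz] at key
  exact key

end BoundaryCurvature

end

end

/-! ### The three assertions assembled. -/

theorem proposition1p4 {M : Type*} [TopologicalSpace M] [T2Space M] [SecondCountableTopology M]
    [ConnectedSpace M] [ChartedSpace (EuclideanHalfSpace 4) M] [IsManifold (𝓡∂ 4) ∞ M]
    (hne : ((𝓡∂ 4).boundary M).Nonempty) (hcpt : IsCompact ((𝓡∂ 4).boundary M))
    (g : BilinField M) (hg : IsEinsteinMetric g)
    (t : M → ℝ) (gbar : ContMetric M) (h : IsC2GeodesicCompactification g t gbar) :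
    (∀ x ∈ (𝓡∂ 4).interior M, x ∉ cutLocus gbar →
      -- the derivative of the scalar curvature along the flow line of `∇t` through `x`
      (∃ σ : ℝ → M, σ 0 = x ∧ IsMIntegralCurveAt σ (BilinField.gradient gbar.inner t) 0) ∧
      (∀ σ : ℝ → M, σ 0 = x → IsMIntegralCurveAt σ (BilinField.gradient gbar.inner t) 0 →
        HasDerivAt (fun τ => BilinField.scalarCurvature gbar.inner (σ τ))
          (6 * (t x)⁻¹ * BilinField.hessianNormSq gbar.inner t x) 0) ∧
      -- the inner product `⟨∇s, ∇t⟩`, wherever `s` is differentiable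
      (MDifferentiableAt (𝓡∂ 4) 𝓘(ℝ, ℝ) (BilinField.scalarCurvature gbar.inner) x →
        gbar.inner x
          (BilinField.gradient gbar.inner (BilinField.scalarCurvature gbar.inner) x)
          (BilinField.gradient gbar.inner t x)
          = 6 * (t x)⁻¹ * BilinField.hessianNormSq gbar.inner t x) ∧
      0 ≤ 6 * (t x)⁻¹ * BilinField.hessianNormSq gbar.inner t x) ∧
    (∀ p ∈ (𝓡∂ 4).boundary M, BilinField.scalarCurvature gbar.inner p
      = 3 / 2 * BilinField.boundaryScalarCurvature gbar.inner p) ∧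
    (∃ p ∈ (𝓡∂ 4).boundary M,
      (∀ q ∈ (𝓡∂ 4).boundary M, BilinField.scalarCurvature gbar.inner p
        ≤ BilinField.scalarCurvature gbar.inner q) ∧
      (∀ q ∈ (𝓡∂ 4).boundary M, BilinField.boundaryScalarCurvature gbar.inner p
        ≤ BilinField.boundaryScalarCurvature gbar.inner q) ∧
      ∀ x, x ∉ cutLocus gbar →
        BilinField.scalarCurvature gbar.inner p ≤ BilinField.scalarCurvature gbar.inner x) := by
  have hcut : ∀ p ∈ (𝓡∂ 4).boundary M, p ∉ cutLocus gbar := fun p hp =>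
    IsC2GeodesicCompactification.notMem_cutLocus_of_boundary hp
  have hbd : ∀ p ∈ (𝓡∂ 4).boundary M, BilinField.scalarCurvature gbar.inner p
      = 3 / 2 * BilinField.boundaryScalarCurvature gbar.inner p :=
    fun p hp => h.scalarCurvature_boundary hg hp
  refine ⟨fun x hx hxc => ?_, hbd, ?_⟩
  · have hp := h.isC2PairAt hxc
    refine ⟨hp.exists_isMIntegralCurveAt hx, fun σ h0 hσ => h.hasDerivAt_scalarCurvature hg hp hx h0 hσ,
      fun hd => ?_, h.mul_hessianNormSq_nonneg hp⟩
    obtain ⟨σ, h0, hσ⟩ := hp.exists_isMIntegralCurveAt hx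
    exact formAt_gradient_of_hasDerivAt hd h0 hσ (h.hasDerivAt_scalarCurvature hg hp hx h0 hσ)
  · have hcont : ContinuousOn (BilinField.scalarCurvature gbar.inner) ((𝓡∂ 4).boundary M) :=
      fun p hp => (h.isC2PairAt (hcut p hp)).metric.continuousAt_scalarCurvature.continuousWithinAt
    -- Compactness gives a minimum of `s` on the boundary. Proportionality with a positive factor
    -- makes it a minimum of `s_γ` as well.
    obtain ⟨p, hp, hmin⟩ := hcpt.exists_isMinOn hne hcont
    have hmin' : ∀ q ∈ (𝓡∂ 4).boundary M, BilinField.scalarCurvature gbar.inner p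
        ≤ BilinField.scalarCurvature gbar.inner q := fun q hq => hmin hq
    refine ⟨p, hp, hmin', fun q hq => ?_, fun x hx => ?_⟩
    · have h1 := hmin' q hq
      rw [hbd p hp, hbd q hq] at h1
      linarith
    · rcases (𝓡∂ 4).isInteriorPoint_or_isBoundaryPoint x with hi | hb
      -- Being off the cut locus means that `x` lies inside a minimizing curve, whose starting value
      -- bounds the value at `x` from below.
      · obtain ⟨σ, b, s, hσ, h0, hs, rfl⟩ := not_not.1 fun hn => hx ⟨hi, hn⟩
        exact (hmin' _ hσ.start).trans (hσ.scalarCurvature_le h hg h0 hs)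
      · exact hmin' x hb
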